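/- **Setting.** Let $s,\alpha,m,m'\in\mathbb N$ with $\alpha\ge 2$ and $1\le m\le m'$, let $\gamma=(\gamma_u)_{u\subseteq\{1,\dots,s\}}$ be non-negative reals, let $p\in\mathbb F_2[x]$ with $\deg p=m'$ and $q=(q_1,\dots,q_s)\in\mathbb F_2[x]^s$. *Function space.* $\mathcal H=\mathcal H_{s,\alpha,\gamma}$ is the space of (continuous representatives on $[0,1]^s$ of) functions whose weak derivatives $f^{(\beta)}$, $\beta\in\{0,\dots,\alpha\}^s$, all lie in $L_2([0,1)^s)$, with the inner product $$\langle f,g\rangle=\sum_{u\subseteq\{1,\dots,s\}}\gamma_u^{-1}\sum_{v\subseteq u}\ \sum_{\tau\in\{1,\dots,\alpha-1\}^{u\setminus v}}\int_{[0,1)^{|v|}}\Big(\int_{[0,1)^{s-|v|}}f^{(\tau_{u\setminus v},\alpha_v,0)}\,dx_{-v}\Big)\Big(\int_{[0,1)^{s-|v|}}g^{(\tau_{u\setminus v},\alpha_v,0)}\,dx_{-v}\Big)dx_v ,$$ where the multi-index $(\tau_{u\setminus v},\alpha_v,0)$ has entry $\tau_j$ for $j\in u\setminus v$, $\alpha$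 for $j\in v$ and $0$ for $j\notin u$. If $\gamma_u=0$, the inner double sum belonging to $u$ is required to vanish for $f\in\mathcal H$, and $0/0=0$. Let $\|f\|=\langle f,f\rangle^{1/2}$. With $B_\tau$ the Bernoulli polynomials, the reproducing kernel is $$\mathcal K(x,y)=\sum_{u\subseteq\{1,\dots,s\}}\gamma_u\prod_{j\in u}\Big(\sum_{\tau=1}^{\alpha}\frac{B_\tau(x_j)B_\tau(y_j)}{(\tau!)^2}+(-1)^{\alpha+1}\frac{B_{2\alpha}(|x_j-y_j|)}{(2\alpha)!}\Big).$$ For $k\in\mathbb N_0$ with binary digits $k=\kappa_0+\kappa_12+\cdots$ and $x\in[0,1)$ with binary digits $x=\xi_12^{-1}+\xi_22^{-2}+\cdots$ (infinitely many $\xi_i\neq1$) let $\mathrm{wal}_k(x)=(-1)^{\kappa_0\xi_1+\kappa_1\xi_2+\cdots}$; for vectors $\mathrm{wal}_{k}(x)=\prod_j\mathrm{wal}_{k_j}(x_j)$. Put $$\hat{\mathcal K}(k,l)=\int_{[0,1)^s}\int_{[0,1)^s}\mathcal K(x,y)\,\mathrm{wal}_k(x)\,\mathrm{wal}_l(y)\,dx\,dy\qquad(k,l\in\mathbb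 N_0^s).$$ *Point set.* Identify $n=n_0+n_12+\cdots$ with $n(x)=n_0+n_1x+\cdots\in\mathbb F_2[x]$, and let $v_{m'}\big(\sum_{l\ge w} t_lx^{-l}\big)=\sum_{l=\max(1,w)}^{m'}t_l2^{-l}$ on $\mathbb F_2((x^{-1}))$. The higher order polynomial lattice point set consists of $x_n=\big(v_{m'}(n q_1/p),\dots,v_{m'}(n q_s/p)\big)$, $0\le n<2^m$. For $\sigma\in[0,1)^s$ let $z_n(\sigma)=\phi(x_n\oplus\sigma)$ componentwise, where $\oplus$ is digitwise addition modulo $2$ of binary expansions and $\phi(x)=1-|2x-1|$. Let $$e(\sigma)=\sup_{f\in\mathcal H,\ \|f\|\le1}\Big|\int_{[0,1)^s}f(x)\,dx-\frac1{2^m}\sum_{n=0}^{2^m-1}f(z_n(\sigma))\Big| .$$ *Index set.* With $\mathrm{tr}_{m'}(k)=\kappa_0+\kappa_1x+\cdots+\kappa_{m'-1}x^{m'-1}$, the dual polynomial lattice is $$\mathcal D^\perp(q,p)=\Big\{k\in\mathbb N_0^s:\ \mathrm{tr}_{m'}(k_1)q_1+\cdots+\mathrm{tr}_{m'}(k_s)q_s\equiv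 a\ (\mathrm{mod}\ p)\ \text{for some } a\in\mathbb F_2[x]\text{ with }\deg a<m'-m\Big\}$$ (where $\deg 0=-\infty$), and $\mathcal E_0$ is the set of positive integers with even binary digit sum, together with $0$. **Theorem 3.1.** The supremum $e(\sigma)$ is finite for every $\sigma\in[0,1)^s$, $e(\sigma)^2$ is integrable over $\sigma\in[0,1)^s$, and the mean square worst-case error is given by the convergent series $$\int_{[0,1)^s}e(\sigma)^2\,d\sigma=\sum_{k\in(\mathcal E_0^s\setminus\{0\})\cap\mathcal D^\perp(q,p)}\hat{\mathcal K}\big(\lfloor k/2\rfloor,\lfloor k/2\rfloor\big),$$ where $\lfloor k/2\rfloor=(\lfloor k_1/2\rfloor,\dots,\lfloor k_s/2\rfloor)$. -/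

import Mathlib

namespace FoldedLattice

noncomputable section

open MeasureTheory Set Polynomial
open scoped ContDiff

/-! ### Cubes -/

/-- The half-open unit cube `[0,1)^ι`. -/
def cube (ι : Type) : Set (ι → ℝ) := Set.univ.pi fun _ => Ico (0 : ℝ) 1

/-- The open unit cube `(0,1)^ι`. -/
def openCube (ι : Type) : Set (ι → ℝ) := Set.univ.pi fun _ => Ioo (0 : ℝ) 1

/-- The closed unit cube `[0,1]^ι`. -/
def closedCube (ι : Type) : Set (ι → ℝ) := Set.univ.pi fun _ => Icc (0 : ℝ) 1

/-! ### Binary digits, polynomials over `𝔽₂`, polynomial lattice point sets -/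

/-- The coefficient `κ_i` in `k = κ_0 + κ_1 2 + κ_2 2^2 + ⋯`. -/
def natDigit (k i : ℕ) : ℕ := k / 2 ^ i % 2

/-- The truncated polynomial `tr_r(k) = κ_0 + κ_1 x + ⋯ + κ_{r-1} x^{r-1}` over `𝔽₂`. -/
def truncPoly (r k : ℕ) : (ZMod 2)[X] :=
  ∑ i ∈ Finset.range r, C (natDigit k i : ZMod 2) * X ^ i

/-- The polynomial `n(x) = n_0 + n_1 x + ⋯` identified with the integer `n`
(`Nat.size n` is the number of binary digits of `n`). -/
def natPoly (n : ℕ) : (ZMod 2)[X] := truncPoly n.size n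

/-- The embedding of `𝔽₂[x]` into the field `𝔽₂((x⁻¹))`. Here `LaurentSeries (ZMod 2)` is read
as a field of series in the variable `x⁻¹`: the coefficient with index `l` is that of `x^(-l)`,
so that `x` is the monomial with index `-1`. -/
def polyToLaurent (f : (ZMod 2)[X]) : LaurentSeries (ZMod 2) :=
  Polynomial.aeval (HahnSeries.single (-1 : ℤ) (1 : ZMod 2) : LaurentSeries (ZMod 2)) f

/-- The map `v_r : ∑ t_l x^(-l) ↦ ∑_{1 ≤ l ≤ r} t_l 2^(-l)`. -/
def laurentToReal (r : ℕ) (L : LaurentSeries (ZMod 2)) : ℝ :=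
  ∑ l ∈ Finset.Icc 1 r, ((L.coeff (l : ℤ)).val : ℝ) / 2 ^ l

/-- The `n`-th point of the higher order polynomial lattice point set with generating
vector `q` and modulus `p`, with coordinates `v_{m'}(n(x) q_j(x) / p(x))`. -/
def latticePoint {s : ℕ} (m' : ℕ) (q : Fin s → (ZMod 2)[X]) (p : (ZMod 2)[X]) (n : ℕ) :
    Fin s → ℝ :=
  fun j => laurentToReal m' (polyToLaurent (natPoly n * q j) / polyToLaurent p)

/-- The dual polynomial lattice: all `k` such that
`tr_{m'}(k_1) q_1 + ⋯ + tr_{m'}(k_s) q_s ≡ a (mod p)` for some `a` with `deg a < m' - m`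
(the zero polynomial has degree `⊥`). -/
def dualLattice {s : ℕ} (m m' : ℕ) (q : Fin s → (ZMod 2)[X]) (p : (ZMod 2)[X]) :
    Set (Fin s → ℕ) :=
  {k | ∃ a : (ZMod 2)[X], a.degree < ((m' - m : ℕ) : WithBot ℕ) ∧
    p ∣ (∑ j, truncPoly m' (k j) * q j) - a}

/-! ### Digital shift and tent transformation -/

/-- Digitwise addition modulo 2 on `[0,1)`; `Real.digits x 2` is the sequence of binary digits
of `x`, and the addition of digits is that of `Fin 2`. -/
def digitalAdd (x y : ℝ) : ℝ := Real.ofDigits fun i => Real.digits x 2 i + Real.digits y 2 i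

/-- The tent transformation. -/
def tent (x : ℝ) : ℝ := 1 - |2 * x - 1|

/-- The point `φ(x ⊕ σ)`, computed componentwise. -/
def shiftFold {s : ℕ} (σ x : Fin s → ℝ) : Fin s → ℝ := fun j => tent (digitalAdd (x j) (σ j))

/-! ### Walsh functions -/

/-- The `k`-th dyadic Walsh function on `[0,1)`; `Real.digits x 2 i` is the digit `ξ_{i+1}`. -/
def walsh (k : ℕ) (x : ℝ) : ℝ :=
  (-1) ^ ∑ i ∈ Finset.range k.size, natDigit k i * (Real.digits x 2 i : ℕ)

/-- The multivariate Walsh function. -/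
def walshMulti {s : ℕ} (k : Fin s → ℕ) (x : Fin s → ℝ) : ℝ := ∏ j, walsh (k j) (x j)

/-! ### The weighted unanchored Sobolev space -/

/-- The classical mixed partial derivative `∂^β φ`, one coordinate after the other. -/
def mixedDeriv {s : ℕ} (β : Fin s → ℕ) (φ : (Fin s → ℝ) → ℝ) : (Fin s → ℝ) → ℝ :=
  (List.finRange s).foldr
    (fun j g x => iteratedDeriv (β j) (fun t => g (Function.update x j t)) (x j)) φ

/-- `g ∈ L²([0,1)^s)` is a weak derivative of order `β` of `f` on the open unit cube. -/
def IsWeakDeriv {s : ℕ} (β : Fin s → ℕ) (f g : (Fin s → ℝ) → ℝ) : Prop :=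
  MemLp g 2 (volume.restrict (cube (Fin s))) ∧
  ∀ φ : (Fin s → ℝ) → ℝ, ContDiff ℝ ∞ φ → HasCompactSupport φ →
    tsupport φ ⊆ openCube (Fin s) →
    ∫ x in cube (Fin s), f x * mixedDeriv β φ x
      = (-1) ^ (∑ j, β j) * ∫ x in cube (Fin s), g x * φ x

open Classical in
/-- The weak derivative `f^(β)` (unique almost everywhere on the cube); `0` if there is none. -/
def weakDeriv {s : ℕ} (β : Fin s → ℕ) (f : (Fin s → ℝ) → ℝ) : (Fin s → ℝ) → ℝ :=
  if h : ∃ g, IsWeakDeriv β f g then Classical.choose h else 0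

/-- The point `x` with `x_v = y` and `x_{-v} = z`. -/
def glue {s : ℕ} (v : Finset (Fin s)) (y : {j // j ∈ v} → ℝ) (z : {j // j ∉ v} → ℝ) :
    Fin s → ℝ :=
  fun j => if h : j ∈ v then y ⟨j, h⟩ else z ⟨j, h⟩

/-- The partial integral `x_v ↦ ∫_{[0,1)^{s-|v|}} g(x) dx_{-v}`. -/
def partialIntegral {s : ℕ} (v : Finset (Fin s)) (g : (Fin s → ℝ) → ℝ)
    (y : {j // j ∈ v} → ℝ) : ℝ :=
  ∫ z in cube {j // j ∉ v}, g (glue v y z)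

/-- The multi-indices `(τ_{u∖v}, α_v, 0)`: the entry is `α` on `v`, runs through
`{1, …, α-1}` on `u ∖ v`, and is `0` off `u`. -/
def multiIndices {s : ℕ} (α : ℕ) (u v : Finset (Fin s)) : Finset (Fin s → ℕ) :=
  Fintype.piFinset fun j =>
    if j ∈ v then {α} else if j ∈ u then Finset.Icc 1 (α - 1) else {0}

/-- The inner double sum (over `v ⊆ u` and over the multi-indices) of the inner product. -/
def innerPart {s : ℕ} (α : ℕ) (u : Finset (Fin s)) (f g : (Fin s → ℝ) → ℝ) : ℝ :=
  ∑ v ∈ u.powerset, ∑ β ∈ multiIndices α u v,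
    ∫ y in cube {j // j ∈ v},
      partialIntegral v (weakDeriv β f) y * partialIntegral v (weakDeriv β g) y

/-- The inner product of the weighted unanchored Sobolev space of smoothness `α`. The terms with
`γ_u = 0` contribute `0`. -/
def sobolevInner {s : ℕ} (α : ℕ) (γ : Finset (Fin s) → ℝ) (f g : (Fin s → ℝ) → ℝ) : ℝ :=
  ∑ u : Finset (Fin s), (γ u)⁻¹ * innerPart α u f g

/-- The norm `⟨f, f⟩^{1/2}`. -/
def sobolevNorm {s : ℕ} (α : ℕ) (γ : Finset (Fin s) → ℝ) (f : (Fin s → ℝ) → ℝ) : ℝ :=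
  √(sobolevInner α γ f f)

/-- Membership in the weighted unanchored Sobolev space of smoothness `α`: `f` is (the continuous
representative of) a function with square integrable weak derivatives of all orders
`β ∈ {0, …, α}^s`, and the inner double sum that belongs to `u` vanishes whenever `γ_u = 0`.
Only the values of `f` on the closed unit cube matter. -/
structure MemSobolev {s : ℕ} (α : ℕ) (γ : Finset (Fin s) → ℝ) (f : (Fin s → ℝ) → ℝ) :
    Prop where
  continuousOn : ContinuousOn f (closedCube (Fin s))
  exists_weakDeriv : ∀ β : Fin s → ℕ, (∀ j, β j ≤ α) → ∃ g, IsWeakDeriv β f g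
  innerPart_eq_zero : ∀ u, γ u = 0 → innerPart α u f f = 0

/-! ### The kernel and its Walsh coefficients -/

/-- The univariate kernel function
`∑_{τ=1}^α B_τ(x) B_τ(y) / (τ!)^2 + (-1)^(α+1) B_{2α}(|x-y|) / (2α)!`. -/
def kernel₁ (α : ℕ) (x y : ℝ) : ℝ :=
  (∑ τ ∈ Finset.Icc 1 α, bernoulliFun τ x * bernoulliFun τ y / ((τ.factorial : ℝ)) ^ 2)
    + (-1) ^ (α + 1) * bernoulliFun (2 * α) |x - y| / ((2 * α).factorial : ℝ)

/-- The reproducing kernel `∑_u γ_u ∏_{j ∈ u} K_1(x_j, y_j)`. -/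
def kernel {s : ℕ} (α : ℕ) (γ : Finset (Fin s) → ℝ) (x y : Fin s → ℝ) : ℝ :=
  ∑ u : Finset (Fin s), γ u * ∏ j ∈ u, kernel₁ α (x j) (y j)

/-- The Walsh coefficient of the kernel with index `(k, l)`. -/
def kernelWalshCoeff {s : ℕ} (α : ℕ) (γ : Finset (Fin s) → ℝ) (k l : Fin s → ℕ) : ℝ :=
  ∫ x in cube (Fin s), ∫ y in cube (Fin s),
    kernel α γ x y * walshMulti k x * walshMulti l y

/-! ### Worst-case errors -/

/-- The equal weight rule `(1/N) ∑_{n < N} f(P_n)`. -/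
def qmc {s : ℕ} (N : ℕ) (P : ℕ → Fin s → ℝ) (f : (Fin s → ℝ) → ℝ) : ℝ :=
  (1 / (N : ℝ)) * ∑ n ∈ Finset.range N, f (P n)

/-- All integration errors `|I(f) - Q(f; P)|` with `f` in the unit ball of the space. -/
def errorSet {s : ℕ} (α : ℕ) (γ : Finset (Fin s) → ℝ) (N : ℕ) (P : ℕ → Fin s → ℝ) : Set ℝ :=
  {r | ∃ f : (Fin s → ℝ) → ℝ, MemSobolev α γ f ∧ sobolevNorm α γ f ≤ 1 ∧
    r = |(∫ x in cube (Fin s), f x) - qmc N P f|}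

/-- The worst-case error. -/
def worstCaseError {s : ℕ} (α : ℕ) (γ : Finset (Fin s) → ℝ) (N : ℕ) (P : ℕ → Fin s → ℝ) : ℝ :=
  sSup (errorSet α γ N P)

/-- The digitally shifted (by `σ`) and then folded lattice point set. -/
def shiftedFoldedPoints {s : ℕ} (m' : ℕ) (q : Fin s → (ZMod 2)[X]) (p : (ZMod 2)[X])
    (σ : Fin s → ℝ) (n : ℕ) : Fin s → ℝ :=
  shiftFold σ (latticePoint m' q p n)

/-- The mean square worst-case error of the randomly digitally shifted and then folded
point set of `2^m` points, the shift being uniformly distributed in the unit cube. -/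
def meanSquareError {s : ℕ} (α : ℕ) (γ : Finset (Fin s) → ℝ) (m m' : ℕ)
    (q : Fin s → (ZMod 2)[X]) (p : (ZMod 2)[X]) : ℝ :=
  ∫ σ in cube (Fin s), (worstCaseError α γ (2 ^ m) (shiftedFoldedPoints m' q p σ)) ^ 2

/-! ### The index set -/

/-- The sum of the binary digits. -/
def digitSum (k : ℕ) : ℕ := (Nat.digits 2 k).sum

/-- The positive integers with even binary digit sum, together with `0`. -/
def evenDigitSum₀ : Set ℕ := {k | 0 < k ∧ digitSum k ≡ 0 [MOD 2]} ∪ {0}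

end

end FoldedLattice

/-! The proof has two halves: a closed form for the squared worst-case error at a fixed shift, and
the average of that form over all shifts.

Closed form. The reproducing property of `kernel` is derived, not assumed. Its source is a
multivariate Bernoulli (Euler–Maclaurin) expansion: a continuous function with square integrable
weak derivatives is a sum over multi-indices of integrals of these derivatives against products of
Bernoulli polynomials and remainder kernels `remKernel` (`eq_expansion`). It is proved weakly:
products of bump functions are integrated by parts against iterated primitives vanishing at both end
points, Fubini returns the kernels to the side of the function, and continuity upgrades the result
to every point of the closed cube. On the other side, differentiating a section of the kernel and
integrating out the coordinates outside `v` gives exactly the same building blocks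
(`partialIntegral_familyProd_kernelFamily`). Pairing with a kernel section therefore evaluates a
part of the expansion (`MemSobolev.sobolevInner_kernelComb`), and the integration error is the inner
product with an explicit combination of sections. Cauchy–Schwarz and the normalised representer give
the attained supremum, whose square is a double mean of `kernel` minus `γ ∅`
(`isGreatest_errorSet`).

Average. On Rademacher functions the tent map acts, off the dyadic rationals, by sending the digit
function of index `i` to the product of those of indices `0` and `i + 1` (`rad_tent`). So composing
the Walsh function of index `l` with the tent map yields the Walsh function of index `evenLift l`,
the only element of `evenDigitSum₀` with half `l`. A digital shift multiplies Walsh functions by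
signs and preserves measure. Formally, the shift average of the kernel at two lattice points `x`,
`y` is the sum over `l` of the diagonal coefficient times the lifted Walsh functions at `x` and `y`.
To justify this without prior summability, sums over dyadic boxes are rewritten with the
Walsh–Dirichlet kernel, an approximate identity, and converge by uniform continuity (`boxSum_eq`,
`tendsto_boxSum`).

Averaging over all pairs of lattice points replaces each product of Walsh values by the indicator of
the dual lattice (`sum_walshMulti_latticePoint`). The diagonal coefficients are nonnegative because
the kernel is a Gram kernel (`kernelWalshCoeff_nonneg`), so convergence along boxes is already
unconditional convergence. The coefficient at zero equals `γ ∅` and cancels the constant subtracted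
in the closed form. -/

namespace FoldedLattice
noncomputable section
open MeasureTheory Set Polynomial
open scoped ContDiff

/-! ### One variable: Bernoulli polynomials, derivatives of the kernel, iterated primitives. -/

/-! ### Normalised Bernoulli polynomials and their periodic translates -/

/-- The normalised Bernoulli polynomial `B_n(x) / n!`. -/
def nbern (n : ℕ) (x : ℝ) : ℝ := bernoulliFun n x / (n.factorial : ℝ)

/-- The value at `t - x` of the periodisation of `nbern n`, for `x, t ∈ [0,1]`. -/
def pbern (n : ℕ) (t x : ℝ) : ℝ := if x ≤ t then nbern n (t - x) else nbern n (t - x + 1)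

/-- The kernel of the remainder term of the Bernoulli expansion of order `n`. -/
def remKernel (n : ℕ) (x t : ℝ) : ℝ := nbern n x - (-1) ^ n * pbern n t x

lemma nbern_zero (x : ℝ) : nbern 0 x = 1 := by simp [nbern]

lemma nbern_one (x : ℝ) : nbern 1 x = x - 1 / 2 := by simp [nbern]

@[fun_prop]
lemma continuous_nbern (n : ℕ) : Continuous (nbern n) := by
  unfold nbern
  fun_prop

lemma hasDerivAt_nbern (n : ℕ) (x : ℝ) : HasDerivAt (nbern (n + 1)) (nbern n x) x := by
  have h := (hasDerivAt_bernoulliFun (n + 1) x).div_const ((n + 1).factorial : ℝ)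
  convert! h using 1
  simp only [nbern, Nat.add_sub_cancel, Nat.factorial_succ]
  push_cast
  have : (n.factorial : ℝ) ≠ 0 := by positivity
  have : (n : ℝ) + 1 ≠ 0 := by positivity
  field_simp

lemma nbern_eval_one {n : ℕ} (hn : n ≠ 1) : nbern n 1 = nbern n 0 := by
  simp [nbern, bernoulliFun_endpoints_eq_of_ne_one hn]

lemma integral_nbern {n : ℕ} (hn : n ≠ 0) : ∫ x in (0 : ℝ)..1, nbern n x = 0 := by
  simp [nbern, integral_bernoulliFun_eq_zero hn]

lemma nbern_one_sub (n : ℕ) (x : ℝ) : nbern n (1 - x) = (-1) ^ n * nbern n x := by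
  simp [nbern, bernoulliFun_eval_one_sub, mul_div_assoc]

lemma measurable_pbern (n : ℕ) : Measurable fun z : ℝ × ℝ => pbern n z.1 z.2 := by
  unfold pbern
  refine Measurable.ite (measurableSet_le (by fun_prop) (by fun_prop)) ?_ ?_
  · exact ((continuous_nbern n).comp (by fun_prop)).measurable
  · exact ((continuous_nbern n).comp (by fun_prop)).measurable

lemma continuous_pbern {n : ℕ} (hn : n ≠ 1) : Continuous fun z : ℝ × ℝ => pbern n z.1 z.2 := by
  unfold pbern
  refine Continuous.if_le ((continuous_nbern n).comp (by fun_prop))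
    ((continuous_nbern n).comp (by fun_prop)) (by fun_prop) (by fun_prop) ?_
  intro z hz
  simp [hz, nbern_eval_one hn]

/-- Neither `n` nor `n + 1` is `1`, so both Bernoulli polynomials take equal values at `0` and `1`;
at `t = x` the two branches agree together with their one-sided derivatives. -/
lemma hasDerivAt_pbern {n : ℕ} (hn : 2 ≤ n) (t x : ℝ) :
    HasDerivAt (fun t => pbern (n + 1) t x) (pbern n t x) t := by
  have h1 : HasDerivAt (fun t => nbern (n + 1) (t - x)) (nbern n (t - x)) t :=
    (hasDerivAt_nbern n (t - x)).comp_sub_const t x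
  have h2 : HasDerivAt (fun t => nbern (n + 1) (t - x + 1)) (nbern n (t - x + 1)) t := by
    have := (hasDerivAt_nbern n (t - (x - 1))).comp_sub_const t (x - 1)
    convert! this using 2 <;> ring_nf
  rcases lt_trichotomy x t with h | h | h
  · rw [pbern, if_pos h.le]
    refine h1.congr_of_eventuallyEq ?_
    filter_upwards [lt_mem_nhds h] with y hy
    simp [pbern, hy.le]
  · subst h
    have e : pbern n x x = nbern n (x - x) := by simp [pbern]
    have e' : nbern n (x - x) = nbern n (x - x + 1) := by
      simp [nbern_eval_one (show n ≠ 1 by omega)]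
    have e1 : nbern (n + 1) (x - x) = nbern (n + 1) (x - x + 1) := by
      simp [nbern_eval_one (show n + 1 ≠ 1 by omega)]
    rw [e]
    have hr : HasDerivWithinAt (fun t => pbern (n + 1) t x) (nbern n (x - x)) (Ici x) x := by
      refine h1.hasDerivWithinAt.congr (fun y hy => ?_) ?_
      · simp [pbern, mem_Ici.1 hy]
      · simp [pbern]
    have hl : HasDerivWithinAt (fun t => pbern (n + 1) t x) (nbern n (x - x)) (Iic x) x := by
      rw [e']
      refine h2.hasDerivWithinAt.congr (fun y hy => ?_) ?_
      · rcases (mem_Iic.1 hy).lt_or_eq with hy' | rfl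
        · simp [pbern, hy']
        · simpa [pbern] using e1
      · simpa [pbern] using e1
    have := hl.union hr
    rwa [Iic_union_Ici, hasDerivWithinAt_univ] at this
  · rw [pbern, if_neg h.not_ge]
    refine h2.congr_of_eventuallyEq ?_
    filter_upwards [gt_mem_nhds h] with y hy
    simp [pbern, hy]

/-- The branch `x ≤ t` is closed, so right derivatives survive even the jump of the periodised
`B_1`. This is all the fundamental theorem of calculus needs, and it makes `n = 1` available in the
integrals below. -/
lemma hasDerivWithinAt_pbern (n : ℕ) (t x : ℝ) :
    HasDerivWithinAt (fun t => pbern (n + 1) t x) (pbern n t x) (Ioi t) t := by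
  have h1 : HasDerivAt (fun t => nbern (n + 1) (t - x)) (nbern n (t - x)) t :=
    (hasDerivAt_nbern n (t - x)).comp_sub_const t x
  have h2 : HasDerivAt (fun t => nbern (n + 1) (t - x + 1)) (nbern n (t - x + 1)) t := by
    have := (hasDerivAt_nbern n (t - (x - 1))).comp_sub_const t (x - 1)
    convert! this using 2 <;> ring_nf
  rcases le_or_gt x t with h | h
  · rw [pbern, if_pos h]
    refine h1.hasDerivWithinAt.congr (fun y hy => ?_) ?_
    · simp [pbern, h.trans (mem_Ioi.1 hy).le]
    · simp [pbern, h]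
  · rw [pbern, if_neg h.not_ge]
    refine HasDerivAt.hasDerivWithinAt (h2.congr_of_eventuallyEq ?_)
    filter_upwards [gt_mem_nhds h] with y hy
    simp [pbern, hy]

lemma exists_bound_nbern (n : ℕ) : ∃ C, ∀ x ∈ Icc (-1 : ℝ) 2, |nbern n x| ≤ C := by
  obtain ⟨C, hC⟩ := isCompact_Icc.exists_bound_of_continuousOn
    (continuous_nbern n).continuousOn (s := Icc (-1 : ℝ) 2)
  exact ⟨C, fun x hx => hC x hx⟩

lemma exists_bound_pbern (n : ℕ) :
    ∃ C, ∀ t ∈ Icc (0 : ℝ) 1, ∀ x ∈ Icc (0 : ℝ) 1, |pbern n t x| ≤ C := by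
  obtain ⟨C, hC⟩ := exists_bound_nbern n
  refine ⟨C, fun t ht x hx => ?_⟩
  rw [mem_Icc] at ht hx
  unfold pbern
  split_ifs with h
  · exact hC _ ⟨by linarith, by linarith⟩
  · exact hC _ ⟨by linarith, by linarith⟩

lemma exists_bound_remKernel (n : ℕ) :
    ∃ C, ∀ x ∈ Icc (0 : ℝ) 1, ∀ t ∈ Icc (0 : ℝ) 1, |remKernel n x t| ≤ C := by
  obtain ⟨C, hC⟩ := exists_bound_nbern n
  obtain ⟨C', hC'⟩ := exists_bound_pbern n
  refine ⟨C + C', fun x hx t ht => ?_⟩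
  unfold remKernel
  refine (abs_sub _ _).trans (add_le_add (hC x ⟨by linarith [hx.1], by linarith [hx.2]⟩) ?_)
  rw [abs_mul, abs_pow, abs_neg, abs_one, one_pow, one_mul]
  exact hC' t ht x hx

lemma measurable_remKernel (n : ℕ) : Measurable fun z : ℝ × ℝ => remKernel n z.1 z.2 := by
  unfold remKernel
  refine Measurable.sub ((continuous_nbern n).comp continuous_fst).measurable ?_
  exact ((measurable_pbern n).comp (measurable_snd.prodMk measurable_fst)).const_mul _

lemma continuous_remKernel {n : ℕ} (hn : n ≠ 1) :
    Continuous fun z : ℝ × ℝ => remKernel n z.1 z.2 := by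
  unfold remKernel
  refine Continuous.sub (by fun_prop) (Continuous.mul (by fun_prop) ?_)
  exact (continuous_pbern hn).comp (continuous_snd.prodMk continuous_fst)

lemma intervalIntegrable_of_bound {f : ℝ → ℝ} (hf : Measurable f) {C : ℝ}
    (hC : ∀ x ∈ Icc (0 : ℝ) 1, |f x| ≤ C) {a b : ℝ} (ha : a ∈ Icc (0 : ℝ) 1)
    (hb : b ∈ Icc (0 : ℝ) 1) : IntervalIntegrable f volume a b := by
  rw [intervalIntegrable_iff]
  refine Measure.integrableOn_of_bounded (M := C) (by simp) hf.aestronglyMeasurable ?_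
  refine (ae_restrict_iff' measurableSet_uIoc).2 (.of_forall fun x hx => hC x ?_)
  have := uIoc_subset_uIcc hx
  rw [mem_uIcc] at this
  rw [mem_Icc] at *
  rcases this with h | h <;> constructor <;> linarith

lemma integral_pbern_left (n : ℕ) {x a t : ℝ} (hx : x ∈ Icc (0 : ℝ) 1) (hn : n ≠ 0)
    (ha : a ∈ Icc (0 : ℝ) 1) (ht : t ∈ Icc (0 : ℝ) 1) :
    ∫ r in a..t, pbern n r x = pbern (n + 1) t x - pbern (n + 1) a x := by
  obtain ⟨C, hC⟩ := exists_bound_pbern n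
  refine intervalIntegral.integral_eq_sub_of_hasDeriv_right ?_
    (fun r _ => hasDerivWithinAt_pbern n r x) ?_
  · exact ((continuous_pbern (show n + 1 ≠ 1 by omega)).comp
      (continuous_id.prodMk continuous_const)).continuousOn
  · exact intervalIntegrable_of_bound
      ((measurable_pbern n).comp (measurable_id.prodMk measurable_const))
      (fun r hr => hC r hr x hx) ha ht

lemma pbern_zero_left {n : ℕ} (hn : n ≠ 1) {x : ℝ} (hx : x ∈ Icc (0 : ℝ) 1) :
    pbern n 0 x = (-1) ^ n * nbern n x := by
  rw [← nbern_one_sub]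
  unfold pbern
  split_ifs with h
  · have : x = 0 := le_antisymm h hx.1
    simp [this, nbern_eval_one hn]
  · ring_nf

lemma pbern_one_left {n : ℕ} {x : ℝ} (hx : x ∈ Icc (0 : ℝ) 1) :
    pbern n 1 x = (-1) ^ n * nbern n x := by
  rw [← nbern_one_sub, pbern, if_pos hx.2]

lemma integral_pbern_eq_zero {n : ℕ} (hn : n ≠ 0) {x : ℝ} (hx : x ∈ Icc (0 : ℝ) 1) :
    ∫ r in (0 : ℝ)..1, pbern n r x = 0 := by
  rw [integral_pbern_left n hx hn ⟨le_rfl, zero_le_one⟩ ⟨zero_le_one, le_rfl⟩,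
    pbern_zero_left (by omega) hx, pbern_one_left hx, sub_self]

/-- The recursion of `iterPrim` at the level of kernels: `t` times the full integral minus the
integral up to `t` turns the kernel of order `n` into that of order `n + 1`. -/
lemma integral_remKernel (n : ℕ) (hn : n ≠ 0) {x t : ℝ} (hx : x ∈ Icc (0 : ℝ) 1)
    (ht : t ∈ Icc (0 : ℝ) 1) :
    ∫ r in (0 : ℝ)..t, remKernel n x r = t * nbern n x - remKernel (n + 1) x t := by
  obtain ⟨C, hC⟩ := exists_bound_pbern n
  unfold remKernel
  rw [intervalIntegral.integral_sub (by simp), intervalIntegral.integral_const_mul,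
    integral_pbern_left n hx hn ⟨le_rfl, zero_le_one⟩ ht, pbern_zero_left (by omega) hx]
  · simp only [intervalIntegral.integral_const, smul_eq_mul]
    have : ((-1 : ℝ) ^ n) * (-1) ^ n = 1 := by rw [← mul_pow]; simp
    rw [pow_succ]
    linear_combination (-nbern (n + 1) x) * this
  · exact (intervalIntegrable_of_bound
      ((measurable_pbern n).comp (measurable_id.prodMk measurable_const))
      (fun r hr => hC r hr x hx) ⟨le_rfl, zero_le_one⟩ ht).const_mul _

lemma integral_remKernel_one (n : ℕ) (hn : n ≠ 0) {x : ℝ} (hx : x ∈ Icc (0 : ℝ) 1) :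
    ∫ r in (0 : ℝ)..1, remKernel n x r = nbern n x := by
  rw [integral_remKernel n hn hx ⟨zero_le_one, le_rfl⟩, remKernel, pbern_one_left hx]
  have : ((-1 : ℝ) ^ (n + 1)) * (-1) ^ (n + 1) = 1 := by rw [← mul_pow]; simp
  linear_combination (nbern (n + 1) x) * this

lemma remKernel_one (x t : ℝ) : remKernel 1 x t = if x ≤ t then t - 1 else t := by
  simp only [remKernel, pbern, nbern_one]
  split_ifs <;> ring

/-! ### The univariate kernel and its derivatives -/

lemma kernel₁_eq (α : ℕ) (x y : ℝ) :
    kernel₁ α x y = (∑ τ ∈ Finset.Icc 1 α, nbern τ x * nbern τ y)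
      + (-1) ^ (α + 1) * pbern (2 * α) x y := by
  have hp : pbern (2 * α) x y = bernoulliFun (2 * α) |x - y| / ((2 * α).factorial : ℝ) := by
    unfold pbern
    split_ifs with h
    · rw [abs_of_nonneg (by linarith), nbern]
    · rw [abs_of_neg (by linarith), show x - y + 1 = 1 - -(x - y) by ring, nbern_one_sub, nbern]
      simp
  rw [kernel₁, hp, mul_div_assoc]
  congr 1
  refine Finset.sum_congr rfl fun τ _ => ?_
  rw [nbern, nbern]
  have : (τ.factorial : ℝ) ≠ 0 := by positivity
  field_simp

/-- The `i`-th derivative of `kernel₁ α · z`, for `i ≤ α`. -/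
def kernelDeriv (α i : ℕ) (z x : ℝ) : ℝ :=
  (∑ τ ∈ Finset.Icc 1 α, (if i ≤ τ then nbern (τ - i) x else 0) * nbern τ z)
    + (-1) ^ (α + 1) * pbern (2 * α - i) x z

lemma kernelDeriv_zero (α : ℕ) (z x : ℝ) : kernelDeriv α 0 z x = kernel₁ α x z := by
  simp [kernelDeriv, kernel₁_eq]

/-- After `α` derivatives only the summand `τ = α` is left, with `B_0` as its factor. That the top
derivative of a kernel section is the remainder kernel of the Bernoulli expansion is the
one-dimensional reason for the reproducing property. -/
lemma kernelDeriv_self {α : ℕ} (hα : 1 ≤ α) (z x : ℝ) :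
    kernelDeriv α α z x = remKernel α z x := by
  have h2 : 2 * α - α = α := by omega
  rw [kernelDeriv, remKernel, Finset.sum_eq_single α, h2]
  · simp [nbern_zero, pow_succ]
    ring
  · intro τ hτ hne
    have := (Finset.mem_Icc.1 hτ).2
    rw [if_neg (by omega), zero_mul]
  · intro h
    exact absurd (Finset.mem_Icc.2 ⟨hα, le_rfl⟩) h

lemma continuous_kernelDeriv {α i : ℕ} (hα : 2 ≤ α) (hi : i ≤ α) (z : ℝ) :
    Continuous (kernelDeriv α i z) := by
  unfold kernelDeriv
  refine Continuous.add (continuous_finsetSum _ fun τ _ => ?_) (continuous_const.mul ?_)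
  · split_ifs <;> fun_prop
  · exact (continuous_pbern (by omega)).comp (continuous_id.prodMk continuous_const)

lemma hasDerivAt_kernelDeriv {α i : ℕ} (hα : 2 ≤ α) (hi : i < α) (z x : ℝ) :
    HasDerivAt (kernelDeriv α i z) (kernelDeriv α (i + 1) z x) x := by
  unfold kernelDeriv
  refine HasDerivAt.add (HasDerivAt.fun_sum fun τ _ => HasDerivAt.mul_const ?_ _)
    (HasDerivAt.const_mul _ ?_)
  · rcases lt_trichotomy τ i with h | h | h
    · rw [if_neg (by omega)]
      simp only [if_neg h.not_ge]
      exact hasDerivAt_const _ _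
    · subst h
      rw [if_neg (by omega)]
      simp only [le_refl, if_true, Nat.sub_self, nbern_zero]
      exact hasDerivAt_const _ _
    · rw [if_pos (by omega)]
      simp only [h.le, if_true]
      rw [show τ - i = τ - (i + 1) + 1 by omega]
      exact hasDerivAt_nbern _ _
  -- Since `i < α`, the new index `2α - (i + 1)` is at least `α ≥ 2`, the range in which the
  -- periodised polynomial is differentiable.
  · rw [show 2 * α - i = 2 * α - (i + 1) + 1 by omega]
    exact hasDerivAt_pbern (by omega) _ _

/-- Bernoulli polynomials of positive degree and their periodisations have mean zero, so only the
summand `τ = i` contributes; the sum has no such summand when `i = 0`. -/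
lemma integral_kernelDeriv {α i : ℕ} (hα : 2 ≤ α) (hi : i < α) {z : ℝ} (hz : z ∈ Icc (0 : ℝ) 1) :
    ∫ x in (0 : ℝ)..1, kernelDeriv α i z x = if i = 0 then 0 else nbern i z := by
  unfold kernelDeriv
  have hint : ∀ τ ∈ Finset.Icc 1 α, IntervalIntegrable
      (fun x => (if i ≤ τ then nbern (τ - i) x else 0) * nbern τ z) volume 0 1 := by
    intro τ _
    split_ifs
    · exact Continuous.intervalIntegrable (by fun_prop) _ _
    · simp
  rw [intervalIntegral.integral_add, intervalIntegral.integral_finsetSum hint,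
    intervalIntegral.integral_const_mul, integral_pbern_eq_zero (by omega) hz, mul_zero, add_zero]
  · have key : ∀ τ ∈ Finset.Icc 1 α, (∫ x in (0 : ℝ)..1,
        (if i ≤ τ then nbern (τ - i) x else 0) * nbern τ z) = if τ = i then nbern τ z else 0 := by
      intro τ _
      rw [intervalIntegral.integral_mul_const]
      rcases lt_trichotomy τ i with h | h | h
      · simp [h.not_ge, h.ne]
      · simp [h, nbern_zero]
      · simp only [h.le, if_true, h.ne', if_false]
        rw [integral_nbern (by omega), zero_mul]
    rw [Finset.sum_congr rfl key, Finset.sum_ite_eq']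
    by_cases h0 : i = 0
    · simp [h0]
    · rw [if_pos (Finset.mem_Icc.2 ⟨by omega, hi.le⟩), if_neg h0]
  · simpa only [← Finset.sum_fn] using IntervalIntegrable.sum _ hint
  · refine Continuous.intervalIntegrable (continuous_const.mul ?_) _ _
    exact (continuous_pbern (by omega)).comp (continuous_id.prodMk continuous_const)

/-! ### Iterated mean-free primitives -/

/-- The iterated primitives `Φ_0 = φ`, `Φ_{n+1}(t) = t ∫_0^1 Φ_n - ∫_0^t Φ_n`. -/
def iterPrim (φ : ℝ → ℝ) : ℕ → ℝ → ℝ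
  | 0 => φ
  | n + 1 => fun t => t * (∫ x in (0 : ℝ)..1, iterPrim φ n x) - ∫ x in (0 : ℝ)..t, iterPrim φ n x

lemma hasDerivAt_prim_sub {φ : ℝ → ℝ} (hφ : Continuous φ) (c t : ℝ) :
    HasDerivAt (fun t => t * c - ∫ x in (0 : ℝ)..t, φ x) (c - φ t) t := by
  have h1 : HasDerivAt (fun t : ℝ => t * c) c t := by
    simpa using (hasDerivAt_id t).mul_const c
  exact h1.sub (intervalIntegral.integral_hasDerivAt_right (hφ.intervalIntegrable _ _)
    hφ.stronglyMeasurable.stronglyMeasurableAtFilter hφ.continuousAt)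

lemma contDiff_iterPrim {φ : ℝ → ℝ} (hφ : ContDiff ℝ ∞ φ) (n : ℕ) :
    ContDiff ℝ ∞ (iterPrim φ n) := by
  induction n with
  | zero => exact hφ
  | succ n ih =>
    have hd := hasDerivAt_prim_sub ih.continuous (∫ x in (0 : ℝ)..1, iterPrim φ n x)
    rw [contDiff_infty_iff_deriv]
    refine ⟨fun t => (hd t).differentiableAt, ?_⟩
    have : deriv (iterPrim φ (n + 1)) =
        fun t => (∫ x in (0 : ℝ)..1, iterPrim φ n x) - iterPrim φ n t :=
      funext fun t => (hd t).deriv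
    rw [this]
    exact contDiff_const.sub ih

/-- Each primitive vanishes at `0` and `1`, so this formula amounts to `∫ g Φ_n = (∫ Φ_n) (∫ g) + ∫
g' Φ_{n+1}`: one integration by parts splits off a mean and leaves no boundary term. -/
lemma deriv_iterPrim {φ : ℝ → ℝ} (hφ : ContDiff ℝ ∞ φ) (n : ℕ) :
    deriv (iterPrim φ (n + 1)) =
      fun t => (∫ x in (0 : ℝ)..1, iterPrim φ n x) - iterPrim φ n t :=
  funext fun t => (hasDerivAt_prim_sub (contDiff_iterPrim hφ n).continuous _ t).deriv

lemma iterPrim_apply_zero (φ : ℝ → ℝ) (n : ℕ) : iterPrim φ (n + 1) 0 = 0 := by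
  simp [iterPrim]

lemma iterPrim_apply_one (φ : ℝ → ℝ) (n : ℕ) : iterPrim φ (n + 1) 1 = 0 := by
  simp [iterPrim]

lemma integral_integral_remKernel_swap {φ : ℝ → ℝ} (hφ : Continuous φ) (n : ℕ) {t : ℝ}
    (ht : t ∈ Icc (0 : ℝ) 1) :
    ∫ r in (0 : ℝ)..t, ∫ x in (0 : ℝ)..1, remKernel n x r * φ x =
      ∫ x in (0 : ℝ)..1, (∫ r in (0 : ℝ)..t, remKernel n x r) * φ x := by
  obtain ⟨C, hC⟩ := exists_bound_remKernel n
  obtain ⟨C', hC'⟩ := isCompact_Icc.exists_bound_of_continuousOn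
    hφ.continuousOn (s := Icc (0 : ℝ) 1)
  have := intervalIntegral_intervalIntegral_swap (a := 0) (b := t) (c := (0 : ℝ)) (d := 1)
    (F := fun r x => remKernel n x r * φ x) ?_
  · rw [this]
    simp only [intervalIntegral.integral_mul_const]
  · rw [uIoc_of_le ht.1, uIoc_of_le zero_le_one]
    refine Measure.integrableOn_of_bounded (M := C * C') ?_ ?_ ?_
    · rw [Measure.volume_eq_prod, Measure.prod_prod]
      simp
    · refine Measurable.aestronglyMeasurable ?_
      exact ((measurable_remKernel n).comp (measurable_snd.prodMk measurable_fst)).mul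
        (hφ.measurable.comp measurable_snd)
    · refine (ae_restrict_iff' (measurableSet_Ioc.prod measurableSet_Ioc)).2 (.of_forall ?_)
      rintro ⟨r, x⟩ ⟨hr, hx⟩
      have hx' : x ∈ Icc (0 : ℝ) 1 := Ioc_subset_Icc_self hx
      have hr' : r ∈ Icc (0 : ℝ) 1 := ⟨hr.1.le, hr.2.trans ht.2⟩
      rw [Function.uncurry_apply_pair, norm_mul]
      have h0 := hC x hx' r hr'
      exact mul_le_mul h0 (hC' x hx') (norm_nonneg _) ((abs_nonneg _).trans h0)

/-- The explicit kernel of the iterated primitives, by induction: for one step `[0,1]` is split at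
`t`, and afterwards `integral_remKernel` under Fubini advances the order. The mean of a primitive is
read off at `t = 1`. -/
lemma iterPrim_eq_integral {φ : ℝ → ℝ} (hφ : ContDiff ℝ ∞ φ) (n : ℕ) :
    (∀ t ∈ Icc (0 : ℝ) 1,
      iterPrim φ (n + 1) t = ∫ x in (0 : ℝ)..1, remKernel (n + 1) x t * φ x) ∧
    ∫ x in (0 : ℝ)..1, iterPrim φ n x = ∫ x in (0 : ℝ)..1, nbern n x * φ x := by
  have hc := hφ.continuous
  have hI : ∀ n : ℕ, ∀ t ∈ Icc (0 : ℝ) 1,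
      IntervalIntegrable (fun x => remKernel n x t * φ x) volume 0 1 := by
    intro n t ht
    obtain ⟨C, hC⟩ := exists_bound_remKernel n
    exact (intervalIntegrable_of_bound
      ((measurable_remKernel n).comp (measurable_id.prodMk measurable_const))
      (fun x hx => hC x hx t ht) ⟨le_rfl, zero_le_one⟩ ⟨zero_le_one, le_rfl⟩).mul_continuousOn
      hc.continuousOn
  induction n with
  | zero =>
    refine ⟨fun t ht => ?_, by simp [iterPrim, nbern_zero]⟩
    have h01 : IntervalIntegrable (fun x => remKernel 1 x t * φ x) volume 0 t :=
      (hI 1 t ht).mono_set (by rw [uIcc_of_le ht.1, uIcc_of_le zero_le_one]; exact Icc_subset_Icc_right ht.2)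
    have h02 : IntervalIntegrable (fun x => remKernel 1 x t * φ x) volume t 1 :=
      (hI 1 t ht).mono_set (by rw [uIcc_of_le ht.2, uIcc_of_le zero_le_one]; exact Icc_subset_Icc_left ht.1)
    simp only [iterPrim, zero_add]
    rw [← intervalIntegral.integral_add_adjacent_intervals h01 h02,
      ← intervalIntegral.integral_add_adjacent_intervals (hc.intervalIntegrable 0 t)
        (hc.intervalIntegrable t 1)]
    have e1 : ∫ x in (0 : ℝ)..t, remKernel 1 x t * φ x = ∫ x in (0 : ℝ)..t, (t - 1) * φ x := by
      refine intervalIntegral.integral_congr fun x hx => ?_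
      rw [uIcc_of_le ht.1] at hx
      simp [remKernel_one, hx.2]
    have e2 : ∫ x in t..1, remKernel 1 x t * φ x = ∫ x in t..1, t * φ x := by
      refine intervalIntegral.integral_congr_ae (.of_forall fun x hx => ?_)
      rw [uIoc_of_le ht.2] at hx
      simp [remKernel_one, hx.1]
    rw [e1, e2, intervalIntegral.integral_const_mul, intervalIntegral.integral_const_mul]
    ring
  | succ n ih =>
    obtain ⟨ih1, -⟩ := ih
    have key : ∀ t ∈ Icc (0 : ℝ) 1, ∫ r in (0 : ℝ)..t, iterPrim φ (n + 1) r =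
        ∫ x in (0 : ℝ)..1, (∫ r in (0 : ℝ)..t, remKernel (n + 1) x r) * φ x := by
      intro t ht
      rw [← integral_integral_remKernel_swap hc _ ht]
      refine intervalIntegral.integral_congr fun r hr => ih1 r ?_
      rw [uIcc_of_le ht.1] at hr
      exact ⟨hr.1, hr.2.trans ht.2⟩
    have h1 : ∫ x in (0 : ℝ)..1, iterPrim φ (n + 1) x =
        ∫ x in (0 : ℝ)..1, nbern (n + 1) x * φ x := by
      rw [key 1 ⟨zero_le_one, le_rfl⟩]
      refine intervalIntegral.integral_congr fun x hx => ?_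
      rw [uIcc_of_le zero_le_one] at hx
      simp only [integral_remKernel_one (n + 1) (by omega) hx]
    refine ⟨fun t ht => ?_, h1⟩
    simp only [iterPrim]
    simp only [iterPrim] at h1 key
    rw [h1, key t ht, ← intervalIntegral.integral_const_mul,
      ← intervalIntegral.integral_sub]
    · refine intervalIntegral.integral_congr fun x hx => ?_
      rw [uIcc_of_le zero_le_one] at hx
      simp only [integral_remKernel (n + 1) (by omega) hx ht]
      ring
    · exact Continuous.intervalIntegrable (by fun_prop) _ _
    · refine IntervalIntegrable.congr_ae
        (f := fun x => t * (nbern (n + 1) x * φ x) - remKernel (n + 1 + 1) x t * φ x) ?_ ?_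
      · exact (Continuous.intervalIntegrable (by fun_prop) _ _).sub (hI _ t ht)
      · refine (ae_restrict_iff' measurableSet_uIoc).2 (.of_forall fun x hx => ?_)
        rw [uIoc_of_le zero_le_one] at hx
        simp only [integral_remKernel (n + 1) (by omega) (Ioc_subset_Icc_self hx) ht]
        ring

end
end FoldedLattice

/-! ### Integration by parts for weak derivatives and the weak form of the Bernoulli expansion. -/

namespace FoldedLattice
noncomputable section
open MeasureTheory Set Polynomial
open scoped ContDiff

/-! ### The cubes as measurable spaces -/

lemma measurableSet_cube (ι : Type) [Fintype ι] : MeasurableSet (cube ι) :=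
  MeasurableSet.univ_pi fun _ => measurableSet_Ico

lemma isOpen_openCube (ι : Type) [Fintype ι] : IsOpen (openCube ι) :=
  isOpen_set_pi finite_univ fun _ _ => isOpen_Ioo

lemma isCompact_closedCube (ι : Type) : IsCompact (closedCube ι) :=
  isCompact_univ_pi fun _ => isCompact_Icc

lemma openCube_subset_cube (ι : Type) : openCube ι ⊆ cube ι :=
  pi_mono fun _ _ => Ioo_subset_Ico_self

lemma cube_subset_closedCube (ι : Type) : cube ι ⊆ closedCube ι :=
  pi_mono fun _ _ => Ico_subset_Icc_self

lemma volume_cube (ι : Type) [Fintype ι] : volume (cube ι) = 1 := by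
  simp [cube, volume_pi_pi]

instance isProbabilityMeasure_cube (ι : Type) [Fintype ι] :
    IsProbabilityMeasure (volume.restrict (cube ι)) :=
  ⟨by rw [Measure.restrict_apply_univ, volume_cube]⟩

lemma openCube_ae_eq_cube (ι : Type) [Fintype ι] : openCube ι =ᵐ[volume] cube ι :=
  (Measure.univ_pi_Ioo_ae_eq_Icc (μ := fun _ : ι => (volume : Measure ℝ))
    (f := fun _ => 0) (g := fun _ => 1)).trans
  (Measure.univ_pi_Ico_ae_eq_Icc (μ := fun _ : ι => (volume : Measure ℝ))
    (f := fun _ => 0) (g := fun _ => 1)).symm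

lemma restrict_cube_eq_restrict_openCube (ι : Type) [Fintype ι] :
    (volume : Measure (ι → ℝ)).restrict (cube ι) = volume.restrict (openCube ι) :=
  (Measure.restrict_congr_set (openCube_ae_eq_cube ι)).symm

lemma ae_mem_openCube (ι : Type) [Fintype ι] :
    ∀ᵐ x ∂(volume : Measure (ι → ℝ)).restrict (cube ι), x ∈ openCube ι := by
  rw [restrict_cube_eq_restrict_openCube]
  exact ae_restrict_mem (isOpen_openCube ι).measurableSet

lemma ae_mem_cube (ι : Type) [Fintype ι] :
    ∀ᵐ x ∂(volume : Measure (ι → ℝ)).restrict (cube ι), x ∈ cube ι :=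
  ae_restrict_mem (measurableSet_cube ι)

/-! ### Smooth cut-off functions on the unit interval -/

lemma deriv_smoothTransition_eq_zero {y : ℝ} (hy : y ∉ Icc (0 : ℝ) 1) :
    deriv Real.smoothTransition y = 0 := by
  rw [mem_Icc, not_and_or, not_le, not_le] at hy
  rcases hy with hy | hy
  · have : Real.smoothTransition =ᶠ[nhds y] fun _ => 0 := by
      filter_upwards [gt_mem_nhds hy] with z hz using Real.smoothTransition.zero_of_nonpos hz.le
    rw [this.deriv_eq, deriv_const]
  · have : Real.smoothTransition =ᶠ[nhds y] fun _ => 1 := by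
      filter_upwards [lt_mem_nhds hy] with z hz using Real.smoothTransition.one_of_one_le hz.le
    rw [this.deriv_eq, deriv_const]

/-- The cut-off uses the argument `y = (n + 3) x - 1`, for which `y + 1 = (n + 3) x`. The second
bound thus controls `x` times the growing derivative of the cut-off, uniformly in `n`. -/
lemma exists_bound_deriv_smoothTransition :
    ∃ M, 0 ≤ M ∧ ∀ y, |deriv Real.smoothTransition y| ≤ M ∧
      |(y + 1) * deriv Real.smoothTransition y| ≤ 2 * M := by
  have hc : Continuous (deriv Real.smoothTransition) :=
    (Real.smoothTransition.contDiff (n := 1)).continuous_deriv le_rfl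
  obtain ⟨M, hM⟩ := isCompact_Icc.exists_bound_of_continuousOn hc.continuousOn (s := Icc (0 : ℝ) 1)
  have hM0 : 0 ≤ M := (norm_nonneg _).trans (hM 0 ⟨le_rfl, zero_le_one⟩)
  refine ⟨M, hM0, fun y => ?_⟩
  by_cases hy : y ∈ Icc (0 : ℝ) 1
  · refine ⟨hM y hy, ?_⟩
    rw [abs_mul]
    refine mul_le_mul ?_ (hM y hy) (abs_nonneg _) (by norm_num)
    rw [abs_of_nonneg (by linarith [hy.1])]
    linarith [hy.2]
  · simp [deriv_smoothTransition_eq_zero hy, hM0]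

/-- A smooth function with support in `(0,1)`, equal to `1` away from the end points. -/
def cutoff (n : ℕ) (x : ℝ) : ℝ :=
  Real.smoothTransition ((n + 3) * x - 1) * Real.smoothTransition ((n + 3) * (1 - x) - 1)

lemma contDiff_cutoff (n : ℕ) : ContDiff ℝ ∞ (cutoff n) := by
  unfold cutoff
  have h : ContDiff ℝ ∞ Real.smoothTransition := Real.smoothTransition.contDiff
  exact (h.comp (by fun_prop)).mul (h.comp (by fun_prop))

lemma cutoff_nonneg (n : ℕ) (x : ℝ) : 0 ≤ cutoff n x :=
  mul_nonneg (Real.smoothTransition.nonneg _) (Real.smoothTransition.nonneg _)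

lemma cutoff_le_one (n : ℕ) (x : ℝ) : cutoff n x ≤ 1 :=
  mul_le_one₀ (Real.smoothTransition.le_one _) (Real.smoothTransition.nonneg _)
    (Real.smoothTransition.le_one _)

lemma tsupport_cutoff (n : ℕ) : tsupport (cutoff n) ⊆ Ioo 0 1 := by
  have hn : (0 : ℝ) < n + 3 := by positivity
  have h : tsupport (cutoff n) ⊆ Icc (1 / (n + 3) : ℝ) (1 - 1 / (n + 3)) := by
    refine closure_minimal (fun x hx => ?_) isClosed_Icc
    have h1 : Real.smoothTransition ((n + 3) * x - 1) ≠ 0 := left_ne_zero_of_mul hx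
    have h2 : Real.smoothTransition ((n + 3) * (1 - x) - 1) ≠ 0 := right_ne_zero_of_mul hx
    constructor
    · by_contra hlt
      rw [not_le, lt_div_iff₀ hn] at hlt
      exact h1 (Real.smoothTransition.zero_of_nonpos (by linarith))
    · by_contra hlt
      rw [not_le, sub_lt_comm, lt_div_iff₀ hn] at hlt
      exact h2 (Real.smoothTransition.zero_of_nonpos (by linarith))
  refine h.trans fun x hx => ?_
  have : (0 : ℝ) < 1 / (n + 3) := by positivity
  exact ⟨by linarith [hx.1], by linarith [hx.2]⟩

lemma eventually_cutoff_eq_one {x : ℝ} (hx : x ∈ Ioo (0 : ℝ) 1) :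
    ∀ᶠ n : ℕ in Filter.atTop, cutoff n x = 1 ∧ deriv (cutoff n) x = 0 := by
  obtain ⟨N, hN⟩ := exists_nat_gt (2 / min x (1 - x))
  have hm : 0 < min x (1 - x) := lt_min hx.1 (by linarith [hx.2])
  filter_upwards [Filter.eventually_ge_atTop N] with n hn
  have hn' : (N : ℝ) ≤ n := by exact_mod_cast hn
  have h2 : 2 < (n + 3) * min x (1 - x) := by
    rw [div_lt_iff₀ hm] at hN
    nlinarith
  have hx1 : 1 < (n + 3) * x - 1 := by
    have := mul_le_mul_of_nonneg_left (min_le_left x (1 - x)) (by positivity : (0 : ℝ) ≤ n + 3)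
    linarith
  have hx2 : 1 < (n + 3) * (1 - x) - 1 := by
    have := mul_le_mul_of_nonneg_left (min_le_right x (1 - x)) (by positivity : (0 : ℝ) ≤ n + 3)
    linarith
  have hev : cutoff n =ᶠ[nhds x] fun _ => 1 := by
    have c1 : Continuous fun y : ℝ => (n + 3) * y - 1 := by fun_prop
    have c2 : Continuous fun y : ℝ => (n + 3) * (1 - y) - 1 := by fun_prop
    filter_upwards [c1.continuousAt.eventually_const_lt hx1,
      c2.continuousAt.eventually_const_lt hx2] with y h1 h2
    simp [cutoff, Real.smoothTransition.one_of_one_le h1.le,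
      Real.smoothTransition.one_of_one_le h2.le]
  exact ⟨hev.eq_of_nhds, by rw [hev.deriv_eq, deriv_const]⟩

lemma deriv_cutoff (n : ℕ) (x : ℝ) :
    deriv (cutoff n) x =
      (n + 3) * deriv Real.smoothTransition ((n + 3) * x - 1)
          * Real.smoothTransition ((n + 3) * (1 - x) - 1)
        - Real.smoothTransition ((n + 3) * x - 1)
          * ((n + 3) * deriv Real.smoothTransition ((n + 3) * (1 - x) - 1)) := by
  have hd : ∀ y, HasDerivAt Real.smoothTransition (deriv Real.smoothTransition y) y := fun y =>
    ((Real.smoothTransition.contDiff (n := 1)).differentiable (by simp) y).hasDerivAt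
  have h1 : HasDerivAt (fun x : ℝ => (n + 3) * x - 1) (n + 3 : ℝ) x := by
    simpa using ((hasDerivAt_id x).const_mul (n + 3 : ℝ)).sub_const 1
  have h2 : HasDerivAt (fun x : ℝ => (n + 3) * (1 - x) - 1) (-(n + 3) : ℝ) x := by
    simpa using (((hasDerivAt_id x).const_sub 1).const_mul (n + 3 : ℝ)).sub_const 1
  have := (((hd _).comp x h1).mul ((hd _).comp x h2)).deriv
  rw [show cutoff n = _ from rfl]
  refine Eq.trans this ?_
  simp only [Function.comp]
  ring

/-- The product of a smooth function vanishing at the end points with the derivative of the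
cut-off function is uniformly bounded. -/
lemma exists_bound_mul_deriv_cutoff {ψ : ℝ → ℝ} (hψ : ContDiff ℝ ∞ ψ) (h0 : ψ 0 = 0)
    (h1 : ψ 1 = 0) :
    ∃ C, ∀ n : ℕ, ∀ x ∈ Icc (0 : ℝ) 1, |ψ x * deriv (cutoff n) x| ≤ C := by
  obtain ⟨M, hM0, hM⟩ := exists_bound_deriv_smoothTransition
  obtain ⟨L, hL⟩ := isCompact_Icc.exists_bound_of_continuousOn
    (hψ.continuous_deriv (by simp)).continuousOn (s := Icc (0 : ℝ) 1)
  -- As `ψ` vanishes at both ends, the Lipschitz bound gives `|ψ x| ≤ L x` and `|ψ x| ≤ L (1 - x)`;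
  -- each absorbs the factor `n + 3` in one of the two terms of the derivative.
  have hlip : ∀ x ∈ Icc (0 : ℝ) 1, ∀ y ∈ Icc (0 : ℝ) 1, |ψ y - ψ x| ≤ L * |y - x| :=
    fun x hx y hy => (convex_Icc (0 : ℝ) 1).norm_image_sub_le_of_norm_deriv_le
      (fun z _ => (hψ.differentiable (by simp)) z) hL hx hy
  have hS : ∀ y, |Real.smoothTransition y| ≤ 1 := fun y => by
    rw [abs_of_nonneg (Real.smoothTransition.nonneg y)]
    exact Real.smoothTransition.le_one y
  have hL0 : 0 ≤ L := (norm_nonneg _).trans (hL 0 ⟨le_rfl, zero_le_one⟩)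
  refine ⟨L * (2 * M) + L * (2 * M), fun n x hx => ?_⟩
  have ha := hlip 0 ⟨le_rfl, zero_le_one⟩ x hx
  have hb := hlip 1 ⟨zero_le_one, le_rfl⟩ x hx
  rw [h0, sub_zero, sub_zero, abs_of_nonneg hx.1] at ha
  rw [h1, sub_zero, abs_of_nonpos (a := x - 1) (by linarith [hx.2])] at hb
  have e1 := (hM ((n + 3) * x - 1)).2
  have e2 := (hM ((n + 3) * (1 - x) - 1)).2
  rw [sub_add_cancel] at e1 e2
  rw [abs_mul, abs_of_nonneg (by have := hx.1; positivity)] at e1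
  rw [abs_mul, abs_of_nonneg (mul_nonneg (by positivity) (by linarith [hx.2]))] at e2
  rw [deriv_cutoff, mul_sub]
  refine (abs_sub _ _).trans (add_le_add ?_ ?_)
  · rw [abs_mul, abs_mul, abs_mul, abs_of_nonneg (by positivity : (0 : ℝ) ≤ n + 3)]
    calc _ ≤ L * x * ((n + 3) * |deriv Real.smoothTransition ((n + 3) * x - 1)| * 1) := by
          have := mul_nonneg hL0 hx.1
          gcongr
          exact hS _
      _ = L * ((n + 3) * x * |deriv Real.smoothTransition ((n + 3) * x - 1)|) := by ring
      _ ≤ _ := by gcongr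
  · rw [abs_mul, abs_mul, abs_mul, abs_of_nonneg (by positivity : (0 : ℝ) ≤ n + 3)]
    have hx' : 0 ≤ -(x - 1) := by linarith [hx.2]
    calc _ ≤ L * -(x - 1) *
            (1 * ((n + 3) * |deriv Real.smoothTransition ((n + 3) * (1 - x) - 1)|)) := by
          have := mul_nonneg hL0 hx'
          gcongr
          exact hS _
      _ = L * ((n + 3) * (1 - x) * |deriv Real.smoothTransition ((n + 3) * (1 - x) - 1)|) := by
          ring
      _ ≤ _ := by gcongr

/-! ### Weak derivatives tested against products -/

variable {s : ℕ}

lemma prod_update_apply (ψ : Fin s → ℝ → ℝ) (j : Fin s) (θ : ℝ → ℝ) (x : Fin s → ℝ) :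
    ∏ i, Function.update ψ j θ i (x i) = θ (x j) * ∏ i ∈ Finset.univ.erase j, ψ i (x i) := by
  rw [← Finset.mul_prod_erase _ _ (Finset.mem_univ j), Function.update_self]
  congr 1
  refine Finset.prod_congr rfl fun i hi => ?_
  rw [Function.update_of_ne (Finset.ne_of_mem_erase hi)]

lemma prod_apply_update (ψ : Fin s → ℝ → ℝ) (j : Fin s) (t : ℝ) (x : Fin s → ℝ) :
    ∏ i, ψ i (Function.update x j t i) = ψ j t * ∏ i ∈ Finset.univ.erase j, ψ i (x i) := by
  rw [← Finset.mul_prod_erase _ _ (Finset.mem_univ j), Function.update_self]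
  congr 1
  refine Finset.prod_congr rfl fun i hi => ?_
  rw [Function.update_of_ne (Finset.ne_of_mem_erase hi)]

lemma mixedDeriv_prod (β : Fin s → ℕ) (φ : Fin s → ℝ → ℝ) :
    mixedDeriv β (fun x => ∏ j, φ j (x j)) = fun x => ∏ j, iteratedDeriv (β j) (φ j) (x j) := by
  have key : ∀ l : List (Fin s), l.Nodup →
      l.foldr (fun j g x => iteratedDeriv (β j) (fun t => g (Function.update x j t)) (x j))
        (fun x => ∏ j, φ j (x j)) =
      fun x => ∏ j, (if j ∈ l then iteratedDeriv (β j) (φ j) else φ j) (x j) := by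
    intro l
    induction l with
    | nil => simp
    | cons j l ih =>
      intro hl
      rw [List.nodup_cons] at hl
      rw [List.foldr_cons, ih hl.2]
      funext x
      have e : (fun t => ∏ i, (if i ∈ l then iteratedDeriv (β i) (φ i) else φ i)
          (Function.update x j t i)) = fun t =>
          (∏ i ∈ Finset.univ.erase j, (if i ∈ l then iteratedDeriv (β i) (φ i) else φ i) (x i))
            * φ j t := by
        funext t
        rw [prod_apply_update (fun i => if i ∈ l then iteratedDeriv (β i) (φ i) else φ i)]
        simp [hl.1, mul_comm]
      rw [e, iteratedDeriv_const_mul_field, ← Finset.mul_prod_erase _ _ (Finset.mem_univ j),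
        mul_comm]
      congr 1
      · simp
      · refine Finset.prod_congr rfl fun i hi => ?_
        simp [Finset.ne_of_mem_erase hi]
  rw [mixedDeriv, key _ (List.nodup_finRange s)]
  simp

/-- Smooth functions with compact support in `(0,1)`. -/
def IsBump (ψ : ℝ → ℝ) : Prop := ContDiff ℝ ∞ ψ ∧ tsupport ψ ⊆ Ioo 0 1

lemma IsBump.deriv {ψ : ℝ → ℝ} (h : IsBump ψ) : IsBump (deriv ψ) :=
  ⟨(contDiff_infty_iff_deriv.1 h.1).2, (closure_minimal support_deriv_subset
    (isClosed_tsupport ψ)).trans h.2⟩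

lemma IsBump.mul_cutoff {ψ : ℝ → ℝ} (h : ContDiff ℝ ∞ ψ) (n : ℕ) :
    IsBump (fun x => ψ x * cutoff n x) :=
  ⟨h.mul (contDiff_cutoff n), (tsupport_mul_subset_right (f := ψ)).trans (tsupport_cutoff n)⟩

lemma contDiff_prod_apply {ψ : Fin s → ℝ → ℝ} (h : ∀ j, ContDiff ℝ ∞ (ψ j)) :
    ContDiff ℝ ∞ fun x : Fin s → ℝ => ∏ j, ψ j (x j) :=
  contDiff_prod fun j _ => (h j).comp (contDiff_apply ℝ ℝ j)

lemma tsupport_prod_apply (ψ : Fin s → ℝ → ℝ) :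
    tsupport (fun x : Fin s → ℝ => ∏ j, ψ j (x j)) ⊆ univ.pi fun j => tsupport (ψ j) := by
  refine closure_minimal (fun x hx j _ => ?_) (isClosed_set_pi fun j _ => isClosed_tsupport _)
  exact subset_tsupport _ fun h0 => hx (Finset.prod_eq_zero (Finset.mem_univ j) h0)

lemma tsupport_prod_isBump {ψ : Fin s → ℝ → ℝ} (h : ∀ j, IsBump (ψ j)) :
    tsupport (fun x : Fin s → ℝ => ∏ j, ψ j (x j)) ⊆ openCube (Fin s) :=
  (tsupport_prod_apply ψ).trans (pi_mono fun j _ => (h j).2)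

lemma hasCompactSupport_of_subset_openCube {φ : (Fin s → ℝ) → ℝ}
    (h : tsupport φ ⊆ openCube (Fin s)) : HasCompactSupport φ :=
  (isCompact_closedCube _).of_isClosed_subset (isClosed_tsupport φ)
    (h.trans ((openCube_subset_cube _).trans (cube_subset_closedCube _)))

lemma IsWeakDeriv.integral_prod {β : Fin s → ℕ} {f g : (Fin s → ℝ) → ℝ} (h : IsWeakDeriv β f g)
    {ψ : Fin s → ℝ → ℝ} (hψ : ∀ j, IsBump (ψ j)) :
    ∫ x in cube (Fin s), f x * ∏ j, iteratedDeriv (β j) (ψ j) (x j)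
      = (-1) ^ (∑ j, β j) * ∫ x in cube (Fin s), g x * ∏ j, ψ j (x j) := by
  have ht := tsupport_prod_isBump hψ
  have := h.2 _ (contDiff_prod_apply fun j => (hψ j).1) (hasCompactSupport_of_subset_openCube ht) ht
  rwa [mixedDeriv_prod] at this

lemma IsWeakDeriv.integrable {β : Fin s → ℕ} {f g : (Fin s → ℝ) → ℝ} (h : IsWeakDeriv β f g) :
    Integrable g (volume.restrict (cube (Fin s))) := h.1.integrable (by norm_num)

/-- The definition relates `g` and `g'` only to `f`, not to each other. Raising the order in
coordinate `j` is the same as testing at order `β` with the `j`-th factor already differentiated, so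
`f` can be eliminated. -/
lemma IsWeakDeriv.integral_succ_of_isBump {β : Fin s → ℕ} {j : Fin s} {f g g' : (Fin s → ℝ) → ℝ}
    (h : IsWeakDeriv β f g) (h' : IsWeakDeriv (Function.update β j (β j + 1)) f g')
    {ψ : Fin s → ℝ → ℝ} (hψ : ∀ j, IsBump (ψ j)) :
    ∫ x in cube (Fin s), g' x * ∏ i, ψ i (x i) =
      - ∫ x in cube (Fin s), g x * ∏ i, Function.update ψ j (deriv (ψ j)) i (x i) := by
  have h1 := h'.integral_prod hψ
  have hψ' : ∀ i, IsBump (Function.update ψ j (deriv (ψ j)) i) := by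
    intro i
    rcases eq_or_ne i j with rfl | hij
    · simpa using (hψ i).deriv
    · simpa [hij] using hψ i
  have h2 := h.integral_prod hψ'
  have e1 : ∀ i, iteratedDeriv (Function.update β j (β j + 1) i) (ψ i) =
      iteratedDeriv (β i) (Function.update ψ j (deriv (ψ j)) i) := by
    intro i
    rcases eq_or_ne i j with rfl | hij
    · simp [iteratedDeriv_succ']
    · simp [hij]
  simp only [e1] at h1
  rw [h2, show ∑ i, Function.update β j (β j + 1) i = (∑ i, β i) + 1 by
    rw [Finset.sum_update_of_mem (Finset.mem_univ j), ← Finset.sum_sdiff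
      (Finset.subset_univ {j}), Finset.sum_singleton]; ring, pow_succ] at h1
  have hne : ((-1 : ℝ) ^ (∑ i, β i)) ≠ 0 := by positivity
  have := mul_left_cancel₀ hne (h1.trans (mul_assoc _ _ _))
  rw [this]
  simp

/-- Dominated convergence; pointwise limits are needed only in the open cube, because the faces are
null sets. This is what allows cut-offs that collapse at the boundary. -/
lemma tendsto_integral_prod {g : (Fin s → ℝ) → ℝ}
    (hg : Integrable g (volume.restrict (cube (Fin s)))) {θ : ℕ → Fin s → ℝ → ℝ}
    {ψ : Fin s → ℝ → ℝ} (hθ : ∀ n i, Continuous (θ n i)) (C : Fin s → ℝ)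
    (hC : ∀ n i, ∀ x ∈ Icc (0 : ℝ) 1, |θ n i x| ≤ C i)
    (hlim : ∀ i, ∀ x ∈ Ioo (0 : ℝ) 1,
      Filter.Tendsto (fun n => θ n i x) Filter.atTop (nhds (ψ i x))) :
    Filter.Tendsto (fun n => ∫ x in cube (Fin s), g x * ∏ i, θ n i (x i)) Filter.atTop
      (nhds (∫ x in cube (Fin s), g x * ∏ i, ψ i (x i))) := by
  have hcont : ∀ n, Continuous fun x : Fin s → ℝ => ∏ i, θ n i (x i) := fun n =>
    continuous_finsetProd _ fun i _ => (hθ n i).comp (continuous_apply i)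
  refine tendsto_integral_of_dominated_convergence (fun x => |g x| * ∏ i, C i) ?_ ?_ ?_ ?_
  · exact fun n => hg.1.mul (hcont n).aestronglyMeasurable
  · exact hg.abs.mul_const _
  · intro n
    filter_upwards [ae_mem_cube (Fin s)] with x hx
    rw [norm_mul, Real.norm_eq_abs, Real.norm_eq_abs, Finset.abs_prod]
    refine mul_le_mul_of_nonneg_left ?_ (abs_nonneg _)
    exact Finset.prod_le_prod (fun i _ => abs_nonneg _) fun i _ =>
      hC n i _ (Ico_subset_Icc_self (hx i (mem_univ i)))
  · filter_upwards [ae_mem_openCube (Fin s)] with x hx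
    exact (tendsto_finsetProd _ fun i _ => hlim i _ (hx i (mem_univ i))).const_mul _

/-- Integration by parts against a product of smooth functions, one of which vanishes at
the end points of the unit interval. -/
lemma IsWeakDeriv.integral_succ {β : Fin s → ℕ} {j : Fin s} {f g g' : (Fin s → ℝ) → ℝ}
    (h : IsWeakDeriv β f g) (h' : IsWeakDeriv (Function.update β j (β j + 1)) f g')
    {ψ : Fin s → ℝ → ℝ} (hψ : ∀ j, ContDiff ℝ ∞ (ψ j)) (h0 : ψ j 0 = 0) (h1 : ψ j 1 = 0) :
    ∫ x in cube (Fin s), g' x * ∏ i, ψ i (x i) =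
      - ∫ x in cube (Fin s), g x * ∏ i, Function.update ψ j (deriv (ψ j)) i (x i) := by
  have hB : ∀ i, ∃ C, ∀ x ∈ Icc (0 : ℝ) 1, |ψ i x| ≤ C := fun i =>
    isCompact_Icc.exists_bound_of_continuousOn (hψ i).continuous.continuousOn
  choose B hB using hB
  obtain ⟨B', hB'⟩ := isCompact_Icc.exists_bound_of_continuousOn
    ((hψ j).continuous_deriv (by simp)).continuousOn (s := Icc (0 : ℝ) 1)
  obtain ⟨B'', hB''⟩ := exists_bound_mul_deriv_cutoff (hψ j) h0 h1
  have habs : ∀ n x, |cutoff n x| ≤ 1 := fun n x => by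
    rw [abs_of_nonneg (cutoff_nonneg n x)]; exact cutoff_le_one n x
  have hbd : ∀ (θ : ℝ → ℝ) (D : ℝ), (∀ x ∈ Icc (0 : ℝ) 1, |θ x| ≤ D) → ∀ n,
      ∀ x ∈ Icc (0 : ℝ) 1, |θ x * cutoff n x| ≤ D := by
    intro θ D hD n x hx
    rw [abs_mul]
    exact (mul_le_of_le_one_right (abs_nonneg _) (habs n x)).trans (hD x hx)
  have hlim : ∀ (θ : ℝ → ℝ), ∀ x ∈ Ioo (0 : ℝ) 1,
      Filter.Tendsto (fun n => θ x * cutoff n x) Filter.atTop (nhds (θ x)) := by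
    intro θ x hx
    refine tendsto_const_nhds.congr' ?_
    filter_upwards [eventually_cutoff_eq_one hx] with n hn
    rw [hn.1, mul_one]
  have hder : ∀ n, deriv (fun x => ψ j x * cutoff n x) =
      fun x => deriv (ψ j) x * cutoff n x + ψ j x * deriv (cutoff n) x := fun n => funext fun x =>
    deriv_fun_mul ((hψ j).differentiable (by simp) x)
      ((contDiff_cutoff n).differentiable (by simp) x)
  -- Every factor is multiplied by the cut-off. The derivative of the `j`-th product has the extra
  -- term `ψ j * deriv (cutoff n)`, which is uniformly bounded and eventually zero at each interior
  -- point.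
  have T1 := tendsto_integral_prod h'.integrable (θ := fun n i x => ψ i x * cutoff n x) (ψ := ψ)
    (fun n i => (hψ i).continuous.mul (contDiff_cutoff n).continuous) B
    (fun n i => hbd (ψ i) (B i) (hB i) n) (fun i => hlim (ψ i))
  have T2 := tendsto_integral_prod h.integrable
    (θ := fun n => Function.update (fun i x => ψ i x * cutoff n x) j
      (deriv (fun x => ψ j x * cutoff n x))) (ψ := Function.update ψ j (deriv (ψ j)))
    (fun n i => ?_) (Function.update B j (B' + B'')) (fun n i => ?_) (fun i => ?_)
  · refine tendsto_nhds_unique T1 (T2.neg.congr fun n => ?_)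
    exact (h.integral_succ_of_isBump h' (ψ := fun i x => ψ i x * cutoff n x)
      fun i => IsBump.mul_cutoff (hψ i) n).symm
  · rcases eq_or_ne i j with rfl | hij
    · rw [Function.update_self]
      exact ((hψ i).mul (contDiff_cutoff n)).continuous_deriv (by simp)
    · rw [Function.update_of_ne hij]
      exact (hψ i).continuous.mul (contDiff_cutoff n).continuous
  · rcases eq_or_ne i j with rfl | hij
    · simp only [Function.update_self, hder]
      intro x hx
      exact (abs_add_le _ _).trans (add_le_add (hbd _ _ hB' n x hx) (hB'' n x hx))
    · simp only [Function.update_of_ne hij]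
      exact hbd _ _ (hB i) n
  · rcases eq_or_ne i j with rfl | hij
    · simp only [Function.update_self, hder]
      intro x hx
      refine (tendsto_const_nhds (x := deriv (ψ i) x)).congr' ?_
      filter_upwards [eventually_cutoff_eq_one hx] with n hn
      rw [hn.1, hn.2, mul_one, mul_zero, add_zero]
    · simp only [Function.update_of_ne hij]
      exact hlim _

lemma integrable_mul_prod {g : (Fin s → ℝ) → ℝ}
    (hg : Integrable g (volume.restrict (cube (Fin s)))) {ψ : Fin s → ℝ → ℝ}
    (hψ : ∀ i, Continuous (ψ i)) :
    Integrable (fun x => g x * ∏ i, ψ i (x i)) (volume.restrict (cube (Fin s))) := by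
  have hB : ∀ i, ∃ C, ∀ x ∈ Icc (0 : ℝ) 1, |ψ i x| ≤ C := fun i =>
    isCompact_Icc.exists_bound_of_continuousOn (hψ i).continuousOn
  choose B hB using hB
  refine hg.mul_bdd (c := ∏ i, B i) ?_ ?_
  · exact (continuous_finsetProd _ fun i _ =>
      (hψ i).comp (continuous_apply i)).aestronglyMeasurable
  · filter_upwards [ae_mem_cube (Fin s)] with x hx
    rw [Real.norm_eq_abs, Finset.abs_prod]
    exact Finset.prod_le_prod (fun i _ => abs_nonneg _) fun i _ =>
      hB i _ (Ico_subset_Icc_self (hx i (mem_univ i)))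

lemma integral_update_sub {g : (Fin s → ℝ) → ℝ}
    (hg : Integrable g (volume.restrict (cube (Fin s)))) {ψ : Fin s → ℝ → ℝ}
    (hψ : ∀ i, Continuous (ψ i)) (j : Fin s) {θ θ' : ℝ → ℝ} (hθ : Continuous θ)
    (hθ' : Continuous θ') :
    ∫ x in cube (Fin s), g x * ∏ i, Function.update ψ j (fun t => θ t - θ' t) i (x i) =
      (∫ x in cube (Fin s), g x * ∏ i, Function.update ψ j θ i (x i)) -
      ∫ x in cube (Fin s), g x * ∏ i, Function.update ψ j θ' i (x i) := by
  have hu : ∀ θ : ℝ → ℝ, Continuous θ → ∀ i, Continuous (Function.update ψ j θ i) := by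
    intro θ hθ i
    rcases eq_or_ne i j with rfl | hij
    · simpa using hθ
    · simpa [hij] using hψ i
  rw [← integral_sub (integrable_mul_prod hg (hu θ hθ)) (integrable_mul_prod hg (hu θ' hθ'))]
  congr 1
  funext x
  simp only [prod_update_apply]
  ring

/-- The weights of the Bernoulli expansion of order `α` in weak form. -/
def expandTest (α : ℕ) (φ : ℝ → ℝ) (τ : ℕ) : ℝ → ℝ :=
  if τ < α then fun _ => ∫ x in (0 : ℝ)..1, iterPrim φ τ x else iterPrim φ α

lemma contDiff_expandTest (α : ℕ) {φ : ℝ → ℝ} (hφ : ContDiff ℝ ∞ φ) (τ : ℕ) :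
    ContDiff ℝ ∞ (expandTest α φ τ) := by
  unfold expandTest
  split_ifs
  · exact contDiff_const
  · exact contDiff_iterPrim hφ α

/-- The Bernoulli expansion in the direction of a single coordinate. -/
lemma integral_expand_coordinate {α : ℕ} {f : (Fin s → ℝ) → ℝ}
    {F : (Fin s → ℕ) → (Fin s → ℝ) → ℝ}
    (hF : ∀ β : Fin s → ℕ, (∀ j, β j ≤ α) → IsWeakDeriv β f (F β)) {β : Fin s → ℕ}
    (hβ : ∀ j, β j ≤ α) {j : Fin s} (hj : β j = 0) {ψ : Fin s → ℝ → ℝ}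
    (hψ : ∀ i, ContDiff ℝ ∞ (ψ i)) :
    ∫ x in cube (Fin s), F β x * ∏ i, ψ i (x i) =
      ∑ τ ∈ Finset.range (α + 1), ∫ x in cube (Fin s), F (Function.update β j τ) x *
        ∏ i, Function.update ψ j (expandTest α (ψ j) τ) i (x i) := by
  have hle : ∀ τ ≤ α, ∀ i, Function.update β j τ i ≤ α := by
    intro τ hτ i
    rcases eq_or_ne i j with rfl | hij
    · simpa using hτ
    · simpa [hij] using hβ i
  have hsm : ∀ θ : ℝ → ℝ, ContDiff ℝ ∞ θ → ∀ i, ContDiff ℝ ∞ (Function.update ψ j θ i) := by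
    intro θ hθ i
    rcases eq_or_ne i j with rfl | hij
    · simpa using hθ
    · simpa [hij] using hψ i
  -- Induction on the number `n` of integrations by parts already done in coordinate `j`; each turns
  -- the last integral into a mean term and an integral of one order higher.
  have key : ∀ n ≤ α, ∫ x in cube (Fin s), F β x * ∏ i, ψ i (x i) =
      (∑ τ ∈ Finset.range n, ∫ x in cube (Fin s), F (Function.update β j τ) x *
        ∏ i, Function.update ψ j (fun _ => ∫ x in (0 : ℝ)..1, iterPrim (ψ j) τ x) i (x i)) +
      ∫ x in cube (Fin s), F (Function.update β j n) x *
        ∏ i, Function.update ψ j (iterPrim (ψ j) n) i (x i) := by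
    intro n
    induction n with
    | zero =>
      intro _
      rw [← hj, Function.update_eq_self, hj, iterPrim, Function.update_eq_self]
      simp
    | succ n ih =>
      intro hn
      rw [ih (by omega), Finset.sum_range_succ, add_assoc]
      congr 1
      have hw := hF _ (hle n (by omega))
      have hw' := hF _ (hle (n + 1) hn)
      have e : Function.update β j (n + 1) = Function.update (Function.update β j n) j
          (Function.update β j n j + 1) := by simp
      rw [e] at hw'
      have := hw.integral_succ hw' (hsm _ (contDiff_iterPrim (hψ j) (n + 1)))
        (by simp [iterPrim_apply_zero]) (by simp [iterPrim_apply_one])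
      rw [← e] at this
      simp only [Function.update_self, Function.update_idem, deriv_iterPrim (hψ j)] at this
      rw [this, integral_update_sub hw.integrable (fun i => (hψ i).continuous) j continuous_const
        (contDiff_iterPrim (hψ j) n).continuous]
      ring
  rw [key α le_rfl, Finset.sum_range_succ]
  congr 1
  · refine Finset.sum_congr rfl fun τ hτ => ?_
    rw [expandTest, if_pos (Finset.mem_range.1 hτ)]
  · rw [expandTest, if_neg (lt_irrefl _)]

lemma sum_piFinset_update {ι M : Type*} [Fintype ι] [DecidableEq ι] [AddCommMonoid M]
    (t : ι → Finset ℕ) (j : ι) (h : t j = {0}) (S : Finset ℕ) (T : (ι → ℕ) → M) :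
    ∑ β ∈ Fintype.piFinset (Function.update t j S), T β =
      ∑ β ∈ Fintype.piFinset t, ∑ τ ∈ S, T (Function.update β j τ) := by
  rw [← Finset.sum_product']
  symm
  refine Finset.sum_bij' (fun z _ => Function.update z.1 j z.2)
    (fun β _ => (Function.update β j 0, β j)) ?_ ?_ ?_ ?_ ?_
  · rintro ⟨β, τ⟩ hz
    rw [Finset.mem_product, Fintype.mem_piFinset] at hz
    rw [Fintype.mem_piFinset]
    intro i
    rcases eq_or_ne i j with rfl | hij
    · simpa using hz.2
    · simpa [hij] using hz.1 i
  · intro β hβ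
    rw [Fintype.mem_piFinset] at hβ
    rw [Finset.mem_product, Fintype.mem_piFinset]
    refine ⟨fun i => ?_, by simpa using hβ j⟩
    rcases eq_or_ne i j with rfl | hij
    · simp [h]
    · simpa [hij] using hβ i
  · rintro ⟨β, τ⟩ hz
    rw [Finset.mem_product, Fintype.mem_piFinset] at hz
    have h0 : β j = 0 := by simpa [h] using hz.1 j
    simp [← h0]
  · intro β _
    simp
  · intro z _
    rfl

/-- The Bernoulli expansion of order `α` in all coordinates, in weak form. -/
lemma integral_expand {α : ℕ} {f : (Fin s → ℝ) → ℝ} {F : (Fin s → ℕ) → (Fin s → ℝ) → ℝ}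
    (hF : ∀ β : Fin s → ℕ, (∀ j, β j ≤ α) → IsWeakDeriv β f (F β)) {φ : Fin s → ℝ → ℝ}
    (hφ : ∀ i, ContDiff ℝ ∞ (φ i)) :
    ∫ x in cube (Fin s), F 0 x * ∏ i, φ i (x i) =
      ∑ β ∈ Fintype.piFinset (fun _ : Fin s => Finset.range (α + 1)),
        ∫ x in cube (Fin s), F β x * ∏ i, expandTest α (φ i) (β i) (x i) := by
  -- `S` is the set of coordinates already expanded. The others still have order `0`, which is what
  -- the single-coordinate expansion requires.
  have key : ∀ S : Finset (Fin s), ∫ x in cube (Fin s), F 0 x * ∏ i, φ i (x i) =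
      ∑ β ∈ Fintype.piFinset (fun j : Fin s => if j ∈ S then Finset.range (α + 1) else {0}),
        ∫ x in cube (Fin s), F β x *
          ∏ i, (if i ∈ S then expandTest α (φ i) (β i) else φ i) (x i) := by
    intro S
    induction S using Finset.induction_on with
    | empty =>
      have : Fintype.piFinset (fun _ : Fin s => ({0} : Finset ℕ)) = {0} := by
        rw [Fintype.piFinset_singleton]
        rfl
      simp [this]
    | insert j S hj ih =>
      rw [ih]
      have e : (fun i : Fin s => if i ∈ insert j S then Finset.range (α + 1) else {0}) =
          Function.update (fun i => if i ∈ S then Finset.range (α + 1) else {0}) j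
            (Finset.range (α + 1)) := by
        funext i
        rcases eq_or_ne i j with rfl | hij
        · simp
        · simp [hij]
      rw [e, sum_piFinset_update _ _ (by simp [hj])]
      refine Finset.sum_congr rfl fun β hβ => ?_
      rw [Fintype.mem_piFinset] at hβ
      have hβ0 : β j = 0 := by simpa [hj] using hβ j
      have hβα : ∀ i, β i ≤ α := by
        intro i
        have := hβ i
        split_ifs at this
        · exact Nat.lt_succ_iff.1 (Finset.mem_range.1 this)
        · rw [Finset.mem_singleton.1 this]
          exact Nat.zero_le _
      rw [integral_expand_coordinate hF hβα hβ0
        (ψ := fun i => if i ∈ S then expandTest α (φ i) (β i) else φ i)]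
      · refine Finset.sum_congr rfl fun τ _ => ?_
        congr 1
        funext x
        congr 1
        refine Finset.prod_congr rfl fun i _ => ?_
        rcases eq_or_ne i j with rfl | hij
        · simp [hj]
        · simp [hij]
      · intro i
        split_ifs
        · exact contDiff_expandTest α (hφ i) _
        · exact hφ i
  simpa using key Finset.univ

end
end FoldedLattice

/-! ### From the weak to the pointwise Bernoulli expansion. -/

namespace FoldedLattice
noncomputable section
open MeasureTheory Set Polynomial
open scoped ContDiff

/-! ### The pointwise Bernoulli expansion -/

/-- The univariate building blocks of the Bernoulli expansion of order `α`: a Bernoulli polynomial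
in `x` for `n < α`, and the kernel of the remainder term otherwise. -/
def expandKernel (α n : ℕ) (x t : ℝ) : ℝ := if n < α then nbern n x else remKernel α x t

variable {s : ℕ}

lemma continuous_expandKernel {α : ℕ} (hα : 2 ≤ α) (n : ℕ) :
    Continuous fun z : ℝ × ℝ => expandKernel α n z.1 z.2 := by
  unfold expandKernel
  split_ifs
  · fun_prop
  · exact continuous_remKernel (by omega)

lemma continuous_prod_expandKernel {α : ℕ} (hα : 2 ≤ α) (β : Fin s → ℕ) :
    Continuous fun z : (Fin s → ℝ) × (Fin s → ℝ) =>
      ∏ j, expandKernel α (β j) (z.1 j) (z.2 j) := by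
  refine continuous_finsetProd _ fun j _ => ?_
  exact (continuous_expandKernel hα (β j)).comp
    (f := fun z : (Fin s → ℝ) × (Fin s → ℝ) => (z.1 j, z.2 j)) (by fun_prop)

lemma exists_bound_prod_expandKernel {α : ℕ} (hα : 2 ≤ α) (β : Fin s → ℕ) :
    ∃ C, ∀ x ∈ closedCube (Fin s), ∀ t ∈ closedCube (Fin s),
      |∏ j, expandKernel α (β j) (x j) (t j)| ≤ C := by
  obtain ⟨C, hC⟩ := ((isCompact_closedCube (Fin s)).prod
    (isCompact_closedCube (Fin s))).exists_bound_of_continuousOn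
    (continuous_prod_expandKernel hα β).continuousOn
  exact ⟨C, fun x hx t ht => hC (x, t) ⟨hx, ht⟩⟩

/-- Writing the weights of the weak expansion as integrals of `φ` against an explicit kernel is what
makes it possible to free `φ` by Fubini. -/
lemma expandTest_eq_integral {α : ℕ} (hα : 1 ≤ α) {φ : ℝ → ℝ} (hφ : ContDiff ℝ ∞ φ) (n : ℕ) {t : ℝ}
    (ht : t ∈ Icc (0 : ℝ) 1) :
    expandTest α φ n t = ∫ x in Ico (0 : ℝ) 1, expandKernel α n x t * φ x := by
  rw [integral_Ico_eq_integral_Ioc, ← intervalIntegral.integral_of_le zero_le_one]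
  unfold expandTest expandKernel
  split_ifs
  · exact (iterPrim_eq_integral hφ n).2
  · obtain ⟨a, rfl⟩ : ∃ a, α = a + 1 := ⟨α - 1, by omega⟩
    exact (iterPrim_eq_integral hφ a).1 t ht

lemma integral_cube_prod {ι : Type} [Fintype ι] (f : ι → ℝ → ℝ) :
    ∫ x in cube ι, ∏ j, f j (x j) = ∏ j, ∫ x in Ico (0 : ℝ) 1, f j x := by
  rw [cube, volume_pi, Measure.restrict_pi_pi]
  exact integral_fintype_prod_eq_prod (𝕜 := ℝ) (E := fun _ : ι => ℝ) f

/-- The pointwise Bernoulli expansion with coefficient functions `F β`. -/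
def expansion (α : ℕ) (F : (Fin s → ℕ) → (Fin s → ℝ) → ℝ) (x : Fin s → ℝ) : ℝ :=
  ∑ β ∈ Fintype.piFinset (fun _ : Fin s => Finset.range (α + 1)),
    ∫ t in cube (Fin s), F β t * ∏ j, expandKernel α (β j) (x j) (t j)

lemma continuousOn_integral_expandKernel {α : ℕ} (hα : 2 ≤ α) (β : Fin s → ℕ)
    {g : (Fin s → ℝ) → ℝ} (hg : Integrable g (volume.restrict (cube (Fin s)))) :
    ContinuousOn (fun x => ∫ t in cube (Fin s), g t * ∏ j, expandKernel α (β j) (x j) (t j))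
      (closedCube (Fin s)) := by
  obtain ⟨C, hC⟩ := exists_bound_prod_expandKernel hα β
  refine continuousOn_of_dominated (bound := fun t => |g t| * C) ?_ ?_ (hg.abs.mul_const _) ?_
  · intro x _
    exact hg.1.mul ((continuous_prod_expandKernel hα β).comp
      (continuous_const.prodMk continuous_id)).aestronglyMeasurable
  · intro x hx
    filter_upwards [ae_mem_cube (Fin s)] with t ht
    rw [norm_mul]
    exact mul_le_mul_of_nonneg_left (hC x hx t (cube_subset_closedCube _ ht)) (abs_nonneg _)
  · refine .of_forall fun t => Continuous.continuousOn (continuous_const.mul ?_)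
    exact (continuous_prod_expandKernel hα β).comp (continuous_id.prodMk continuous_const)

/-- Fubini moves the test functions outside, leaving a function of `x` that can be compared with
`f`; all kernels are bounded on the closed cube. -/
lemma integral_expandTest_eq {α : ℕ} (hα : 2 ≤ α) (β : Fin s → ℕ) {g : (Fin s → ℝ) → ℝ}
    (hg : Integrable g (volume.restrict (cube (Fin s)))) {φ : Fin s → ℝ → ℝ}
    (hφ : ∀ i, ContDiff ℝ ∞ (φ i)) :
    ∫ t in cube (Fin s), g t * ∏ i, expandTest α (φ i) (β i) (t i) =
      ∫ x in cube (Fin s), (∫ t in cube (Fin s), g t * ∏ j, expandKernel α (β j) (x j) (t j)) *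
        ∏ i, φ i (x i) := by
  have hφc : Continuous fun x : Fin s → ℝ => ∏ i, φ i (x i) := (contDiff_prod_apply hφ).continuous
  have e1 : ∫ t in cube (Fin s), g t * ∏ i, expandTest α (φ i) (β i) (t i) =
      ∫ t in cube (Fin s), ∫ x in cube (Fin s),
        g t * (∏ j, expandKernel α (β j) (x j) (t j)) * ∏ i, φ i (x i) := by
    refine setIntegral_congr_fun (measurableSet_cube _) fun t ht => ?_
    simp only [mul_assoc]
    rw [integral_const_mul]
    congr 1
    simp only [← Finset.prod_mul_distrib]
    rw [integral_cube_prod fun i x => expandKernel α (β i) x (t i) * φ i x]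
    exact Finset.prod_congr rfl fun i _ => expandTest_eq_integral (by omega) (hφ i) _
      (Ico_subset_Icc_self (ht i (mem_univ i)))
  rw [e1, integral_integral_swap]
  · simp only [integral_mul_const]
  · obtain ⟨C, hC⟩ := exists_bound_prod_expandKernel hα β
    obtain ⟨D, hD⟩ := (isCompact_closedCube (Fin s)).exists_bound_of_continuousOn hφc.continuousOn
    have h1 : Integrable (fun z : (Fin s → ℝ) × (Fin s → ℝ) => g z.1)
        ((volume.restrict (cube (Fin s))).prod (volume.restrict (cube (Fin s)))) :=
      hg.comp_fst _
    have h2 : Continuous fun z : (Fin s → ℝ) × (Fin s → ℝ) =>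
        (∏ j, expandKernel α (β j) (z.2 j) (z.1 j)) * ∏ i, φ i (z.2 i) :=
      ((continuous_prod_expandKernel hα β).comp (continuous_snd.prodMk continuous_fst)).mul
        (hφc.comp continuous_snd)
    have := h1.mul_bdd (c := C * D) h2.aestronglyMeasurable ?_
    · refine this.congr (.of_forall fun z => ?_)
      simp only [Function.uncurry, mul_assoc]
    · rw [Measure.prod_restrict]
      filter_upwards [ae_restrict_mem ((measurableSet_cube _).prod (measurableSet_cube _))] with z hz
      rw [norm_mul]
      have := hC z.2 (cube_subset_closedCube _ hz.2) z.1 (cube_subset_closedCube _ hz.1)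
      exact mul_le_mul this (hD _ (cube_subset_closedCube _ hz.2)) (norm_nonneg _)
        ((abs_nonneg _).trans this)

/-- A continuous function on the cube that is orthogonal to all products of bump functions
vanishes. -/
lemma eq_zero_of_integral_prod_isBump {h : (Fin s → ℝ) → ℝ} (hc : ContinuousOn h (openCube (Fin s)))
    (hi : ∀ φ : Fin s → ℝ → ℝ, (∀ i, IsBump (φ i)) →
      ∫ x in cube (Fin s), h x * ∏ i, φ i (x i) = 0)
    {x₀ : Fin s → ℝ} (hx₀ : x₀ ∈ openCube (Fin s)) : h x₀ = 0 := by
  by_contra hne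
  -- Multiplying by `h x₀` treats both signs at once: near `x₀` the product is positive, and it
  -- suffices to place a product of bumps there.
  have hO : IsOpen (openCube (Fin s) ∩ {x | 0 < h x₀ * h x}) := by
    have : ContinuousOn (fun x => h x₀ * h x) (openCube (Fin s)) := continuousOn_const.mul hc
    exact this.isOpen_inter_preimage (isOpen_openCube _) isOpen_Ioi
  have hmem : x₀ ∈ openCube (Fin s) ∩ {x | 0 < h x₀ * h x} :=
    ⟨hx₀, mul_self_pos.2 hne⟩
  obtain ⟨δ, hδ, hball⟩ := Metric.isOpen_iff.1 hO _ hmem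
  let b : ∀ i : Fin s, ContDiffBump (x₀ i) := fun i => ⟨δ / 4, δ / 2, by linarith, by linarith⟩
  have hsupp : ∀ x : Fin s → ℝ, (∀ i, x i ∈ Metric.closedBall (x₀ i) (δ / 2)) →
      x ∈ openCube (Fin s) ∩ {x | 0 < h x₀ * h x} := by
    intro x hx
    refine hball (Metric.mem_ball.2 ?_)
    refine lt_of_le_of_lt ((dist_pi_le_iff (by linarith)).2 fun i => hx i) (by linarith)
  have hb : ∀ i, IsBump (b i) := by
    intro i
    refine ⟨(b i).contDiff, ?_⟩
    rw [(b i).tsupport_eq]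
    intro y hy
    have := (hsupp (Function.update x₀ i y) fun k => ?_).1 i (mem_univ i)
    · simpa using this
    · rcases eq_or_ne k i with rfl | hk
      · simpa using hy
      · simp only [ne_eq, hk, not_false_eq_true, Function.update_of_ne]
        exact Metric.mem_closedBall_self (by linarith)
  have hcP : Continuous fun x : Fin s → ℝ => ∏ i, b i (x i) :=
    (contDiff_prod_apply fun i => (hb i).1).continuous
  have hnn : ∀ x : Fin s → ℝ, 0 ≤ h x₀ * (h x * ∏ i, b i (x i)) := by
    intro x
    by_cases hx : ∀ i, x i ∈ Metric.closedBall (x₀ i) (δ / 2)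
    · rw [← mul_assoc]
      exact mul_nonneg (hsupp x hx).2.le (Finset.prod_nonneg fun i _ => (b i).nonneg)
    · push Not at hx
      obtain ⟨i, hi'⟩ := hx
      have : b i (x i) = 0 := by
        refine image_eq_zero_of_notMem_tsupport ?_
        rw [(b i).tsupport_eq]
        exact hi'
      rw [Finset.prod_eq_zero (Finset.mem_univ i) this, mul_zero, mul_zero]
  have hcO : ContinuousOn (fun x => h x₀ * (h x * ∏ i, b i (x i))) (openCube (Fin s)) :=
    continuousOn_const.mul (hc.mul hcP.continuousOn)
  have h0 := hi (fun i => b i) hb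
  have h0' : ∫ x in openCube (Fin s), h x₀ * (h x * ∏ i, b i (x i)) = 0 := by
    rw [← restrict_cube_eq_restrict_openCube, integral_const_mul, h0, mul_zero]
  have hint : IntegrableOn (fun x => h x₀ * (h x * ∏ i, b i (x i))) (openCube (Fin s)) := by
    have hK : IsCompact (univ.pi fun i => Metric.closedBall (x₀ i) (δ / 2)) :=
      isCompact_univ_pi fun i => isCompact_closedBall _ _
    have hKs : (univ.pi fun i => Metric.closedBall (x₀ i) (δ / 2)) ⊆ openCube (Fin s) :=
      fun x hx => (hsupp x fun i => hx i (mem_univ i)).1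
    refine IntegrableOn.of_forall_sdiff_eq_zero
      ((hcO.mono hKs).integrableOn_compact hK) (isOpen_openCube _).measurableSet ?_
    intro x hx
    have hx' : ¬ ∀ i, x i ∈ Metric.closedBall (x₀ i) (δ / 2) := fun hx' =>
      hx.2 fun i _ => hx' i
    push Not at hx'
    obtain ⟨i, hi'⟩ := hx'
    have : b i (x i) = 0 := by
      refine image_eq_zero_of_notMem_tsupport ?_
      rw [(b i).tsupport_eq]
      exact hi'
    rw [Finset.prod_eq_zero (Finset.mem_univ i) this, mul_zero, mul_zero]
  -- A nonnegative function with zero integral vanishes almost everywhere, hence by continuity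
  -- everywhere on the open cube; at `x₀` it is positive.
  have hae := (setIntegral_eq_zero_iff_of_nonneg_ae (.of_forall hnn) hint).1 h0'
  have heq := Measure.eqOn_open_of_ae_eq hae (isOpen_openCube _) hcO continuousOn_const hx₀
  simp only [Pi.zero_apply] at heq
  have hpos : 0 < ∏ i, b i (x₀ i) := Finset.prod_pos fun i _ =>
    (b i).pos_of_mem_ball (Metric.mem_ball_self (by simp only [b]; linarith))
  have := mul_pos (mul_self_pos.2 hne) hpos
  rw [mul_assoc] at this
  exact this.ne' heq

/-- A continuous function with weak derivatives up to order `α` in each coordinate equals its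
Bernoulli expansion on the closed cube. -/
lemma eq_expansion {α : ℕ} (hα : 2 ≤ α) {f : (Fin s → ℝ) → ℝ} {F : (Fin s → ℕ) → (Fin s → ℝ) → ℝ}
    (hf : ContinuousOn f (closedCube (Fin s)))
    (hF : ∀ β : Fin s → ℕ, (∀ j, β j ≤ α) → IsWeakDeriv β f (F β)) {x : Fin s → ℝ}
    (hx : x ∈ closedCube (Fin s)) : f x = expansion α F x := by
  have hβ : ∀ β ∈ Fintype.piFinset (fun _ : Fin s => Finset.range (α + 1)), ∀ j, β j ≤ α :=
    fun β hβ j => Nat.lt_succ_iff.1 (Finset.mem_range.1 (Fintype.mem_piFinset.1 hβ j))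
  have hR : ContinuousOn (expansion α F) (closedCube (Fin s)) :=
    continuousOn_finsetSum _ fun β hb =>
      continuousOn_integral_expandKernel hα β (hF β (hβ β hb)).integrable
  have hoc : openCube (Fin s) ⊆ closedCube (Fin s) :=
    (openCube_subset_cube _).trans (cube_subset_closedCube _)
  have hint : ∀ {h : (Fin s → ℝ) → ℝ}, ContinuousOn h (closedCube (Fin s)) →
      Integrable h (volume.restrict (cube (Fin s))) := fun hh =>
    (hh.integrableOn_compact (isCompact_closedCube _)).mono_set (cube_subset_closedCube _)
  have hEq : EqOn f (expansion α F) (openCube (Fin s)) := by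
    intro y hy
    refine sub_eq_zero.1 (eq_zero_of_integral_prod_isBump (h := fun y => f y - expansion α F y)
      ((hf.sub hR).mono hoc) ?_ hy)
    intro φ hφ
    have hcd : ∀ i, ContDiff ℝ ∞ (φ i) := fun i => (hφ i).1
    have hc : ∀ i, Continuous (φ i) := fun i => (hcd i).continuous
    -- `F 0` is some weak derivative of order zero, not literally `f`; against bumps the two have
    -- the same integrals.
    have h0 := (hF 0 fun _ => Nat.zero_le _).integral_prod hφ
    simp only [Pi.zero_apply, iteratedDeriv_zero, Finset.sum_const_zero, pow_zero, one_mul] at h0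
    simp only [sub_mul]
    rw [integral_sub (integrable_mul_prod (hint hf) hc) (integrable_mul_prod (hint hR) hc), h0,
      integral_expand hF hcd, sub_eq_zero]
    simp only [expansion, Finset.sum_mul]
    rw [integral_finsetSum]
    · exact Finset.sum_congr rfl fun β hb =>
        integral_expandTest_eq hα β (hF β (hβ β hb)).integrable hcd
    · intro β hb
      exact integrable_mul_prod
        (hint (continuousOn_integral_expandKernel hα β (hF β (hβ β hb)).integrable)) hc
  -- Both sides are continuous on the closed cube, the closure of the open one, so boundary points
  -- are included; the folded points may lie there.
  refine hEq.of_subset_closure hf hR hoc ?_ hx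
  rw [openCube, closure_pi_set]
  simp only [closure_Ioo (zero_ne_one' ℝ)]
  exact subset_rfl

end
end FoldedLattice

/-! ### The expansion in terms of the inner product, and the Cauchy–Schwarz inequality. -/

namespace FoldedLattice
noncomputable section
open MeasureTheory Set Polynomial
open scoped ContDiff

variable {s : ℕ}

/-! ### Partial integrals -/

lemma measurePreserving_glue (v : Finset (Fin s)) :
    MeasurePreserving (fun z : ({j // j ∈ v} → ℝ) × ({j // j ∉ v} → ℝ) => glue v z.1 z.2)
      ((volume.restrict (cube {j // j ∈ v})).prod (volume.restrict (cube {j // j ∉ v})))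
      (volume.restrict (cube (Fin s))) := by
  have h := (volume_preserving_piEquivPiSubtypeProd (fun _ : Fin s => ℝ) (fun j => j ∈ v)).symm
  have h2 := h.restrict_preimage (measurableSet_cube (Fin s))
  have e : (⇑(MeasurableEquiv.piEquivPiSubtypeProd (fun _ : Fin s => ℝ) (fun j => j ∈ v)).symm) ⁻¹'
      cube (Fin s) = cube {j // j ∈ v} ×ˢ cube {j // j ∉ v} := by
    ext z
    change (fun j => if h : j ∈ v then z.1 ⟨j, h⟩ else z.2 ⟨j, h⟩) ∈ cube (Fin s) ↔ _
    simp only [cube, mem_univ_pi, mem_prod, Subtype.forall]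
    constructor
    · intro H
      exact ⟨fun j hj => by simpa [hj] using H j, fun j hj => by simpa [hj] using H j⟩
    · rintro ⟨H1, H2⟩ j
      by_cases hj : j ∈ v
      · simpa [hj] using H1 j hj
      · simpa [hj] using H2 j hj
  rw [e] at h2
  rw [Measure.prod_restrict, ← Measure.volume_eq_prod]
  convert! h2

lemma glue_of_mem {v : Finset (Fin s)} (y : {j // j ∈ v} → ℝ) (z : {j // j ∉ v} → ℝ)
    (j : {j // j ∈ v}) : glue v y z j = y j := by
  simp [glue, j.2]

lemma glue_of_notMem {v : Finset (Fin s)} (y : {j // j ∈ v} → ℝ) (z : {j // j ∉ v} → ℝ)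
    (j : {j // j ∉ v}) : glue v y z j = z j := by
  simp [glue, j.2]

lemma integral_mul_restrict_eq {v : Finset (Fin s)} {g : (Fin s → ℝ) → ℝ}
    {h : ({j // j ∈ v} → ℝ) → ℝ}
    (hgh : Integrable (fun x => g x * h fun j => x j) (volume.restrict (cube (Fin s)))) :
    ∫ x in cube (Fin s), g x * h (fun j => x j) =
      ∫ y in cube {j // j ∈ v}, partialIntegral v g y * h y := by
  have hmp := measurePreserving_glue v
  rw [← hmp.map_eq, integral_map hmp.measurable.aemeasurable (by rw [hmp.map_eq]; exact hgh.1),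
    integral_prod]
  · simp only [glue_of_mem, integral_mul_const]
    rfl
  · exact (hmp.integrable_comp hgh.1).2 hgh

lemma partialIntegral_congr_ae {v : Finset (Fin s)} {g g' : (Fin s → ℝ) → ℝ}
    (h : g =ᵐ[volume.restrict (cube (Fin s))] g') :
    partialIntegral v g =ᵐ[volume.restrict (cube {j // j ∈ v})] partialIntegral v g' := by
  have h2 := Measure.ae_ae_of_ae_prod ((measurePreserving_glue v).quasiMeasurePreserving.ae h)
  filter_upwards [h2] with y hy
  exact integral_congr_ae hy

/-- Jensen's inequality on the fibres: with `c` the mean of `g` over the fibre, `∫ (g - c)² ≥ 0`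
gives `c² ≤ ∫ g²`. -/
lemma memLp_partialIntegral {v : Finset (Fin s)} {g : (Fin s → ℝ) → ℝ}
    (hg : MemLp g 2 (volume.restrict (cube (Fin s)))) :
    MemLp (partialIntegral v g) 2 (volume.restrict (cube {j // j ∈ v})) := by
  have h := hg.comp_measurePreserving (measurePreserving_glue v)
  have h1 := h.integrable (by norm_num)
  have hm : AEStronglyMeasurable (partialIntegral v g) (volume.restrict (cube {j // j ∈ v})) :=
    h1.1.integral_prod_right'
  rw [memLp_two_iff_integrable_sq hm]
  have h2 := (memLp_two_iff_integrable_sq h.1).1 h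
  refine h2.integral_prod_left.mono' (hm.pow 2) ?_
  filter_upwards [h1.prod_right_ae, h2.prod_right_ae] with y hy1 hy2
  rw [Real.norm_eq_abs, abs_of_nonneg (sq_nonneg _)]
  set c := partialIntegral v g y with hc
  have h0 : 0 ≤ ∫ z in cube {j // j ∉ v}, (g (glue v y z) - c) ^ 2 :=
    integral_nonneg fun z => sq_nonneg _
  have e : ∀ z, (g (glue v y z) - c) ^ 2 =
      (g (glue v y z)) ^ 2 - (2 * c) * g (glue v y z) + c ^ 2 := fun z => by ring
  simp only [Function.comp] at hy1 hy2 ⊢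
  simp only [e] at h0
  have hy3 : Integrable (fun z => g (glue v y z) ^ 2 - 2 * c * g (glue v y z))
      (volume.restrict (cube {j // j ∉ v})) := hy2.sub (hy1.const_mul _)
  rw [integral_add hy3 (integrable_const _), integral_sub hy2 (hy1.const_mul _), integral_const_mul] at h0
  simp only [integral_const, smul_eq_mul, probReal_univ, one_mul] at h0
  rw [show ∫ z in cube {j // j ∉ v}, g (glue v y z) = c from rfl] at h0
  linarith

/-! ### Sums over multi-indices -/

/-- A multi-index determines `u` as its support and `v` as the set where it equals `α`. Hence the
index sets of the inner product partition the box `{0, …, α}^s` over which the expansion is summed.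
-/
lemma mem_multiIndices_iff {α : ℕ} (hα : 2 ≤ α) {u v : Finset (Fin s)} (hv : v ⊆ u)
    (β : Fin s → ℕ) :
    β ∈ multiIndices α u v ↔ (∀ j, β j ≤ α) ∧ Finset.univ.filter (fun j => β j ≠ 0) = u ∧
      Finset.univ.filter (fun j => β j = α) = v := by
  simp only [multiIndices, Fintype.mem_piFinset, Finset.ext_iff, Finset.mem_filter,
    Finset.mem_univ, true_and, ← forall_and]
  refine forall_congr' fun j => ?_
  by_cases h1 : j ∈ v
  · have h2 := hv h1
    simp only [h1, h2, if_true, Finset.mem_singleton, iff_true]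
    omega
  · by_cases h2 : j ∈ u
    · simp only [h1, h2, if_true, if_false, Finset.mem_Icc, iff_true, iff_false]
      omega
    · simp only [h1, h2, if_false, Finset.mem_singleton, iff_false]
      omega

lemma sum_multiIndices {α : ℕ} (hα : 2 ≤ α) (T : (Fin s → ℕ) → ℝ) :
    ∑ β ∈ Fintype.piFinset (fun _ : Fin s => Finset.range (α + 1)), T β =
      ∑ u : Finset (Fin s), ∑ v ∈ u.powerset, ∑ β ∈ multiIndices α u v, T β := by
  have e : ∀ u : Finset (Fin s), ∀ v ∈ u.powerset, ∑ β ∈ multiIndices α u v, T β =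
      ∑ β ∈ Fintype.piFinset (fun _ : Fin s => Finset.range (α + 1)),
        if Finset.univ.filter (fun j => β j = α) = v then
          (if Finset.univ.filter (fun j => β j ≠ 0) = u then T β else 0) else 0 := by
    intro u v hv
    simp only [← ite_and]
    rw [← Finset.sum_filter]
    refine Finset.sum_congr ?_ fun _ _ => rfl
    ext β
    rw [mem_multiIndices_iff hα (Finset.mem_powerset.1 hv), Finset.mem_filter,
      Fintype.mem_piFinset]
    simp only [Finset.mem_range, Nat.lt_succ_iff]
    tauto
  rw [Finset.sum_congr rfl fun u _ => Finset.sum_congr rfl fun v hv => e u v hv]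
  rw [Finset.sum_congr rfl fun u _ => Finset.sum_comm, Finset.sum_comm]
  refine Finset.sum_congr rfl fun β _ => ?_
  simp only [Finset.sum_ite_eq]
  rw [Finset.sum_eq_single (Finset.univ.filter fun j => β j ≠ 0)]
  · rw [if_pos, if_pos rfl]
    rw [Finset.mem_powerset]
    intro j
    simp only [Finset.mem_filter, Finset.mem_univ, true_and]
    omega
  · intro u _ hu
    rw [if_neg hu.symm, ite_self]
  · simp

/-! ### The Bernoulli expansion in terms of partial integrals -/

/-- The value at `x` of the representer of the functional `f ↦ ∫ f^(β) dx_{-v}(y)`. -/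
def expandKernelOn (α : ℕ) (v : Finset (Fin s)) (β : Fin s → ℕ) (x : Fin s → ℝ)
    (y : {j // j ∈ v} → ℝ) : ℝ :=
  (∏ j : {j // j ∈ v}, remKernel α (x j) (y j)) * ∏ j : {j // j ∉ v}, nbern (β j) (x j)

lemma prod_expandKernel_eq {α : ℕ} (hα : 2 ≤ α) {u v : Finset (Fin s)} (hv : v ⊆ u)
    {β : Fin s → ℕ} (hβ : β ∈ multiIndices α u v) (x t : Fin s → ℝ) :
    ∏ j, expandKernel α (β j) (x j) (t j) = expandKernelOn α v β x fun j => t j := by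
  rw [mem_multiIndices_iff hα hv] at hβ
  obtain ⟨h1, -, rfl⟩ := hβ
  rw [expandKernelOn, ← Fintype.prod_subtype_mul_prod_subtype
    (fun j => j ∈ Finset.univ.filter fun j => β j = α)]
  congr 1
  · refine Finset.prod_congr (Finset.ext fun _ => by simp) fun j _ => ?_
    have := (Finset.mem_filter.1 j.2).2
    rw [expandKernel, if_neg (by omega)]
  · refine Finset.prod_congr rfl fun j _ => ?_
    have : β j ≠ α := fun h => j.2 (Finset.mem_filter.2 ⟨Finset.mem_univ _, h⟩)
    rw [expandKernel, if_pos (lt_of_le_of_ne (h1 j) this)]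

lemma continuous_expandKernelOn {α : ℕ} (hα : 2 ≤ α) (v : Finset (Fin s)) (β : Fin s → ℕ) :
    Continuous fun z : (Fin s → ℝ) × ({j // j ∈ v} → ℝ) => expandKernelOn α v β z.1 z.2 := by
  unfold expandKernelOn
  refine (continuous_finsetProd _ fun j _ => ?_).mul (continuous_finsetProd _ fun j _ => ?_)
  · exact (continuous_remKernel (by omega)).comp
      (f := fun z : (Fin s → ℝ) × ({j // j ∈ v} → ℝ) => (z.1 j, z.2 j)) (by fun_prop)
  · fun_prop

lemma isWeakDeriv_weakDeriv {β : Fin s → ℕ} {f : (Fin s → ℝ) → ℝ} (h : ∃ g, IsWeakDeriv β f g) :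
    IsWeakDeriv β f (weakDeriv β f) := by
  rw [weakDeriv, dif_pos h]
  exact Classical.choose_spec h

lemma MemSobolev.isWeakDeriv {α : ℕ} {γ : Finset (Fin s) → ℝ} {f : (Fin s → ℝ) → ℝ}
    (hf : MemSobolev α γ f) (β : Fin s → ℕ) (hβ : ∀ j, β j ≤ α) :
    IsWeakDeriv β f (weakDeriv β f) :=
  isWeakDeriv_weakDeriv (hf.exists_weakDeriv β hβ)

/-- The kernel of a term depends on `t` only through the coordinates in `v`. Integrating out the
others turns the weak derivative into the partial integral that appears in the inner product. -/
lemma MemSobolev.eq_sum {α : ℕ} (hα : 2 ≤ α) {γ : Finset (Fin s) → ℝ} {f : (Fin s → ℝ) → ℝ}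
    (hf : MemSobolev α γ f) {x : Fin s → ℝ} (hx : x ∈ closedCube (Fin s)) :
    f x = ∑ u : Finset (Fin s), ∑ v ∈ u.powerset, ∑ β ∈ multiIndices α u v,
      ∫ y in cube {j // j ∈ v}, partialIntegral v (weakDeriv β f) y * expandKernelOn α v β x y := by
  rw [eq_expansion hα hf.continuousOn (F := fun β => weakDeriv β f) hf.isWeakDeriv hx, expansion,
    sum_multiIndices hα]
  refine Finset.sum_congr rfl fun u _ => Finset.sum_congr rfl fun v hv =>
    Finset.sum_congr rfl fun β hβ => ?_
  rw [Finset.mem_powerset] at hv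
  have hβα := ((mem_multiIndices_iff hα hv β).1 hβ).1
  simp only [prod_expandKernel_eq hα hv hβ]
  refine integral_mul_restrict_eq ?_
  simp only [← prod_expandKernel_eq hα hv hβ]
  obtain ⟨C, hC⟩ := exists_bound_prod_expandKernel hα β
  refine (hf.isWeakDeriv β hβα).integrable.mul_bdd (c := C) ?_ ?_
  · exact ((continuous_prod_expandKernel hα β).comp
      (continuous_const.prodMk continuous_id)).aestronglyMeasurable
  · filter_upwards [ae_mem_cube (Fin s)] with t ht using hC x hx t (cube_subset_closedCube _ ht)

lemma MemSobolev.memLp {α : ℕ} (hα : 2 ≤ α) {γ : Finset (Fin s) → ℝ} {f : (Fin s → ℝ) → ℝ}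
    (hf : MemSobolev α γ f) {u v : Finset (Fin s)} (hv : v ∈ u.powerset) {β : Fin s → ℕ}
    (hβ : β ∈ multiIndices α u v) :
    MemLp (partialIntegral v (weakDeriv β f)) 2 (volume.restrict (cube {j // j ∈ v})) :=
  memLp_partialIntegral (hf.isWeakDeriv β
    ((mem_multiIndices_iff hα (Finset.mem_powerset.1 hv) β).1 hβ).1).1

/-- A vanishing sum of squared `L²` norms has only vanishing terms. This is the input for weights `γ
u = 0`, whose terms the inner product discards (`0⁻¹ = 0`) although the expansion does not. -/
lemma MemSobolev.partialIntegral_ae_eq_zero {α : ℕ} (hα : 2 ≤ α) {γ : Finset (Fin s) → ℝ}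
    {f : (Fin s → ℝ) → ℝ} (hf : MemSobolev α γ f) {u v : Finset (Fin s)} (hu : γ u = 0)
    (hv : v ∈ u.powerset) {β : Fin s → ℕ} (hβ : β ∈ multiIndices α u v) :
    partialIntegral v (weakDeriv β f) =ᵐ[volume.restrict (cube {j // j ∈ v})] 0 := by
  have h0 := hf.innerPart_eq_zero u hu
  rw [innerPart] at h0
  have hnn : ∀ v β, 0 ≤ ∫ y in cube {j // j ∈ v},
      partialIntegral v (weakDeriv β f) y * partialIntegral v (weakDeriv β f) y :=
    fun v β => integral_nonneg fun y => mul_self_nonneg _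
  rw [Finset.sum_eq_zero_iff_of_nonneg fun v _ => Finset.sum_nonneg fun β _ => hnn v β] at h0
  have h1 := h0 v hv
  rw [Finset.sum_eq_zero_iff_of_nonneg fun β _ => hnn v β] at h1
  have hm := hf.memLp hα hv hβ
  have h2 := h1 β hβ
  rw [integral_eq_zero_iff_of_nonneg (fun y => mul_self_nonneg _) (hm.integrable_mul hm)] at h2
  filter_upwards [h2] with y hy
  exact mul_self_eq_zero.1 hy

/-! ### The Cauchy–Schwarz inequality -/

lemma sobolevInner_self_nonneg {α : ℕ} {γ : Finset (Fin s) → ℝ} (hγ : ∀ u, 0 ≤ γ u)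
    (f : (Fin s → ℝ) → ℝ) : 0 ≤ sobolevInner α γ f f :=
  Finset.sum_nonneg fun u _ => mul_nonneg (inv_nonneg.2 (hγ u)) <|
    Finset.sum_nonneg fun _ _ => Finset.sum_nonneg fun _ _ =>
      integral_nonneg fun _ => mul_self_nonneg _

/-- Discriminant of the nonnegative quadratic `c ↦ ‖c f + g‖²`. The square is formed from the
partial integrals, which avoids any appeal to linearity of the chosen representatives `weakDeriv`.
-/
lemma sobolevInner_sq_le {α : ℕ} (hα : 2 ≤ α) {γ : Finset (Fin s) → ℝ} (hγ : ∀ u, 0 ≤ γ u)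
    {f g : (Fin s → ℝ) → ℝ} (hf : MemSobolev α γ f) (hg : MemSobolev α γ g) :
    sobolevInner α γ f g ^ 2 ≤ sobolevInner α γ f f * sobolevInner α γ g g := by
  have key : ∀ c : ℝ, 0 ≤ sobolevInner α γ f f * (c * c) + 2 * sobolevInner α γ f g * c +
      sobolevInner α γ g g := by
    intro c
    have e : sobolevInner α γ f f * (c * c) + 2 * sobolevInner α γ f g * c +
        sobolevInner α γ g g = ∑ u : Finset (Fin s), (γ u)⁻¹ * ∑ v ∈ u.powerset,
          ∑ β ∈ multiIndices α u v, ∫ y in cube {j // j ∈ v},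
          (c * partialIntegral v (weakDeriv β f) y + partialIntegral v (weakDeriv β g) y) ^ 2 := by
      simp only [sobolevInner, innerPart, Finset.sum_mul, Finset.mul_sum, ← Finset.sum_add_distrib]
      refine Finset.sum_congr rfl fun u _ => Finset.sum_congr rfl fun v hv =>
        Finset.sum_congr rfl fun β hβ => ?_
      have hm := hf.memLp hα hv hβ
      have hm' := hg.memLp hα hv hβ
      have e1 : ∀ y, (c * partialIntegral v (weakDeriv β f) y +
          partialIntegral v (weakDeriv β g) y) ^ 2 =
          (c * c) * (partialIntegral v (weakDeriv β f) y * partialIntegral v (weakDeriv β f) y) +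
          (2 * c) * (partialIntegral v (weakDeriv β f) y * partialIntegral v (weakDeriv β g) y) +
          partialIntegral v (weakDeriv β g) y * partialIntegral v (weakDeriv β g) y := by
        intro y
        ring
      simp only [e1]
      have i1 := hm.integrable_mul hm
      have i2 := hm.integrable_mul hm'
      have i3 := hm'.integrable_mul hm'
      rw [integral_add, integral_add, integral_const_mul, integral_const_mul]
      · ring
      · exact i1.const_mul _
      · exact i2.const_mul _
      · exact (i1.const_mul _).add (i2.const_mul _)
      · exact i3
    rw [e]
    exact Finset.sum_nonneg fun u _ => mul_nonneg (inv_nonneg.2 (hγ u)) <|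
      Finset.sum_nonneg fun _ _ => Finset.sum_nonneg fun _ _ =>
        integral_nonneg fun _ => sq_nonneg _
  have := discrim_le_zero key
  rw [discrim] at this
  nlinarith

end
end FoldedLattice

/-! ### Weak derivatives of kernel sections. -/

namespace FoldedLattice
noncomputable section
open MeasureTheory Set Polynomial
open scoped ContDiff

variable {s : ℕ}

/-! ### Weak derivatives of products of univariate functions -/

/-- The partial derivative in the direction of the `j`-th coordinate. -/
def partialDeriv (j : Fin s) (g : (Fin s → ℝ) → ℝ) (x : Fin s → ℝ) : ℝ :=
  fderiv ℝ g x (Pi.single j 1)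

/-- Smooth functions with compact support in the open cube. -/
def IsCubeBump (g : (Fin s → ℝ) → ℝ) : Prop :=
  ContDiff ℝ ∞ g ∧ tsupport g ⊆ openCube (Fin s)

lemma IsCubeBump.hasCompactSupport {g : (Fin s → ℝ) → ℝ} (hg : IsCubeBump g) :
    HasCompactSupport g := hasCompactSupport_of_subset_openCube hg.2

lemma IsCubeBump.partialDeriv {g : (Fin s → ℝ) → ℝ} (hg : IsCubeBump g) (j : Fin s) :
    IsCubeBump (partialDeriv j g) :=
  ⟨(hg.1.fderiv_right (by simp)).clm_apply contDiff_const,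
    (tsupport_fderiv_apply_subset ℝ _).trans hg.2⟩

lemma IsCubeBump.iterate_partialDeriv {g : (Fin s → ℝ) → ℝ} (hg : IsCubeBump g) (j : Fin s)
    (n : ℕ) : IsCubeBump ((FoldedLattice.partialDeriv j)^[n] g) := by
  induction n with
  | zero => exact hg
  | succ n ih =>
    rw [Function.iterate_succ_apply']
    exact ih.partialDeriv j

lemma iteratedDeriv_update {g : (Fin s → ℝ) → ℝ} (hg : IsCubeBump g) (j : Fin s) (x : Fin s → ℝ)
    (n : ℕ) : iteratedDeriv n (fun t => g (Function.update x j t)) =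
      fun t => (partialDeriv j)^[n] g (Function.update x j t) := by
  induction n generalizing g with
  | zero => simp
  | succ n ih =>
    rw [iteratedDeriv_succ', Function.iterate_succ_apply, ← ih (hg.partialDeriv j)]
    congr 1
    funext t
    exact (((hg.1.differentiable (by simp)) _).hasFDerivAt.comp_hasDerivAt t
      (hasDerivAt_update x j t)).deriv

/-- A family of univariate functions `h i n` such that `h i (n + 1)` is the derivative of `h i n`
for `n < α`. -/
structure DerivFamily (α : ℕ) (h : Fin s → ℕ → ℝ → ℝ) : Prop where
  continuous : ∀ i, ∀ n ≤ α, Continuous (h i n)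
  hasDerivAt : ∀ i, ∀ n < α, ∀ x, HasDerivAt (h i n) (h i (n + 1) x) x

/-- The product of the members of a family of functions with indices `e i`. -/
def familyProd (h : Fin s → ℕ → ℝ → ℝ) (e : Fin s → ℕ) (x : Fin s → ℝ) : ℝ := ∏ i, h i (e i) (x i)

lemma DerivFamily.continuous_familyProd {α : ℕ} {h : Fin s → ℕ → ℝ → ℝ} (hh : DerivFamily α h)
    {e : Fin s → ℕ} (he : ∀ i, e i ≤ α) : Continuous (familyProd h e) :=
  continuous_finsetProd _ fun i _ => (hh.continuous i _ (he i)).comp (continuous_apply i)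

lemma DerivFamily.hasLineDerivAt {α : ℕ} {h : Fin s → ℕ → ℝ → ℝ} (hh : DerivFamily α h)
    {e : Fin s → ℕ} {j : Fin s} (hj : e j < α) (x : Fin s → ℝ) :
    HasLineDerivAt ℝ (familyProd h e) (familyProd h (Function.update e j (e j + 1)) x) x
      (Pi.single j 1) := by
  unfold HasLineDerivAt
  have e1 : (fun t : ℝ => familyProd h e (x + t • Pi.single j 1)) =
      fun t => h j (e j) (x j + t) * ∏ i ∈ Finset.univ.erase j, h i (e i) (x i) := by
    funext t
    rw [familyProd, ← Finset.mul_prod_erase _ _ (Finset.mem_univ j)]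
    congr 1
    · simp
    · refine Finset.prod_congr rfl fun i hi => ?_
      simp [Finset.ne_of_mem_erase hi]
  have e2 : familyProd h (Function.update e j (e j + 1)) x =
      h j (e j + 1) (x j) * ∏ i ∈ Finset.univ.erase j, h i (e i) (x i) := by
    rw [familyProd, ← Finset.mul_prod_erase _ _ (Finset.mem_univ j)]
    congr 1
    · simp
    · refine Finset.prod_congr rfl fun i hi => ?_
      simp [Finset.ne_of_mem_erase hi]
  rw [e1, e2]
  refine HasDerivAt.mul_const ?_ _
  refine HasDerivAt.comp_const_add (x j) 0 ?_
  rw [add_zero]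
  exact hh.hasDerivAt j _ hj _

lemma IsCubeBump.integrable_mul {g : (Fin s → ℝ) → ℝ} (hg : IsCubeBump g) {H : (Fin s → ℝ) → ℝ}
    (hH : Continuous H) : Integrable fun x => H x * g x :=
  (hH.mul hg.1.continuous).integrable_of_hasCompactSupport hg.hasCompactSupport.mul_left

/-- Compact support of the bump makes all products integrable and leaves no boundary term; of the
family only the derivative along the `j`-th axis is used. -/
lemma DerivFamily.integral_partialDeriv {α : ℕ} {h : Fin s → ℕ → ℝ → ℝ} (hh : DerivFamily α h)
    {e : Fin s → ℕ} (he : ∀ i, e i ≤ α) {j : Fin s} (hj : e j < α) {g : (Fin s → ℝ) → ℝ}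
    (hg : IsCubeBump g) :
    ∫ x, familyProd h e x * partialDeriv j g x =
      - ∫ x, familyProd h (Function.update e j (e j + 1)) x * g x := by
  have he' : ∀ i, Function.update e j (e j + 1) i ≤ α := by
    intro i
    rcases eq_or_ne i j with rfl | hij
    · simpa using hj
    · simpa [hij] using he i
  refine integral_bilinear_hasLineDerivAt_right_eq_neg_left_of_integrable
    (B := ContinuousLinearMap.mul ℝ ℝ) (v := Pi.single j (1 : ℝ)) ?_ ?_ ?_ ?_ ?_
  · exact hg.integrable_mul (hh.continuous_familyProd he')
  · exact (hg.partialDeriv j).integrable_mul (hh.continuous_familyProd he)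
  · exact hg.integrable_mul (hh.continuous_familyProd he)
  · exact fun x _ => hh.hasLineDerivAt hj x
  · exact fun x _ => ((hg.1.differentiable (by simp)) x).hasFDerivAt.hasLineDerivAt _

lemma DerivFamily.integral_iterate_partialDeriv {α : ℕ} {h : Fin s → ℕ → ℝ → ℝ}
    (hh : DerivFamily α h) {e : Fin s → ℕ} (he : ∀ i, e i ≤ α) {j : Fin s} {n : ℕ}
    (hj : e j + n ≤ α) {g : (Fin s → ℝ) → ℝ} (hg : IsCubeBump g) :
    ∫ x, familyProd h e x * (partialDeriv j)^[n] g x =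
      (-1) ^ n * ∫ x, familyProd h (Function.update e j (e j + n)) x * g x := by
  induction n generalizing g with
  | zero => simp
  | succ n ih =>
    have he' : ∀ i, Function.update e j (e j + n) i ≤ α := by
      intro i
      rcases eq_or_ne i j with rfl | hij
      · rw [Function.update_self]
        omega
      · simpa [hij] using he i
    rw [Function.iterate_succ_apply, ih (by omega) (hg.partialDeriv j),
      hh.integral_partialDeriv he' (by rw [Function.update_self]; omega) hg]
    simp only [Function.update_self, Function.update_idem, add_assoc]
    ring

/-- Induction over the coordinates already differentiated. Both assertions are carried together
because the next integration by parts needs the partly differentiated test function to be a bump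
again; no coordinate is repeated, so each order is raised once. -/
lemma DerivFamily.foldr_mixedDeriv {α : ℕ} {h : Fin s → ℕ → ℝ → ℝ} (hh : DerivFamily α h)
    {β : Fin s → ℕ} {φ : (Fin s → ℝ) → ℝ} (hφ : IsCubeBump φ) {l : List (Fin s)} (hl : l.Nodup) :
    IsCubeBump (l.foldr (fun j g x =>
      iteratedDeriv (β j) (fun t => g (Function.update x j t)) (x j)) φ) ∧
    ∀ e : Fin s → ℕ, (∀ i, e i ≤ α) → (∀ i ∈ l, e i + β i ≤ α) →
      ∫ x, familyProd h e x * l.foldr (fun j g x =>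
        iteratedDeriv (β j) (fun t => g (Function.update x j t)) (x j)) φ x =
      (-1) ^ (l.map β).sum *
        ∫ x, familyProd h (fun i => if i ∈ l then e i + β i else e i) x * φ x := by
  induction l with
  | nil => exact ⟨hφ, fun e _ _ => by simp⟩
  | cons j l ih =>
    rw [List.nodup_cons] at hl
    obtain ⟨ih1, ih2⟩ := ih hl.2
    have e1 : (j :: l).foldr (fun j g x =>
        iteratedDeriv (β j) (fun t => g (Function.update x j t)) (x j)) φ =
        (partialDeriv j)^[β j] (l.foldr (fun j g x =>
          iteratedDeriv (β j) (fun t => g (Function.update x j t)) (x j)) φ) := by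
      rw [List.foldr_cons]
      funext x
      rw [iteratedDeriv_update ih1]
      simp
    rw [e1]
    refine ⟨ih1.iterate_partialDeriv j _, fun e he hel => ?_⟩
    rw [hh.integral_iterate_partialDeriv he (hel j (by simp)) ih1, ih2, List.map_cons,
      List.sum_cons, pow_add, mul_assoc]
    · have e2 : (fun i => if i ∈ l then Function.update e j (e j + β j) i + β i else
          Function.update e j (e j + β j) i) = fun i => if i ∈ j :: l then e i + β i else e i := by
        funext i
        rcases eq_or_ne i j with rfl | hij
        · simp [hl.1]
        · simp [hij]
      rw [e2]
    · intro i
      rcases eq_or_ne i j with rfl | hij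
      · rw [Function.update_self]
        exact hel i (by simp)
      · simpa [hij] using he i
    · intro i hi
      have hij : i ≠ j := fun h => hl.1 (h ▸ hi)
      simpa [hij] using hel i (by simp [hi])

lemma IsCubeBump.setIntegral_eq {g : (Fin s → ℝ) → ℝ} (hg : IsCubeBump g)
    (H : (Fin s → ℝ) → ℝ) : ∫ x in cube (Fin s), H x * g x = ∫ x, H x * g x := by
  refine setIntegral_eq_integral_of_forall_compl_eq_zero fun x hx => ?_
  rw [image_eq_zero_of_notMem_tsupport fun h => hx (openCube_subset_cube _ (hg.2 h)), mul_zero]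

lemma memLp_of_continuous {g : (Fin s → ℝ) → ℝ} (hg : Continuous g) :
    MemLp g 2 (volume.restrict (cube (Fin s))) := by
  obtain ⟨C, hC⟩ := (isCompact_closedCube (Fin s)).exists_bound_of_continuousOn hg.continuousOn
  refine MemLp.of_bound hg.aestronglyMeasurable C ?_
  filter_upwards [ae_mem_cube (Fin s)] with x hx using hC x (cube_subset_closedCube _ hx)

/-- Linear combinations of products of differentiable univariate functions have the expected
weak derivatives. -/
lemma isWeakDeriv_sum_familyProd {α : ℕ} {I : Type*} (S : Finset I) (c : I → ℝ)
    {h : I → Fin s → ℕ → ℝ → ℝ} (hh : ∀ i ∈ S, DerivFamily α (h i)) {β : Fin s → ℕ}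
    (hβ : ∀ j, β j ≤ α) :
    IsWeakDeriv β (fun x => ∑ i ∈ S, c i * familyProd (h i) 0 x)
      (fun x => ∑ i ∈ S, c i * familyProd (h i) β x) := by
  refine ⟨memLp_of_continuous (continuous_finsetSum _ fun i hi =>
    continuous_const.mul ((hh i hi).continuous_familyProd hβ)), fun φ h1 _ h2 => ?_⟩
  have hφ : IsCubeBump φ := ⟨h1, h2⟩
  rcases S.eq_empty_or_nonempty with rfl | ⟨i₀, hi₀⟩
  · simp
  have hm : IsCubeBump (mixedDeriv β φ) :=
    ((hh i₀ hi₀).foldr_mixedDeriv hφ (List.nodup_finRange s)).1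
  rw [hm.setIntegral_eq, hφ.setIntegral_eq]
  simp only [Finset.sum_mul]
  rw [integral_finsetSum, integral_finsetSum, Finset.mul_sum]
  · refine Finset.sum_congr rfl fun i hi => ?_
    have := ((hh i hi).foldr_mixedDeriv (β := β) hφ (List.nodup_finRange s)).2 0
      (fun _ => Nat.zero_le _) (fun j _ => by simpa using hβ j)
    simp only [List.mem_finRange, if_true, Pi.zero_apply, zero_add, ← Fin.sum_univ_def] at this
    simp only [mul_assoc, integral_const_mul]
    rw [show mixedDeriv β φ = (List.finRange s).foldr (fun j g x =>
      iteratedDeriv (β j) (fun t => g (Function.update x j t)) (x j)) φ from rfl, this]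
    ring
  · intro i hi
    exact hφ.integrable_mul (continuous_const.mul ((hh i hi).continuous_familyProd hβ))
  · intro i hi
    exact hm.integrable_mul (continuous_const.mul
      ((hh i hi).continuous_familyProd fun _ => Nat.zero_le _))

/-- Fundamental lemma of the calculus of variations. It identifies the arbitrarily chosen
`weakDeriv` with any explicit candidate. -/
lemma IsWeakDeriv.ae_eq {β : Fin s → ℕ} {f g g' : (Fin s → ℝ) → ℝ} (h : IsWeakDeriv β f g)
    (h' : IsWeakDeriv β f g') : g =ᵐ[volume.restrict (cube (Fin s))] g' := by
  have hi := h.integrable.sub h'.integrable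
  rw [restrict_cube_eq_restrict_openCube] at hi ⊢
  have key := (isOpen_openCube (Fin s)).ae_eq_zero_of_integral_contDiff_smul_eq_zero
    (μ := volume) (f := g - g') (IntegrableOn.locallyIntegrableOn hi) ?_
  · rw [Filter.EventuallyEq, ae_restrict_iff' (isOpen_openCube _).measurableSet]
    filter_upwards [key] with x hx hxo
    exact sub_eq_zero.1 (hx hxo)
  · intro φ h1 h2 h3
    have hφ : IsCubeBump φ := ⟨h1, h3⟩
    have e := (h.2 φ h1 h2 h3).symm.trans (h'.2 φ h1 h2 h3)
    have hne : ((-1 : ℝ) ^ (∑ i, β i)) ≠ 0 := by positivity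
    have e2 := mul_left_cancel₀ hne e
    obtain ⟨C, hC⟩ := h2.exists_bound_of_continuous h1.continuous
    have hb : ∀ {g : (Fin s → ℝ) → ℝ}, Integrable g (volume.restrict (cube (Fin s))) →
        Integrable (fun x => g x * φ x) (volume.restrict (cube (Fin s))) := fun hg =>
      hg.mul_bdd h1.continuous.aestronglyMeasurable (.of_forall hC)
    have e3 : ∫ x in cube (Fin s), (g - g') x * φ x = 0 := by
      simp only [Pi.sub_apply, sub_mul]
      rw [integral_sub (hb h.integrable) (hb h'.integrable), e2, sub_self]
    rw [hφ.setIntegral_eq] at e3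
    simpa [mul_comm] using e3

/-! ### Linear combinations of sections of the kernel -/

/-- The derivatives of the factors of `∏_{j ∈ u} kernel₁ α · (z j)`. -/
def kernelFamily (α : ℕ) (u : Finset (Fin s)) (z : Fin s → ℝ) (i : Fin s) (n : ℕ) (x : ℝ) : ℝ :=
  if i ∈ u then kernelDeriv α n (z i) x else if n = 0 then 1 else 0

lemma derivFamily_kernelFamily {α : ℕ} (hα : 2 ≤ α) (u : Finset (Fin s)) (z : Fin s → ℝ) :
    DerivFamily α (kernelFamily α u z) := by
  constructor
  · intro i n hn
    unfold kernelFamily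
    split_ifs
    · exact continuous_kernelDeriv hα hn (z i)
    · exact continuous_const
    · exact continuous_const
  · intro i n hn x
    unfold kernelFamily
    by_cases hi : i ∈ u
    · simp only [hi, if_true]
      exact hasDerivAt_kernelDeriv hα hn (z i) x
    · simp only [hi, if_false, Nat.succ_ne_zero]
      exact hasDerivAt_const x _

lemma familyProd_kernelFamily_zero (α : ℕ) (u : Finset (Fin s)) (z x : Fin s → ℝ) :
    familyProd (kernelFamily α u z) 0 x = ∏ j ∈ u, kernel₁ α (x j) (z j) := by
  simp only [familyProd, kernelFamily, Pi.zero_apply, if_true, kernelDeriv_zero]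
  rw [Finset.prod_ite_mem, Finset.univ_inter]

/-- The linear combination `∑_n ∑_u κ(n, u) ∏_{j ∈ u} kernel₁ α (x j) (P n j)`. -/
def kernelComb (α N : ℕ) (P : ℕ → Fin s → ℝ) (κ : ℕ → Finset (Fin s) → ℝ) (x : Fin s → ℝ) : ℝ :=
  ∑ n ∈ Finset.range N, ∑ u : Finset (Fin s), κ n u * ∏ j ∈ u, kernel₁ α (x j) (P n j)

lemma kernelComb_eq (α N : ℕ) (P : ℕ → Fin s → ℝ) (κ : ℕ → Finset (Fin s) → ℝ) :
    kernelComb α N P κ = fun x => ∑ i ∈ Finset.range N ×ˢ Finset.univ,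
      κ i.1 i.2 * familyProd (kernelFamily α i.2 (P i.1)) 0 x := by
  funext x
  simp only [familyProd_kernelFamily_zero]
  rw [kernelComb, Finset.sum_product]

lemma isWeakDeriv_kernelComb {α : ℕ} (hα : 2 ≤ α) (N : ℕ) (P : ℕ → Fin s → ℝ)
    (κ : ℕ → Finset (Fin s) → ℝ) {β : Fin s → ℕ} (hβ : ∀ j, β j ≤ α) :
    IsWeakDeriv β (kernelComb α N P κ) fun x => ∑ i ∈ Finset.range N ×ˢ Finset.univ,
      κ i.1 i.2 * familyProd (kernelFamily α i.2 (P i.1)) β x := by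
  rw [kernelComb_eq]
  exact isWeakDeriv_sum_familyProd _ _ (fun i _ => derivFamily_kernelFamily hα i.2 (P i.1)) hβ

lemma partialIntegral_familyProd (v : Finset (Fin s)) (h : Fin s → ℕ → ℝ → ℝ) (β : Fin s → ℕ)
    (y : {j // j ∈ v} → ℝ) :
    partialIntegral v (familyProd h β) y = (∏ j : {j // j ∈ v}, h j (β j) (y j)) *
      ∏ j : {j // j ∉ v}, ∫ x in (0 : ℝ)..1, h j (β j) x := by
  simp only [partialIntegral, familyProd]
  have e : ∀ z : {j // j ∉ v} → ℝ, ∏ i, h i (β i) (glue v y z i) =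
      (∏ j : {j // j ∈ v}, h j (β j) (y j)) * ∏ j : {j // j ∉ v}, h j (β j) (z j) := by
    intro z
    rw [← Fintype.prod_subtype_mul_prod_subtype (fun j => j ∈ v)]
    congr 1
    · refine Finset.prod_congr (Finset.ext fun _ => by simp) fun j _ => ?_
      rw [glue_of_mem]
    · refine Finset.prod_congr rfl fun j _ => ?_
      rw [glue_of_notMem]
  simp only [e, integral_const_mul]
  rw [integral_cube_prod fun (j : {j // j ∉ v}) x => h j (β j) x]
  simp only [intervalIntegral.integral_of_le zero_le_one, integral_Ico_eq_integral_Ioc]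

/-- The orthogonality behind the reproducing property. A coordinate in `u'` but not in `u` is
integrated at order `0` and has mean zero; one in `u` but not in `u'` differentiates a constant.
When `u' = u`, coordinates in `v` give the remainder kernel and those in `u \ v` the Bernoulli
values. -/
lemma partialIntegral_familyProd_kernelFamily {α : ℕ} (hα : 2 ≤ α) {u u' v : Finset (Fin s)}
    (hv : v ⊆ u) {β : Fin s → ℕ} (hβ : β ∈ multiIndices α u v) {z : Fin s → ℝ}
    (hz : z ∈ closedCube (Fin s)) (y : {j // j ∈ v} → ℝ) :
    partialIntegral v (familyProd (kernelFamily α u' z) β) y =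
      if u' = u then expandKernelOn α v β z y else 0 := by
  rw [mem_multiIndices_iff hα hv] at hβ
  obtain ⟨h1, h2, h3⟩ := hβ
  have hu : ∀ j, j ∈ u ↔ β j ≠ 0 := fun j => by rw [← h2]; simp
  have hv' : ∀ j, j ∈ v ↔ β j = α := fun j => by rw [← h3]; simp
  have hint : ∀ j ∉ v, ∫ x in (0 : ℝ)..1, kernelFamily α u' z j (β j) x =
      if j ∈ u' then (if j ∈ u then nbern (β j) (z j) else 0) else (if j ∈ u then 0 else 1) := by
    intro j hj
    rw [hv'] at hj
    unfold kernelFamily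
    by_cases hju : j ∈ u'
    · simp only [hju, if_true]
      rw [integral_kernelDeriv hα (lt_of_le_of_ne (h1 j) hj) (hz j (mem_univ j))]
      by_cases h0 : β j = 0 <;> simp [hu, h0]
    · simp only [hju, if_false]
      by_cases h0 : β j = 0 <;> simp [hu, h0]
  rw [partialIntegral_familyProd]
  split_ifs with h
  · subst h
    rw [expandKernelOn]
    congr 1
    · refine Finset.prod_congr rfl fun j _ => ?_
      rw [kernelFamily, if_pos (hv j.2), (hv' j).1 j.2, kernelDeriv_self (by omega)]
    · refine Finset.prod_congr rfl fun j _ => ?_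
      rw [hint j j.2]
      by_cases hj : (j : Fin s) ∈ u'
      · simp [hj]
      · have : β j = 0 := by simpa [hu] using hj
        simp [hj, this, nbern_zero]
  · obtain ⟨j, hj⟩ : ∃ j, ¬ (j ∈ u' ↔ j ∈ u) := by
      by_contra hcon
      push Not at hcon
      exact h (Finset.ext hcon)
    by_cases hjv : j ∈ v
    · have hju : j ∈ u := hv hjv
      have hju' : j ∉ u' := by tauto
      rw [Finset.prod_eq_zero (Finset.mem_univ (⟨j, hjv⟩ : {j // j ∈ v})), zero_mul]
      have : β j ≠ 0 := (hu j).1 hju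
      simp [kernelFamily, hju', this]
    · rw [mul_comm, Finset.prod_eq_zero (Finset.mem_univ (⟨j, hjv⟩ : {j // j ∉ v})), zero_mul]
      rw [hint j hjv]
      by_cases hju : j ∈ u <;> simp_all

lemma partialIntegral_sum {I : Type*} (S : Finset I) (c : I → ℝ) {g : I → (Fin s → ℝ) → ℝ}
    (hg : ∀ i ∈ S, Continuous (g i)) (v : Finset (Fin s)) (y : {j // j ∈ v} → ℝ) :
    partialIntegral v (fun x => ∑ i ∈ S, c i * g i x) y = ∑ i ∈ S, c i * partialIntegral v (g i) y := by
  simp only [partialIntegral]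
  rw [integral_finsetSum]
  · simp only [integral_const_mul]
  · intro i hi
    have hc : Continuous fun z => c i * g i (glue v y z) := by
      refine continuous_const.mul ((hg i hi).comp (continuous_pi fun j => ?_))
      unfold glue
      by_cases h : j ∈ v
      · simp only [h, dif_pos]
        exact continuous_const
      · simp only [h, dif_neg, not_false_eq_true]
        exact continuous_apply _
    exact (hc.continuousOn.integrableOn_compact (isCompact_closedCube _)).mono_set
      (cube_subset_closedCube _)

lemma partialIntegral_weakDeriv_kernelComb {α : ℕ} (hα : 2 ≤ α) {u v : Finset (Fin s)}
    (hv : v ∈ u.powerset) {β : Fin s → ℕ} (hβ : β ∈ multiIndices α u v) (N : ℕ)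
    {P : ℕ → Fin s → ℝ} (hP : ∀ n, P n ∈ closedCube (Fin s)) (κ : ℕ → Finset (Fin s) → ℝ) :
    partialIntegral v (weakDeriv β (kernelComb α N P κ))
      =ᵐ[volume.restrict (cube {j // j ∈ v})]
      fun y => ∑ n ∈ Finset.range N, κ n u * expandKernelOn α v β (P n) y := by
  rw [Finset.mem_powerset] at hv
  have hβα := ((mem_multiIndices_iff hα hv β).1 hβ).1
  have h := isWeakDeriv_kernelComb hα N P κ hβα
  refine (partialIntegral_congr_ae ((isWeakDeriv_weakDeriv ⟨_, h⟩).ae_eq h)).trans ?_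
  refine .of_forall fun y => ?_
  dsimp only
  rw [partialIntegral_sum (Finset.range N ×ˢ Finset.univ) (fun i => κ i.1 i.2)
    (g := fun i => familyProd (kernelFamily α i.2 (P i.1)) β)
    (fun i _ => (derivFamily_kernelFamily hα _ _).continuous_familyProd hβα), Finset.sum_product]
  refine Finset.sum_congr rfl fun n _ => ?_
  simp only [partialIntegral_familyProd_kernelFamily hα hv hβ (hP n)]
  simp

lemma memSobolev_kernelComb {α : ℕ} (hα : 2 ≤ α) {γ : Finset (Fin s) → ℝ} (N : ℕ)
    {P : ℕ → Fin s → ℝ} (hP : ∀ n, P n ∈ closedCube (Fin s)) {κ : ℕ → Finset (Fin s) → ℝ}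
    (hκ : ∀ n u, γ u = 0 → κ n u = 0) : MemSobolev α γ (kernelComb α N P κ) := by
  refine ⟨?_, fun β hβ => ⟨_, isWeakDeriv_kernelComb hα N P κ hβ⟩, fun u hu => ?_⟩
  · rw [kernelComb_eq]
    exact (continuous_finsetSum _ fun i _ => continuous_const.mul
      ((derivFamily_kernelFamily hα _ _).continuous_familyProd fun _ => Nat.zero_le _)).continuousOn
  · rw [innerPart]
    refine Finset.sum_eq_zero fun v hv => Finset.sum_eq_zero fun β hβ => ?_
    refine integral_eq_zero_of_ae ?_
    filter_upwards [partialIntegral_weakDeriv_kernelComb hα hv hβ N hP κ] with y hy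
    rw [hy]
    simp [hκ _ _ hu]

end
end FoldedLattice

/-! ### Representer of the integration error and the closed form of the worst-case error. -/

namespace FoldedLattice
noncomputable section
open MeasureTheory Set Polynomial
open scoped ContDiff

variable {s : ℕ}

/-! ### The worst-case error -/

/-- The part of the Bernoulli expansion of `f` at `x` that belongs to `u`. -/
def expansionPart (α : ℕ) (f : (Fin s → ℝ) → ℝ) (x : Fin s → ℝ) (u : Finset (Fin s)) : ℝ :=
  ∑ v ∈ u.powerset, ∑ β ∈ multiIndices α u v,
    ∫ y in cube {j // j ∈ v}, partialIntegral v (weakDeriv β f) y * expandKernelOn α v β x y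

lemma integrable_mul_expandKernelOn {α : ℕ} (hα : 2 ≤ α) {v : Finset (Fin s)} (β : Fin s → ℕ)
    (x : Fin s → ℝ) {c : ({j // j ∈ v} → ℝ) → ℝ}
    (hc : Integrable c (volume.restrict (cube {j // j ∈ v}))) :
    Integrable (fun y => c y * expandKernelOn α v β x y)
      (volume.restrict (cube {j // j ∈ v})) := by
  have hcont : Continuous fun y => expandKernelOn α v β x y :=
    (continuous_expandKernelOn hα v β).comp (continuous_const.prodMk continuous_id)
  obtain ⟨C, hC⟩ := (isCompact_closedCube {j // j ∈ v}).exists_bound_of_continuousOn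
    hcont.continuousOn
  refine hc.mul_bdd (c := C) hcont.aestronglyMeasurable ?_
  filter_upwards [ae_mem_cube _] with y hy using hC y (cube_subset_closedCube _ hy)

lemma MemSobolev.expansionPart_eq_zero {α : ℕ} (hα : 2 ≤ α) {γ : Finset (Fin s) → ℝ}
    {f : (Fin s → ℝ) → ℝ} (hf : MemSobolev α γ f) (x : Fin s → ℝ) {u : Finset (Fin s)}
    (hu : γ u = 0) : expansionPart α f x u = 0 := by
  refine Finset.sum_eq_zero fun v hv => Finset.sum_eq_zero fun β hβ => integral_eq_zero_of_ae ?_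
  filter_upwards [hf.partialIntegral_ae_eq_zero hα hu hv hβ] with y hy
  rw [hy]
  simp

/-- The reproducing property, one `u` at a time: partial integrals of a kernel section are the
building blocks of the expansion, so the pairing returns the part of `f` that belongs to `u` at the
base point, rescaled by `(γ u)⁻¹`. -/
lemma MemSobolev.sobolevInner_kernelComb {α : ℕ} (hα : 2 ≤ α) {γ : Finset (Fin s) → ℝ}
    {f : (Fin s → ℝ) → ℝ} (hf : MemSobolev α γ f) (N : ℕ) {P : ℕ → Fin s → ℝ}
    (hP : ∀ n, P n ∈ closedCube (Fin s)) (κ : ℕ → Finset (Fin s) → ℝ) :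
    sobolevInner α γ f (kernelComb α N P κ) =
      ∑ u : Finset (Fin s), ∑ n ∈ Finset.range N, (γ u)⁻¹ * κ n u * expansionPart α f (P n) u := by
  refine Finset.sum_congr rfl fun u _ => ?_
  have e : innerPart α u f (kernelComb α N P κ) = ∑ v ∈ u.powerset, ∑ β ∈ multiIndices α u v,
      ∑ n ∈ Finset.range N, κ n u * ∫ y in cube {j // j ∈ v},
        partialIntegral v (weakDeriv β f) y * expandKernelOn α v β (P n) y := by
    refine Finset.sum_congr rfl fun v hv => Finset.sum_congr rfl fun β hβ => ?_
    have hi := (hf.memLp hα hv hβ).integrable (by norm_num)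
    simp only [← integral_const_mul]
    rw [← integral_finsetSum _
      fun n _ => (integrable_mul_expandKernelOn hα β (P n) hi).const_mul _]
    refine integral_congr_ae ?_
    filter_upwards [partialIntegral_weakDeriv_kernelComb hα hv hβ N hP κ] with y hy
    rw [hy, Finset.mul_sum]
    exact Finset.sum_congr rfl fun n _ => by ring
  rw [e]
  simp only [expansionPart, Finset.mul_sum]
  symm
  rw [Finset.sum_comm (s := Finset.range N)]
  refine Finset.sum_congr rfl fun v _ => ?_
  rw [Finset.sum_comm (s := Finset.range N)]
  exact Finset.sum_congr rfl fun β _ => Finset.sum_congr rfl fun n _ => by ring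

lemma MemSobolev.isWeakDeriv_zero {α : ℕ} {γ : Finset (Fin s) → ℝ} {f : (Fin s → ℝ) → ℝ}
    (hf : MemSobolev α γ f) : IsWeakDeriv 0 f f := by
  obtain ⟨C, hC⟩ := (isCompact_closedCube (Fin s)).exists_bound_of_continuousOn hf.continuousOn
  refine ⟨MemLp.of_bound ?_ C ?_, fun φ _ _ _ => ?_⟩
  · exact (hf.continuousOn.mono (cube_subset_closedCube _)).aestronglyMeasurable
      (measurableSet_cube _)
  · filter_upwards [ae_mem_cube _] with x hx using hC x (cube_subset_closedCube _ hx)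
  · have : mixedDeriv (0 : Fin s → ℕ) φ = φ := by
      rw [mixedDeriv]
      induction List.finRange s with
      | nil => rfl
      | cons j l ih =>
        rw [List.foldr_cons, ih]
        simp
    simp [this]

/-- For `u = ∅` only the order-zero derivative occurs and everything is integrated out. The exact
integral is thus one part of the expansion, and the error involves only the nonempty `u`. -/
lemma MemSobolev.expansionPart_empty {α : ℕ} {γ : Finset (Fin s) → ℝ}
    {f : (Fin s → ℝ) → ℝ} (hf : MemSobolev α γ f) (x : Fin s → ℝ) :
    expansionPart α f x ∅ = ∫ x in cube (Fin s), f x := by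
  have h0 : multiIndices α (∅ : Finset (Fin s)) ∅ = {0} := by
    simp only [multiIndices, Finset.notMem_empty, if_false]
    rw [Fintype.piFinset_singleton]
    rfl
  have hw := hf.isWeakDeriv 0 fun _ => Nat.zero_le _
  rw [expansionPart, Finset.powerset_empty, Finset.sum_singleton, h0, Finset.sum_singleton,
    ← integral_congr_ae (hw.ae_eq hf.isWeakDeriv_zero)]
  have e : ∀ y, expandKernelOn α ∅ 0 x y = 1 := by
    intro y
    simp [expandKernelOn, nbern_zero]
  simp only [e]
  rw [← integral_mul_restrict_eq (h := fun _ => 1)]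
  · simp
  · simpa using hw.integrable

/-- The coefficients of the representer of the integration error. -/
def errorCoeff (γ : Finset (Fin s) → ℝ) (N : ℕ) (c : ℝ) (_ : ℕ) (u : Finset (Fin s)) : ℝ :=
  if u = ∅ then 0 else c * (-(1 / (N : ℝ)) * γ u)

lemma errorCoeff_eq_zero {γ : Finset (Fin s) → ℝ} (N : ℕ) (c : ℝ) (n : ℕ) (u : Finset (Fin s))
    (hu : γ u = 0) : errorCoeff γ N c n u = 0 := by
  simp [errorCoeff, hu]

/-- The integration error is represented by the function with coefficients `errorCoeff`. -/
lemma MemSobolev.sobolevInner_errorCoeff {α : ℕ} (hα : 2 ≤ α) {γ : Finset (Fin s) → ℝ}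
    {f : (Fin s → ℝ) → ℝ} (hf : MemSobolev α γ f) {N : ℕ} (hN : N ≠ 0) {P : ℕ → Fin s → ℝ}
    (hP : ∀ n, P n ∈ closedCube (Fin s)) (c : ℝ) :
    sobolevInner α γ f (kernelComb α N P (errorCoeff γ N c)) =
      c * ((∫ x in cube (Fin s), f x) - qmc N P f) := by
  have hN' : (N : ℝ) ≠ 0 := by exact_mod_cast hN
  rw [hf.sobolevInner_kernelComb hα N hP, qmc]
  -- The part for `∅` is missing from the representer. Adding it on every point and compensating by
  -- the integral lets the sum run over all `u`, where the parts add up to `f (P n)`.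
  have e1 : ∀ u : Finset (Fin s), ∑ n ∈ Finset.range N,
      (γ u)⁻¹ * errorCoeff γ N c n u * expansionPart α f (P n) u =
      c * (-(1 / (N : ℝ)) * ∑ n ∈ Finset.range N, expansionPart α f (P n) u) +
        if u = ∅ then c * ∫ x in cube (Fin s), f x else 0 := by
    intro u
    by_cases hu : u = ∅
    · subst hu
      simp only [errorCoeff, if_true, hf.expansionPart_empty]
      simp
      field_simp
      ring
    · simp only [errorCoeff, hu, if_false, add_zero, Finset.mul_sum]
      refine Finset.sum_congr rfl fun n _ => ?_
      -- Here `(γ u)⁻¹ * γ u` is `0` rather than `1`, and the equation holds because the part of `f`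
      -- vanishes.
      by_cases h0 : γ u = 0
      · simp [hf.expansionPart_eq_zero hα (P n) h0]
      · field_simp
  rw [Finset.sum_congr rfl fun u _ => e1 u, Finset.sum_add_distrib, Finset.sum_ite_eq',
    if_pos (Finset.mem_univ _), ← Finset.mul_sum, ← Finset.mul_sum, Finset.sum_comm]
  have e2 : ∀ n, ∑ u : Finset (Fin s), expansionPart α f (P n) u = f (P n) := fun n =>
    (hf.eq_sum hα (hP n)).symm
  simp only [e2]
  ring

lemma kernelComb_errorCoeff (α : ℕ) (γ : Finset (Fin s) → ℝ) (N : ℕ) (P : ℕ → Fin s → ℝ) (c : ℝ)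
    (x : Fin s → ℝ) : kernelComb α N P (errorCoeff γ N c) x =
      c * (-(1 / (N : ℝ)) * ∑ n ∈ Finset.range N, (kernel α γ x (P n) - γ ∅)) := by
  simp only [kernelComb, kernel, Finset.mul_sum]
  refine Finset.sum_congr rfl fun n _ => ?_
  rw [← Finset.sum_erase_add _ _ (Finset.mem_univ (∅ : Finset (Fin s))),
    ← Finset.sum_erase_add _ _ (Finset.mem_univ (∅ : Finset (Fin s)))]
  simp only [errorCoeff, if_true, Finset.prod_empty, mul_one, add_zero,
    add_sub_cancel_right, Finset.mul_sum]
  refine Finset.sum_congr rfl fun u hu => ?_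
  rw [if_neg (Finset.ne_of_mem_erase hu)]
  ring

/-- Each univariate factor has mean zero, so only the empty product survives. -/
lemma integral_kernel {α : ℕ} (hα : 2 ≤ α) (γ : Finset (Fin s) → ℝ) {z : Fin s → ℝ}
    (hz : z ∈ closedCube (Fin s)) : ∫ x in cube (Fin s), kernel α γ x z = γ ∅ := by
  have hc : ∀ u : Finset (Fin s), Continuous (familyProd (kernelFamily α u z) 0) := fun u =>
    (derivFamily_kernelFamily hα u z).continuous_familyProd fun _ => Nat.zero_le _
  simp only [kernel, ← familyProd_kernelFamily_zero]
  rw [integral_finsetSum]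
  · simp only [integral_const_mul]
    rw [Finset.sum_eq_single ∅]
    · simp [familyProd_kernelFamily_zero]
    · intro u _ hu
      obtain ⟨j, hj⟩ := Finset.nonempty_iff_ne_empty.2 hu
      unfold familyProd
      rw [integral_cube_prod fun i x => kernelFamily α u z i ((0 : Fin s → ℕ) i) x,
        Finset.prod_eq_zero (Finset.mem_univ j), mul_zero]
      rw [integral_Ico_eq_integral_Ioc, ← intervalIntegral.integral_of_le zero_le_one]
      simp only [kernelFamily, hj, if_true, Pi.zero_apply]
      rw [integral_kernelDeriv hα (by omega) (hz j (mem_univ j)), if_pos rfl]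
    · simp
  · exact fun u _ => (memLp_of_continuous (continuous_const.mul (hc u))).integrable (by norm_num)

lemma continuous_kernel {α : ℕ} (hα : 2 ≤ α) (γ : Finset (Fin s) → ℝ) :
    Continuous fun z : (Fin s → ℝ) × (Fin s → ℝ) => kernel α γ z.1 z.2 := by
  unfold kernel
  refine continuous_finsetSum _ fun u _ => continuous_const.mul (continuous_finsetProd _ fun j _ => ?_)
  simp only [kernel₁_eq]
  refine (continuous_finsetSum _ fun τ _ => by fun_prop).add (continuous_const.mul ?_)
  exact (continuous_pbern (by omega)).comp
    (f := fun z : (Fin s → ℝ) × (Fin s → ℝ) => (z.1 j, z.2 j)) (by fun_prop)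

/-- The squared worst-case error in terms of the kernel. -/
def errorSq (α : ℕ) (γ : Finset (Fin s) → ℝ) (N : ℕ) (P : ℕ → Fin s → ℝ) : ℝ :=
  (1 / (N : ℝ)) * ∑ m ∈ Finset.range N,
    ((1 / (N : ℝ)) * ∑ n ∈ Finset.range N, (kernel α γ (P m) (P n) - γ ∅))

/-- The representer itself has mean zero, so its own error is a double sum of kernel values. Since
the error is the pairing with the representer, this also computes the norm of the representer. -/
lemma integral_sub_qmc_kernelComb {α : ℕ} (hα : 2 ≤ α) (γ : Finset (Fin s) → ℝ) (N : ℕ)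
    {P : ℕ → Fin s → ℝ} (hP : ∀ n, P n ∈ closedCube (Fin s)) (c : ℝ) :
    (∫ x in cube (Fin s), kernelComb α N P (errorCoeff γ N c) x) -
      qmc N P (kernelComb α N P (errorCoeff γ N c)) = c * errorSq α γ N P := by
  have hi : ∀ n, Integrable (fun x => kernel α γ x (P n)) (volume.restrict (cube (Fin s))) :=
    fun n => (memLp_of_continuous ((continuous_kernel hα γ).comp
      (continuous_id.prodMk continuous_const))).integrable (by norm_num)
  have h0 : ∫ x in cube (Fin s), kernelComb α N P (errorCoeff γ N c) x = 0 := by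
    simp only [kernelComb_errorCoeff]
    have hi' : ∀ n, Integrable (fun x => kernel α γ x (P n) - γ ∅)
        (volume.restrict (cube (Fin s))) := fun n => (hi n).sub (integrable_const _)
    rw [integral_const_mul, integral_const_mul, integral_finsetSum _ fun n _ => hi' n]
    rw [Finset.sum_eq_zero, mul_zero, mul_zero]
    intro n _
    rw [integral_sub (hi n) (integrable_const _), integral_kernel hα γ (hP n)]
    simp
  rw [h0, qmc, errorSq]
  simp only [kernelComb_errorCoeff, ← Finset.mul_sum]
  ring

/-- Riesz representation made explicit: the error functional is the pairing with an element of
squared norm `errorSq`; Cauchy–Schwarz bounds it, and the normalised representer attains the bound.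
-/
lemma isGreatest_errorSet {α : ℕ} (hα : 2 ≤ α) {γ : Finset (Fin s) → ℝ} (hγ : ∀ u, 0 ≤ γ u) {N : ℕ}
    (hN : N ≠ 0) {P : ℕ → Fin s → ℝ} (hP : ∀ n, P n ∈ closedCube (Fin s)) :
    0 ≤ errorSq α γ N P ∧ IsGreatest (errorSet α γ N P) √(errorSq α γ N P) := by
  have hmem : ∀ c, MemSobolev α γ (kernelComb α N P (errorCoeff γ N c)) := fun c =>
    memSobolev_kernelComb hα N hP fun n u hu => errorCoeff_eq_zero N c n u hu
  have hself : ∀ c, sobolevInner α γ (kernelComb α N P (errorCoeff γ N c))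
      (kernelComb α N P (errorCoeff γ N c)) = c * (c * errorSq α γ N P) := fun c => by
    rw [(hmem c).sobolevInner_errorCoeff hα hN hP, integral_sub_qmc_kernelComb hα γ N hP]
  have hE : 0 ≤ errorSq α γ N P := by
    have := sobolevInner_self_nonneg (α := α) hγ (kernelComb α N P (errorCoeff γ N 1))
    rwa [hself, one_mul, one_mul] at this
  have hsq := Real.mul_self_sqrt hE
  -- The convention `0⁻¹ = 0` makes the witness the zero function when the error is zero, so that
  -- case needs no other witness.
  refine ⟨hE, ⟨kernelComb α N P (errorCoeff γ N (√(errorSq α γ N P))⁻¹), hmem _, ?_, ?_⟩, ?_⟩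
  · rw [sobolevNorm, hself, Real.sqrt_le_iff]
    refine ⟨zero_le_one, ?_⟩
    rw [one_pow]
    rcases eq_or_ne (√(errorSq α γ N P)) 0 with h | h
    · simp [h]
    · nth_rewrite 3 [← hsq]
      field_simp
      exact le_rfl
  · rw [integral_sub_qmc_kernelComb hα γ N hP]
    rcases eq_or_ne (√(errorSq α γ N P)) 0 with h | h
    · simp [h]
    · nth_rewrite 3 [← hsq]
      rw [inv_mul_cancel_left₀ h, abs_of_nonneg (Real.sqrt_nonneg _)]
  · rintro r ⟨f, hf, hf1, rfl⟩
    have h1 := hf.sobolevInner_errorCoeff hα hN hP 1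
    rw [one_mul] at h1
    rw [← h1]
    refine Real.abs_le_sqrt ((sobolevInner_sq_le hα hγ hf (hmem 1)).trans ?_)
    rw [hself, one_mul, one_mul]
    rw [sobolevNorm, Real.sqrt_le_iff, one_pow] at hf1
    exact mul_le_of_le_one_left hE hf1.2

lemma worstCaseError_sq {α : ℕ} (hα : 2 ≤ α) {γ : Finset (Fin s) → ℝ} (hγ : ∀ u, 0 ≤ γ u) {N : ℕ}
    (hN : N ≠ 0) {P : ℕ → Fin s → ℝ} (hP : ∀ n, P n ∈ closedCube (Fin s)) :
    worstCaseError α γ N P ^ 2 = errorSq α γ N P := by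
  obtain ⟨h0, hg⟩ := isGreatest_errorSet hα hγ hN hP
  rw [worstCaseError, hg.csSup_eq, Real.sq_sqrt h0]

/-- The kernel as a sum of inner products of feature maps. -/
lemma kernel_eq_sum {α : ℕ} (hα : 2 ≤ α) (γ : Finset (Fin s) → ℝ) {x z : Fin s → ℝ}
    (hx : x ∈ closedCube (Fin s)) (hz : z ∈ closedCube (Fin s)) :
    kernel α γ x z = ∑ u : Finset (Fin s), ∑ v ∈ u.powerset, ∑ β ∈ multiIndices α u v,
      γ u * ∫ y in cube {j // j ∈ v}, expandKernelOn α v β z y * expandKernelOn α v β x y := by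
  -- With the weights as coefficients and a single base point the combination is the kernel section
  -- at `z`; its own Bernoulli expansion at `x` is the Gram form.
  have hm : MemSobolev α γ (kernelComb α 1 (fun _ => z) fun _ u => γ u) :=
    memSobolev_kernelComb hα 1 (fun _ => hz) fun _ _ hu => hu
  have h := hm.eq_sum hα hx
  rw [show kernelComb α 1 (fun _ => z) (fun _ u => γ u) x = kernel α γ x z by
    simp [kernelComb, kernel]] at h
  rw [h]
  refine Finset.sum_congr rfl fun u _ => Finset.sum_congr rfl fun v hv =>
    Finset.sum_congr rfl fun β hβ => ?_
  rw [← integral_const_mul]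
  refine integral_congr_ae ?_
  filter_upwards [partialIntegral_weakDeriv_kernelComb hα hv hβ 1 (fun _ => hz)
    (fun _ u => γ u)] with y hy
  rw [hy]
  simp [mul_assoc]

end
end FoldedLattice

/-! ### Binary digits, digital shifts, the tent map and Walsh functions. -/

namespace FoldedLattice
noncomputable section
open MeasureTheory Set Polynomial
open scoped ContDiff

/-! ### Binary digits of real numbers -/

lemma natDigit_eq_toNat (k i : ℕ) : natDigit k i = (k.testBit i).toNat := by
  rw [natDigit, Nat.testBit_eq_decide_div_mod_eq]
  rcases Nat.mod_two_eq_zero_or_one (k / 2 ^ i) with h | h <;> simp [h]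

lemma natDigit_xor (k l i : ℕ) : natDigit (k ^^^ l) i = (natDigit k i + natDigit l i) % 2 := by
  simp only [natDigit_eq_toNat, Nat.testBit_xor]
  cases k.testBit i <;> cases l.testBit i <;> rfl

lemma val_digits (x : ℝ) (i : ℕ) : (Real.digits x 2 i : ℕ) = ⌊x * 2 ^ (i + 1)⌋₊ % 2 := by
  simp [Real.digits]

/-- In `(C + f) / 2 ^ r` the first `r` digits are those of `C`, most significant first, hence the
index `r - 1 - i`; the companion lemma reads the later digits off `f`. -/
lemma val_digits_of_lt {C r i : ℕ} {f : ℝ} (hf : f ∈ Ico (0 : ℝ) 1) (hi : i < r) :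
    (Real.digits ((C + f) / 2 ^ r) 2 i : ℕ) = natDigit C (r - 1 - i) := by
  have e : ((C : ℝ) + f) / 2 ^ r * 2 ^ (i + 1) = (C + f) / ((2 ^ (r - 1 - i) : ℕ) : ℝ) := by
    have : (2 : ℝ) ^ r = 2 ^ (r - 1 - i) * 2 ^ (i + 1) := by
      rw [← pow_add]
      congr 1
      omega
    rw [this]
    push_cast
    field_simp
  rw [val_digits, e, Nat.floor_div_natCast, natDigit, add_comm, Nat.floor_add_natCast hf.1,
    Nat.floor_eq_zero.2 hf.2, zero_add]

lemma val_digits_of_le {C r i : ℕ} {f : ℝ} (hf : f ∈ Ico (0 : ℝ) 1) (hi : r ≤ i) :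
    (Real.digits ((C + f) / 2 ^ r) 2 i : ℕ) = ⌊f * 2 ^ (i + 1 - r)⌋₊ % 2 := by
  have e : ((C : ℝ) + f) / 2 ^ r * 2 ^ (i + 1) =
      f * 2 ^ (i + 1 - r) + ((2 * (C * 2 ^ (i - r)) : ℕ) : ℝ) := by
    have h1 : (2 : ℝ) ^ (i + 1) = 2 ^ r * 2 ^ (i + 1 - r) := by
      rw [← pow_add]
      congr 1
      omega
    have h2 : (2 : ℝ) ^ (i + 1 - r) = 2 * 2 ^ (i - r) := by
      rw [← pow_succ']
      congr 1
      omega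
    rw [h1]
    push_cast
    rw [h2]
    field_simp
    ring
  have hf0 : 0 ≤ f * 2 ^ (i + 1 - r) := mul_nonneg hf.1 (by positivity)
  rw [val_digits, e, Nat.floor_add_natCast hf0]
  omega

lemma add_fract_div_mem_Ico {C r : ℕ} {f : ℝ} (hf : f ∈ Ico (0 : ℝ) 1) (hC : C < 2 ^ r) :
    ((C : ℝ) + f) / 2 ^ r ∈ Ico (0 : ℝ) 1 := by
  have h1 : (C : ℝ) + 1 ≤ 2 ^ r := by exact_mod_cast hC
  have hf0 := hf.1
  refine ⟨by positivity, ?_⟩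
  rw [div_lt_one (by positivity)]
  linarith [hf.2]

lemma exists_eq_add_fract_div (r : ℕ) {σ : ℝ} (hσ : σ ∈ Ico (0 : ℝ) 1) :
    ∃ C : ℕ, C < 2 ^ r ∧ ∃ f ∈ Ico (0 : ℝ) 1, σ = ((C : ℝ) + f) / 2 ^ r := by
  have h0 : 0 ≤ σ * 2 ^ r := mul_nonneg hσ.1 (by positivity)
  refine ⟨⌊σ * 2 ^ r⌋₊, ?_, σ * 2 ^ r - ⌊σ * 2 ^ r⌋₊, ⟨?_, ?_⟩, ?_⟩
  · rw [Nat.floor_lt h0]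
    push_cast
    nlinarith [hσ.2, show (0 : ℝ) < 2 ^ r by positivity]
  · linarith [Nat.floor_le h0]
  · linarith [Nat.lt_floor_add_one (σ * 2 ^ r)]
  · field_simp
    ring

lemma digits_add_eq {X C r : ℕ} {f : ℝ} (hf : f ∈ Ico (0 : ℝ) 1) (i : ℕ) :
    Real.digits ((X : ℝ) / 2 ^ r) 2 i + Real.digits ((C + f) / 2 ^ r) 2 i =
      Real.digits (((X ^^^ C : ℕ) + f) / 2 ^ r) 2 i := by
  have h0 : (0 : ℝ) ∈ Ico (0 : ℝ) 1 := ⟨le_rfl, one_pos⟩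
  have e : (X : ℝ) / 2 ^ r = (X + 0) / 2 ^ r := by rw [add_zero]
  rw [Fin.ext_iff, Fin.val_add, e]
  rcases lt_or_ge i r with hi | hi
  · rw [val_digits_of_lt h0 hi, val_digits_of_lt hf hi, val_digits_of_lt hf hi, natDigit_xor]
  · rw [val_digits_of_le h0 hi, val_digits_of_le hf hi, val_digits_of_le hf hi]
    simp

/-- Adding a dyadic point only xors the leading `r` digits and keeps the tail `f`. The summed digit
sequence is therefore again the canonical expansion of a number in `[0,1)`, which fails for
digitwise sums in general. -/
lemma digitalAdd_eq {X C r : ℕ} {f : ℝ} (hf : f ∈ Ico (0 : ℝ) 1) (hX : X < 2 ^ r) (hC : C < 2 ^ r) :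
    digitalAdd ((X : ℝ) / 2 ^ r) ((C + f) / 2 ^ r) = ((X ^^^ C : ℕ) + f) / 2 ^ r := by
  unfold digitalAdd
  simp only [digits_add_eq hf]
  exact Real.ofDigits_digits one_lt_two (add_fract_div_mem_Ico hf (Nat.xor_lt_two_pow hX hC))

/-- The points `X / 2 ^ r` with `X < 2 ^ r`. -/
def IsDyadic (r : ℕ) (x : ℝ) : Prop := ∃ X : ℕ, X < 2 ^ r ∧ x = (X : ℝ) / 2 ^ r

lemma IsDyadic.digitalAdd_mem {r : ℕ} {x : ℝ} (hx : IsDyadic r x) {σ : ℝ} (hσ : σ ∈ Ico (0 : ℝ) 1) :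
    digitalAdd x σ ∈ Ico (0 : ℝ) 1 := by
  obtain ⟨X, hX, rfl⟩ := hx
  obtain ⟨C, hC, f, hf, rfl⟩ := exists_eq_add_fract_div r hσ
  rw [digitalAdd_eq hf hX hC]
  exact add_fract_div_mem_Ico hf (Nat.xor_lt_two_pow hX hC)

lemma IsDyadic.digits_digitalAdd {r : ℕ} {x : ℝ} (hx : IsDyadic r x) {σ : ℝ}
    (hσ : σ ∈ Ico (0 : ℝ) 1) (i : ℕ) :
    Real.digits (digitalAdd x σ) 2 i = Real.digits x 2 i + Real.digits σ 2 i := by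
  obtain ⟨X, hX, rfl⟩ := hx
  obtain ⟨C, hC, f, hf, rfl⟩ := exists_eq_add_fract_div r hσ
  rw [digitalAdd_eq hf hX hC, digits_add_eq hf]

/-! ### Measure preserving maps of the unit interval -/

lemma measurable_digits : Measurable fun (σ : ℝ) (i : ℕ) => Real.digits σ 2 i := by
  refine measurable_pi_lambda _ fun i => ?_
  have : Measurable fun n : ℕ => Fin.ofNat 2 n := measurable_of_countable _
  exact this.comp (Nat.measurable_floor.comp (measurable_id.mul_const _))

lemma measurable_digitalAdd (x : ℝ) : Measurable (digitalAdd x) := by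
  unfold digitalAdd
  refine Real.continuous_ofDigits.measurable.comp (measurable_pi_lambda _ fun i => ?_)
  have : Measurable fun d : Fin 2 => Real.digits x 2 i + d := measurable_of_countable _
  exact this.comp ((measurable_pi_apply i).comp measurable_digits)

@[fun_prop]
lemma continuous_tent : Continuous tent := by
  unfold tent
  fun_prop

/-- The dyadic interval `[C / 2^r, (C + 1) / 2^r)`. -/
def dyadicCell (r C : ℕ) : Set ℝ := Ico ((C : ℝ) / 2 ^ r) ((C + 1) / 2 ^ r)

lemma mem_dyadicCell_iff {r C : ℕ} {σ : ℝ} :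
    σ ∈ dyadicCell r C ↔ ∃ f ∈ Ico (0 : ℝ) 1, σ = ((C : ℝ) + f) / 2 ^ r := by
  have h2 : (0 : ℝ) < 2 ^ r := by positivity
  constructor
  · rintro ⟨h1, h3⟩
    rw [div_le_iff₀ h2] at h1
    rw [lt_div_iff₀ h2] at h3
    exact ⟨σ * 2 ^ r - C, ⟨by linarith, by linarith⟩, by field_simp; ring⟩
  · rintro ⟨f, hf, rfl⟩
    constructor
    · gcongr
      linarith [hf.1]
    · gcongr
      exact hf.2

lemma pairwiseDisjoint_dyadicCell (r : ℕ) (S : Set ℕ) : S.PairwiseDisjoint (dyadicCell r) := by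
  intro C _ D _ hne
  refine Set.disjoint_left.2 fun σ h1 h2 => hne ?_
  obtain ⟨f, hf, rfl⟩ := mem_dyadicCell_iff.1 h1
  obtain ⟨g, hg, h⟩ := mem_dyadicCell_iff.1 h2
  have h' : (C : ℝ) + f = D + g := by
    have : (0 : ℝ) < 2 ^ r := by positivity
    field_simp at h
    exact h
  have e1 : ⌊f + (C : ℝ)⌋₊ = C := by
    rw [Nat.floor_add_natCast hf.1, Nat.floor_eq_zero.2 hf.2, zero_add]
  have e2 : ⌊g + (D : ℝ)⌋₊ = D := by
    rw [Nat.floor_add_natCast hg.1, Nat.floor_eq_zero.2 hg.2, zero_add]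
  rw [← e1, add_comm, h', add_comm, e2]

lemma Ico_eq_biUnion_dyadicCell (r : ℕ) :
    Ico (0 : ℝ) 1 = ⋃ C ∈ Finset.range (2 ^ r), dyadicCell r C := by
  ext σ
  simp only [Finset.mem_range, mem_iUnion, mem_dyadicCell_iff, exists_prop]
  constructor
  · exact exists_eq_add_fract_div r
  · rintro ⟨C, hC, f, hf, rfl⟩
    exact add_fract_div_mem_Ico hf hC

lemma volume_inter_Ico_eq_sum (r : ℕ) {A : Set ℝ} (hA : MeasurableSet A) :
    volume (A ∩ Ico 0 1) = ∑ C ∈ Finset.range (2 ^ r), volume (A ∩ dyadicCell r C) := by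
  rw [Ico_eq_biUnion_dyadicCell r, inter_iUnion₂, measure_biUnion_finset]
  · exact (pairwiseDisjoint_dyadicCell r _).mono_on fun C _ => inter_subset_right
  · exact fun C _ => hA.inter measurableSet_Ico

/-- The shift permutes the dyadic cells of length `2 ^ (-r)` by the involution `C ↦ X ^^^ C` and
acts on each as a translation. -/
lemma IsDyadic.measurePreserving_digitalAdd {r : ℕ} {x : ℝ} (hx : IsDyadic r x) :
    MeasurePreserving (digitalAdd x) (volume.restrict (Ico (0 : ℝ) 1))
      (volume.restrict (Ico (0 : ℝ) 1)) := by
  refine ⟨measurable_digitalAdd x, Measure.ext fun A hA => ?_⟩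
  have hA' := measurable_digitalAdd x hA
  rw [Measure.map_apply (measurable_digitalAdd x) hA, Measure.restrict_apply hA,
    Measure.restrict_apply hA', volume_inter_Ico_eq_sum r hA, volume_inter_Ico_eq_sum r hA']
  obtain ⟨X, hX, rfl⟩ := hx
  refine Finset.sum_nbij' (fun C => X ^^^ C) (fun C => X ^^^ C) ?_ ?_ ?_ ?_ ?_
  · exact fun C hC => Finset.mem_range.2 (Nat.xor_lt_two_pow hX (Finset.mem_range.1 hC))
  · exact fun C hC => Finset.mem_range.2 (Nat.xor_lt_two_pow hX (Finset.mem_range.1 hC))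
  · exact fun C _ => by simp
  · exact fun C _ => by simp
  · intro C hC
    rw [Finset.mem_range] at hC
    have e : digitalAdd ((X : ℝ) / 2 ^ r) ⁻¹' A ∩ dyadicCell r C =
        (fun σ => σ + (((X ^^^ C : ℕ) : ℝ) - C) / 2 ^ r) ⁻¹' (A ∩ dyadicCell r (X ^^^ C)) := by
      have hsh : ∀ f : ℝ, ((C : ℝ) + f) / 2 ^ r + (((X ^^^ C : ℕ) : ℝ) - C) / 2 ^ r =
          (((X ^^^ C : ℕ) : ℝ) + f) / 2 ^ r := fun f => by ring
      ext σ
      simp only [mem_inter_iff, mem_preimage]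
      constructor
      · rintro ⟨h1, h2⟩
        obtain ⟨f, hf, rfl⟩ := mem_dyadicCell_iff.1 h2
        rw [digitalAdd_eq hf hX hC] at h1
        rw [hsh]
        exact ⟨h1, mem_dyadicCell_iff.2 ⟨f, hf, rfl⟩⟩
      · rintro ⟨h1, h2⟩
        obtain ⟨f, hf, h⟩ := mem_dyadicCell_iff.1 h2
        have hσ : σ = ((C : ℝ) + f) / 2 ^ r := by
          have := hsh f
          linarith
        subst hσ
        rw [digitalAdd_eq hf hX hC]
        rw [hsh] at h1
        exact ⟨h1, mem_dyadicCell_iff.2 ⟨f, hf, rfl⟩⟩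
    rw [e, measure_preimage_add_right]

/-- Two affine branches of slopes `2` and `-2`: each half of the interval is stretched onto the
whole interval up to an end point and contributes half of the measure. -/
lemma measurePreserving_tent :
    MeasurePreserving tent (volume.restrict (Ico (0 : ℝ) 1)) (volume.restrict (Ico (0 : ℝ) 1)) := by
  refine ⟨continuous_tent.measurable, Measure.ext fun A hA => ?_⟩
  have hA' := continuous_tent.measurable hA
  rw [Measure.map_apply continuous_tent.measurable hA, Measure.restrict_apply hA,
    Measure.restrict_apply hA']
  have e0 : tent ⁻¹' A ∩ Ico 0 1 = (tent ⁻¹' A ∩ Ico 0 (1 / 2)) ∪ (tent ⁻¹' A ∩ Ico (1 / 2) 1) := by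
    rw [← inter_union_distrib_left, Ico_union_Ico_eq_Ico (by norm_num) (by norm_num)]
  have e1 : tent ⁻¹' A ∩ Ico 0 (1 / 2) = (fun x => 2 * x) ⁻¹' (A ∩ Ico 0 1) := by
    ext x
    simp only [mem_inter_iff, mem_preimage, mem_Ico]
    have h : x < 1 / 2 → tent x = 2 * x := fun h => by
      rw [tent, abs_of_neg (by linarith)]
      ring
    constructor
    · rintro ⟨h1, h2, h3⟩
      rw [h h3] at h1
      exact ⟨h1, by linarith, by linarith⟩
    · rintro ⟨h1, h2, h3⟩
      have h4 : x < 1 / 2 := by linarith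
      rw [h h4]
      exact ⟨h1, by linarith, h4⟩
  have e2 : tent ⁻¹' A ∩ Ico (1 / 2) 1 =
      (fun x => (-2) * x) ⁻¹' ((fun x => x + 2) ⁻¹' (A ∩ Ioc 0 1)) := by
    ext x
    simp only [mem_inter_iff, mem_preimage, mem_Ico, mem_Ioc]
    have h : 1 / 2 ≤ x → tent x = -2 * x + 2 := fun h => by
      rw [tent, abs_of_nonneg (by linarith)]
      ring
    constructor
    · rintro ⟨h1, h2, h3⟩
      rw [h h2] at h1
      exact ⟨h1, by linarith, by linarith⟩
    · rintro ⟨h1, h2, h3⟩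
      have h4 : 1 / 2 ≤ x := by linarith
      rw [h h4]
      exact ⟨h1, h4, by linarith⟩
  have e3 : volume (A ∩ Ioc (0 : ℝ) 1) = volume (A ∩ Ico (0 : ℝ) 1) :=
    measure_congr ((ae_eq_refl A).inter Ico_ae_eq_Ioc.symm)
  have hd : Disjoint (tent ⁻¹' A ∩ Ico 0 (1 / 2)) (tent ⁻¹' A ∩ Ico (1 / 2) 1) :=
    Disjoint.mono inter_subset_right inter_subset_right
      (Ico_disjoint_Ico_same (a := (0 : ℝ)) (b := 1 / 2) (c := 1))
  rw [e0, measure_union hd (hA'.inter measurableSet_Ico), e1, e2,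
    Real.volume_preimage_mul_left two_ne_zero, Real.volume_preimage_mul_left (by norm_num),
    measure_preimage_add_right, e3, ← add_mul, ← ENNReal.ofReal_add (by positivity) (by positivity)]
  rw [show |(2 : ℝ)⁻¹| + |(-2 : ℝ)⁻¹| = 1 by rw [abs_of_pos, abs_of_neg] <;> norm_num]
  simp

/-! ### Rademacher functions -/

/-- The Rademacher functions `(-1)^{ξ_{i+1}}`. -/
def rad (i : ℕ) (x : ℝ) : ℝ := (-1) ^ (Real.digits x 2 i : ℕ)

lemma rad_eq (i : ℕ) (x : ℝ) : rad i x = (-1) ^ ⌊x * 2 ^ (i + 1)⌋₊ := by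
  rw [rad, val_digits, ← neg_one_pow_eq_pow_mod_two]

lemma rad_mul_self (i : ℕ) (x : ℝ) : rad i x * rad i x = 1 := by
  rw [rad, ← mul_pow]
  simp

lemma abs_rad (i : ℕ) (x : ℝ) : |rad i x| = 1 := by simp [rad]

lemma measurable_rad (i : ℕ) : Measurable (rad i) := by
  have : Measurable fun d : Fin 2 => ((-1 : ℝ)) ^ (d : ℕ) := measurable_of_countable _
  exact this.comp ((measurable_pi_apply i).comp measurable_digits)

lemma IsDyadic.rad_digitalAdd {r : ℕ} {x : ℝ} (hx : IsDyadic r x) {σ : ℝ}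
    (hσ : σ ∈ Ico (0 : ℝ) 1) (i : ℕ) : rad i (digitalAdd x σ) = rad i x * rad i σ := by
  rw [rad, hx.digits_digitalAdd hσ, rad, rad, Fin.val_add, ← neg_one_pow_eq_pow_mod_two, pow_add]

/-- The Rademacher functions after the tent transformation. -/
def foldRad (i : ℕ) (x : ℝ) : ℝ := rad 0 x * rad (i + 1) x

/-- Points that are not dyadic rationals. -/
def IsNonDyadic (w : ℝ) : Prop := ∀ n k : ℕ, w * 2 ^ n ≠ k

lemma ae_isNonDyadic : ∀ᵐ w : ℝ, IsNonDyadic w := by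
  refine ae_all_iff.2 fun n => ae_all_iff.2 fun k => ?_
  have : {w : ℝ | ¬ (w * 2 ^ n ≠ k)} ⊆ {(k : ℝ) / 2 ^ n} := by
    intro w hw
    simp only [ne_eq, not_not, Set.mem_ofPred_eq] at hw
    rw [mem_singleton_iff, ← hw]
    field_simp
  exact measure_mono_null this (by simp)

lemma tent_mem_Icc {w : ℝ} (hw : w ∈ Icc (0 : ℝ) 1) : tent w ∈ Icc (0 : ℝ) 1 := by
  unfold tent
  have h1 : |2 * w - 1| ≤ 1 := abs_le.2 ⟨by linarith [hw.1], by linarith [hw.2]⟩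
  exact ⟨by linarith, by linarith [abs_nonneg (2 * w - 1)]⟩

/-- On the left half the tent map deletes a leading digit `0`. On the right half it deletes a
leading digit `1` and complements all remaining digits. In both cases the new sign is the shifted
one times the sign of the deleted digit. -/
lemma rad_tent {w : ℝ} (hw : w ∈ Ico (0 : ℝ) 1) (hn : IsNonDyadic w) (i : ℕ) :
    tent w ∈ Ico (0 : ℝ) 1 ∧ rad i (tent w) = foldRad i w := by
  have hpow : (2 : ℝ) ^ (i + 1 + 1) = 2 * 2 ^ (i + 1) := by rw [pow_succ']
  simp only [foldRad, rad_eq, zero_add, pow_one]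
  rcases lt_or_ge w (1 / 2) with h | h
  · have ht : tent w = 2 * w := by
      rw [tent, abs_of_neg (by linarith)]
      ring
    have h0 : ⌊w * 2⌋₊ = 0 := Nat.floor_eq_zero.2 (by linarith)
    rw [ht, h0, pow_zero, one_mul, hpow]
    exact ⟨⟨by linarith [hw.1], by linarith⟩, by ring_nf⟩
  · have ht : tent w = 2 - 2 * w := by
      rw [tent, abs_of_nonneg (by linarith)]
      ring
    have h1 : ⌊w * 2⌋₊ = 1 := by
      rw [Nat.floor_eq_iff (by linarith)]
      constructor <;> push_cast <;> linarith [hw.2]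
    have hne : w ≠ 1 / 2 := fun he => hn 1 1 (by rw [he]; norm_num)
    have h' : 1 / 2 < w := lt_of_le_of_ne h hne.symm
    refine ⟨by rw [ht]; exact ⟨by linarith [hw.2], by linarith⟩, ?_⟩
    rw [h1, ht]
    set N := ⌊w * 2 ^ (i + 1 + 1)⌋₊ with hN
    have hw0 : 0 ≤ w * 2 ^ (i + 1 + 1) := mul_nonneg hw.1 (by positivity)
    have hle := lt_of_le_of_ne (Nat.floor_le hw0) (hn (i + 1 + 1) _).symm
    have hlt := Nat.lt_floor_add_one (w * 2 ^ (i + 1 + 1))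
    rw [← hN] at hle hlt
    have hNlt : N < 2 ^ (i + 1 + 1) := by
      have : (N : ℝ) < 2 ^ (i + 1 + 1) := by
        nlinarith [hw.2, show (0 : ℝ) < 2 ^ (i + 1 + 1) by positivity]
      exact_mod_cast this
    -- The floor of an integer minus `y` is that integer minus `1` minus `⌊y⌋` only for non-integral
    -- `y`; this is the use of `w` not being dyadic.
    have hfl : ⌊(2 - 2 * w) * 2 ^ (i + 1)⌋₊ = 2 ^ (i + 1 + 1) - 1 - N := by
      rw [Nat.floor_eq_iff (mul_nonneg (by linarith [hw.2]) (by positivity)), Nat.sub_sub,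
        Nat.cast_sub (by omega)]
      have e : (2 - 2 * w) * 2 ^ (i + 1) = 2 ^ (i + 1 + 1) - w * 2 ^ (i + 1 + 1) := by
        rw [hpow]
        ring
      rw [e]
      push_cast
      constructor <;> linarith
    rw [hfl, ← pow_add]
    have heven : Even (2 ^ (i + 1 + 1)) := ⟨2 ^ (i + 1), by rw [pow_succ]; ring⟩
    have hsum : (2 ^ (i + 1 + 1) - 1 - N) + (1 + N) = 2 ^ (i + 1 + 1) := by omega
    have hone : ((-1 : ℝ)) ^ ((2 ^ (i + 1 + 1) - 1 - N) + (1 + N)) = 1 := by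
      rw [hsum, heven.neg_one_pow]
    rw [pow_add] at hone
    have hsq : ((-1 : ℝ)) ^ (1 + N) * (-1) ^ (1 + N) = 1 := by
      rw [← mul_pow]
      simp
    linear_combination ((-1 : ℝ) ^ (1 + N)) * hone - (-1) ^ (2 ^ (i + 1 + 1) - 1 - N) * hsq

/-! ### Walsh functions as products of Rademacher functions -/

lemma walsh_eq_prod {k R : ℕ} (hk : k < 2 ^ R) (x : ℝ) :
    walsh k x = ∏ i ∈ Finset.range R, rad i x ^ natDigit k i := by
  rw [walsh, ← Finset.prod_pow_eq_pow_sum]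
  rw [← Finset.prod_subset (Finset.range_subset_range.2 (Nat.size_le.2 hk))]
  · exact Finset.prod_congr rfl fun i _ => by rw [rad, ← pow_mul, mul_comm]
  · intro i _ hi
    have h : k < 2 ^ i := Nat.size_le.1 (not_lt.1 fun h => hi (Finset.mem_range.2 h))
    simp [natDigit, Nat.div_eq_of_lt h]

lemma natDigit_two_pow_add {R i : ℕ} (k : ℕ) (hi : i < R) :
    natDigit (2 ^ R + k) i = natDigit k i := by
  rw [natDigit_eq_toNat, natDigit_eq_toNat, Nat.testBit_two_pow_add_gt hi]

lemma natDigit_two_pow_add_self {R k : ℕ} (hk : k < 2 ^ R) : natDigit (2 ^ R + k) R = 1 := by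
  rw [natDigit_eq_toNat, Nat.testBit_two_pow_add_eq, Nat.testBit_lt_two_pow hk]
  rfl

lemma natDigit_eq_zero {R k : ℕ} (hk : k < 2 ^ R) : natDigit k R = 0 := by
  simp [natDigit, Nat.div_eq_of_lt hk]

/-- Expanding the product chooses `1` or `e i` for each `i`, and the choices are the binary
expansions of the numbers below `2 ^ R`. The Dirichlet kernel and the character sum over the lattice
both come from this. -/
lemma sum_prod_pow_natDigit (R : ℕ) (e : ℕ → ℝ) :
    ∑ k ∈ Finset.range (2 ^ R), ∏ i ∈ Finset.range R, e i ^ natDigit k i =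
      ∏ i ∈ Finset.range R, (1 + e i) := by
  induction R with
  | zero => simp
  | succ R ih =>
    rw [pow_succ, mul_two, Finset.sum_range_add, Finset.prod_range_succ, ← ih, mul_add, mul_one,
      Finset.sum_mul]
    congr 1
    · refine Finset.sum_congr rfl fun k hk => ?_
      rw [Finset.prod_range_succ, natDigit_eq_zero (Finset.mem_range.1 hk), pow_zero, mul_one]
    · refine Finset.sum_congr rfl fun k hk => ?_
      rw [Finset.mem_range] at hk
      rw [Finset.prod_range_succ, natDigit_two_pow_add_self hk, pow_one]
      congr 1
      exact Finset.prod_congr rfl fun i hi =>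
        by rw [natDigit_two_pow_add k (Finset.mem_range.1 hi)]

/-- The element of `evenDigitSum₀` whose half is `l`. -/
def evenLift (l : ℕ) : ℕ := 2 * l + digitSum l % 2

lemma natDigit_succ (k i : ℕ) : natDigit k (i + 1) = natDigit (k / 2) i := by
  rw [natDigit, natDigit, pow_succ', Nat.div_div_eq_div_mul]

lemma digitSum_eq_sum {R k : ℕ} (hk : k < 2 ^ R) :
    digitSum k = ∑ i ∈ Finset.range R, natDigit k i := by
  induction R generalizing k with
  | zero =>
    have : k = 0 := by simpa using hk
    simp [this, digitSum]
  | succ R ih =>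
    rw [Finset.sum_range_succ']
    simp only [natDigit_succ]
    rw [← ih (by rw [pow_succ] at hk; omega)]
    rcases Nat.eq_zero_or_pos k with rfl | hpos
    · simp [digitSum, natDigit]
    · rw [digitSum, Nat.digits_def' one_lt_two hpos, List.sum_cons, digitSum, natDigit]
      simp [add_comm]

lemma evenLift_div_two (l : ℕ) : evenLift l / 2 = l := by
  unfold evenLift
  omega

lemma digitSum_evenLift (l : ℕ) : digitSum (evenLift l) = digitSum l % 2 + digitSum l := by
  rcases Nat.eq_zero_or_pos (evenLift l) with h | h
  · have : l = 0 := by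
      unfold evenLift at h
      omega
    simp [this, evenLift, digitSum]
  · rw [digitSum, Nat.digits_def' one_lt_two h, List.sum_cons, evenLift_div_two]
    unfold evenLift
    rw [← digitSum]
    omega

lemma evenLift_mem (l : ℕ) : evenLift l ∈ evenDigitSum₀ := by
  rcases Nat.eq_zero_or_pos (evenLift l) with h | h
  · exact Or.inr h
  · refine Or.inl ⟨h, ?_⟩
    rw [Nat.ModEq, digitSum_evenLift]
    omega

/-- In a number of even digit sum the lowest bit is forced by the others; so halving is a bijection
from `evenDigitSum₀` onto the naturals with inverse `evenLift`. -/
lemma evenLift_of_mem {k : ℕ} (hk : k ∈ evenDigitSum₀) : evenLift (k / 2) = k := by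
  rcases hk with ⟨h, h2⟩ | h
  · rw [Nat.ModEq, digitSum, Nat.digits_def' one_lt_two h, List.sum_cons, ← digitSum] at h2
    unfold evenLift
    omega
  · rw [mem_singleton_iff.1 h]
    simp [evenLift, digitSum]

/-- Each digit `1` of `l` contributes one factor `rad 0`; only the parity of their number matters,
and that parity is the lowest bit of `evenLift l`. -/
lemma walsh_evenLift {l R : ℕ} (hl : l < 2 ^ R) (x : ℝ) :
    walsh (evenLift l) x = ∏ i ∈ Finset.range R, foldRad i x ^ natDigit l i := by
  have h2 : evenLift l < 2 ^ (R + 1) := by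
    unfold evenLift
    rw [pow_succ]
    omega
  rw [walsh_eq_prod h2, Finset.prod_range_succ']
  simp only [natDigit_succ, evenLift_div_two, foldRad, mul_pow]
  rw [Finset.prod_mul_distrib, Finset.prod_pow_eq_pow_sum, ← digitSum_eq_sum hl, mul_comm]
  congr 1
  have : natDigit (evenLift l) 0 = digitSum l % 2 := by
    simp only [natDigit, evenLift]
    omega
  rw [this]
  rcases Nat.even_or_odd (digitSum l) with ⟨n, hn⟩ | ⟨n, hn⟩
  · rw [hn, ← two_mul, Nat.mul_mod_right, pow_zero, pow_mul, sq, rad_mul_self, one_pow]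
  · rw [hn, Nat.mul_add_mod, pow_add, pow_mul, sq, rad_mul_self, one_pow, one_mul]
    rfl

lemma abs_walsh (k : ℕ) (x : ℝ) : |walsh k x| = 1 := by simp [walsh]

lemma measurable_walsh (k : ℕ) : Measurable (walsh k) := by
  have : walsh k = fun x => ∏ i ∈ Finset.range k.size, rad i x ^ natDigit k i :=
    funext fun x => walsh_eq_prod (Nat.lt_size_self k) x
  rw [this]
  exact Finset.measurable_prod _ fun i _ => (measurable_rad i).pow_const _

/-! ### The Walsh–Dirichlet kernel -/

/-- The Walsh–Dirichlet kernel of order `2 ^ R`. -/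
def walshDirichlet (R : ℕ) (b b₀ : ℝ) : ℝ := ∏ i ∈ Finset.range R, (1 + rad i b * rad i b₀)

/-- A factor is `2` if the two digits agree and `0` otherwise, so the product detects a common
dyadic cell of length `2 ^ (-R)`. -/
lemma walshDirichlet_eq (R : ℕ) {b b₀ : ℝ} (hb : b ∈ Ico (0 : ℝ) 1) (hb₀ : b₀ ∈ Ico (0 : ℝ) 1) :
    walshDirichlet R b b₀ = if ⌊b * 2 ^ R⌋₊ = ⌊b₀ * 2 ^ R⌋₊ then 2 ^ R else 0 := by
  induction R with
  | zero => simp [walshDirichlet, Nat.floor_eq_zero.2 hb.2, Nat.floor_eq_zero.2 hb₀.2]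
  | succ R ih =>
    have hdiv : ∀ b : ℝ, ⌊b * 2 ^ R⌋₊ = ⌊b * 2 ^ (R + 1)⌋₊ / 2 := by
      intro b
      rw [← Nat.floor_div_natCast]
      congr 1
      rw [pow_succ]
      push_cast
      ring
    rw [walshDirichlet, Finset.prod_range_succ, ← walshDirichlet, ih, hdiv, hdiv b₀, rad_eq, rad_eq,
      ← pow_add]
    generalize ⌊b * 2 ^ (R + 1)⌋₊ = n
    generalize ⌊b₀ * 2 ^ (R + 1)⌋₊ = n₀
    by_cases h : n / 2 = n₀ / 2
    · rw [if_pos h]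
      by_cases h' : n = n₀
      · rw [if_pos h', h', ← two_mul, pow_mul]
        norm_num
        ring
      · have hodd : Odd (n + n₀) := by
          rw [Nat.odd_iff]
          omega
        rw [if_neg h', hodd.neg_one_pow]
        ring
    · rw [if_neg h, if_neg (fun h' => h (by rw [h'])), zero_mul]

lemma walshDirichlet_nonneg (R : ℕ) {b b₀ : ℝ} (hb : b ∈ Ico (0 : ℝ) 1)
    (hb₀ : b₀ ∈ Ico (0 : ℝ) 1) : 0 ≤ walshDirichlet R b b₀ := by
  rw [walshDirichlet_eq R hb hb₀]
  split_ifs <;> positivity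

lemma abs_sub_le_of_walshDirichlet_ne_zero {R : ℕ} {b b₀ : ℝ} (hb : b ∈ Ico (0 : ℝ) 1)
    (hb₀ : b₀ ∈ Ico (0 : ℝ) 1) (h : walshDirichlet R b b₀ ≠ 0) : |b - b₀| ≤ (1 / 2) ^ R := by
  rw [walshDirichlet_eq R hb hb₀] at h
  have h' : ⌊b * 2 ^ R⌋₊ = ⌊b₀ * 2 ^ R⌋₊ := by
    by_contra hne
    exact h (if_neg hne)
  have p : (0 : ℝ) < 2 ^ R := by positivity
  have h1 := Nat.floor_le (mul_nonneg hb.1 p.le)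
  have h2 := Nat.lt_floor_add_one (b * 2 ^ R)
  have h3 := Nat.floor_le (mul_nonneg hb₀.1 p.le)
  have h4 := Nat.lt_floor_add_one (b₀ * 2 ^ R)
  rw [h'] at h1 h2
  rw [one_div, inv_pow, ← one_div, le_div_iff₀ p, ← abs_of_pos p, ← abs_mul, abs_le]
  constructor <;> nlinarith

lemma integral_walshDirichlet (R : ℕ) {b₀ : ℝ} (hb₀ : b₀ ∈ Ico (0 : ℝ) 1) :
    ∫ b in Ico (0 : ℝ) 1, walshDirichlet R b b₀ = 1 := by
  have p : (0 : ℝ) < 2 ^ R := by positivity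
  obtain ⟨C, hC, f, hf, hbC⟩ := exists_eq_add_fract_div R hb₀
  have hfl : ∀ {g : ℝ}, g ∈ Ico (0 : ℝ) 1 → ∀ D : ℕ, ⌊((D : ℝ) + g) / 2 ^ R * 2 ^ R⌋₊ = D := by
    intro g hg D
    rw [div_mul_cancel₀ _ p.ne', add_comm, Nat.floor_add_natCast hg.1, Nat.floor_eq_zero.2 hg.2,
      zero_add]
  have e : ∫ b in Ico (0 : ℝ) 1, walshDirichlet R b b₀ =
      ∫ b in Ico (0 : ℝ) 1, (dyadicCell R C).indicator (fun _ => (2 : ℝ) ^ R) b := by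
    refine setIntegral_congr_fun measurableSet_Ico fun b hb => ?_
    rw [walshDirichlet_eq R hb hb₀, hbC, hfl hf]
    obtain ⟨D, hD, g, hg, rfl⟩ := exists_eq_add_fract_div R hb
    rw [hfl hg]
    by_cases h : D = C
    · rw [if_pos h, indicator_of_mem (mem_dyadicCell_iff.2 ⟨g, hg, by rw [h]⟩)]
    · rw [if_neg h, indicator_of_notMem]
      intro hmem
      obtain ⟨g', hg', h'⟩ := mem_dyadicCell_iff.1 hmem
      exact h (by rw [← hfl hg D, h', hfl hg'])
  have hsub : dyadicCell R C ⊆ Ico 0 1 := by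
    intro b hb
    obtain ⟨g, hg, rfl⟩ := mem_dyadicCell_iff.1 hb
    exact add_fract_div_mem_Ico hg hC
  rw [e, setIntegral_indicator (show MeasurableSet (dyadicCell R C) from measurableSet_Ico),
    inter_eq_right.2 hsub, setIntegral_const, dyadicCell, Real.volume_real_Ico_of_le (by gcongr; linarith)]
  rw [smul_eq_mul]
  field_simp
  ring

lemma measurable_walshDirichlet (R : ℕ) (b₀ : ℝ) : Measurable fun b => walshDirichlet R b b₀ :=
  Finset.measurable_prod _ fun i _ => measurable_const.add ((measurable_rad i).mul_const _)

end
end FoldedLattice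

/-! ### Nonnegative Walsh coefficients and the shift average of the kernel. -/

namespace FoldedLattice
noncomputable section
open MeasureTheory Set Polynomial
open scoped ContDiff

variable {s : ℕ}

/-! ### Nonnegativity of the diagonal Walsh coefficients -/

/-- Kernels with nonnegative double integral, together with the integrability needed to
take finite sums. -/
def IsNonnegKernel {X : Type*} [MeasurableSpace X] (μ : Measure X) (F : X → X → ℝ) : Prop :=
  (∀ᵐ x ∂μ, Integrable (F x) μ) ∧ Integrable (fun x => ∫ z, F x z ∂μ) μ ∧
    0 ≤ ∫ x, ∫ z, F x z ∂μ ∂μ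

lemma IsNonnegKernel.sum {X ι : Type*} [MeasurableSpace X] {μ : Measure X} {S : Finset ι}
    {F : ι → X → X → ℝ} (h : ∀ i ∈ S, IsNonnegKernel μ (F i)) :
    IsNonnegKernel μ fun x z => ∑ i ∈ S, F i x z := by
  have hint : ∀ᵐ x ∂μ, ∀ i ∈ S, Integrable (F i x) μ := by
    rw [Finset.eventually_all]
    exact fun i hi => (h i hi).1
  have e : ∀ᵐ x ∂μ, ∫ z, ∑ i ∈ S, F i x z ∂μ = ∑ i ∈ S, ∫ z, F i x z ∂μ := by
    filter_upwards [hint] with x hx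
    exact integral_finsetSum _ hx
  refine ⟨?_, ?_, ?_⟩
  · filter_upwards [hint] with x hx
    exact integrable_finsetSum _ hx
  · exact (integrable_finsetSum S fun i hi => (h i hi).2.1).congr
      (Filter.EventuallyEq.symm (by simpa only [Filter.EventuallyEq] using e))
  · rw [integral_congr_ae e, integral_finsetSum _ fun i hi => (h i hi).2.1]
    exact Finset.sum_nonneg fun i hi => (h i hi).2.2

lemma IsNonnegKernel.const_mul {X : Type*} [MeasurableSpace X] {μ : Measure X} {c : ℝ}
    (hc : 0 ≤ c) {F : X → X → ℝ} (h : IsNonnegKernel μ F) :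
    IsNonnegKernel μ fun x z => c * F x z := by
  refine ⟨?_, ?_, ?_⟩
  · filter_upwards [h.1] with x hx
    exact hx.const_mul c
  · simp only [integral_const_mul]
    exact h.2.1.const_mul c
  · simp only [integral_const_mul]
    exact mul_nonneg hc h.2.2

/-- After Fubini the double integral becomes `∫ (∫ A x y dx)² dy`. Boundedness on sets of full
measure supplies the integrability. -/
lemma isNonnegKernel_integral_mul {X Y : Type*} [MeasurableSpace X] [MeasurableSpace Y]
    {μ : Measure X} {ν : Measure Y} [IsProbabilityMeasure μ] [IsProbabilityMeasure ν]
    {S : Set X} {T : Set Y} (hS : ∀ᵐ x ∂μ, x ∈ S) (hT : ∀ᵐ y ∂ν, y ∈ T) {A : X → Y → ℝ}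
    (hA : Measurable fun z : X × Y => A z.1 z.2) {M : ℝ} (hM : ∀ x ∈ S, ∀ y ∈ T, |A x y| ≤ M) :
    IsNonnegKernel μ fun x z => ∫ y, A z y * A x y ∂ν := by
  have hST : ∀ᵐ z ∂μ.prod ν, z.1 ∈ S ∧ z.2 ∈ T :=
    (Measure.quasiMeasurePreserving_fst.ae hS).and (Measure.quasiMeasurePreserving_snd.ae hT)
  have hbd : ∀ᵐ z ∂μ.prod ν, ‖A z.1 z.2‖ ≤ M := by
    filter_upwards [hST] with z hz
    exact hM _ hz.1 _ hz.2
  have hAint : Integrable (fun z : X × Y => A z.1 z.2) (μ.prod ν) :=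
    Integrable.of_bound hA.aestronglyMeasurable M hbd
  have hAx : ∀ x, Measurable (A x) := fun x => hA.comp measurable_prodMk_left
  set g : Y → ℝ := fun y => ∫ x, A x y ∂μ with hg
  have hgm : StronglyMeasurable g :=
    StronglyMeasurable.integral_prod_left (f := A) hA.stronglyMeasurable
  have hgb : ∀ᵐ y ∂ν, ‖g y‖ ≤ M := by
    filter_upwards [hT] with y hy
    refine (norm_integral_le_of_norm_le_const (C := M) ?_).trans (by simp)
    filter_upwards [hS] with x hx
    exact hM x hx y hy
  have hprod : ∀ x ∈ S, Integrable (fun z : X × Y => A z.1 z.2 * A x z.2) (μ.prod ν) := by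
    intro x hx
    refine hAint.mul_bdd (c := M) ((hAx x).comp measurable_snd).aestronglyMeasurable ?_
    filter_upwards [hST] with z hz
    exact hM x hx _ hz.2
  have hinner : ∀ x ∈ S, ∫ z, ∫ y, A z y * A x y ∂ν ∂μ = ∫ y, A x y * g y ∂ν := by
    intro x hx
    rw [integral_integral_swap (hprod x hx)]
    refine integral_congr_ae (Filter.Eventually.of_forall fun y => ?_)
    simp only [hg]
    rw [integral_mul_const, mul_comm]
  have hag : Integrable (fun z : X × Y => A z.1 z.2 * g z.2) (μ.prod ν) :=
    hAint.mul_bdd (c := M) (hgm.comp_measurable measurable_snd).aestronglyMeasurable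
      (Measure.quasiMeasurePreserving_snd.ae hgb)
  have hae : (fun x => ∫ z, ∫ y, A z y * A x y ∂ν ∂μ) =ᵐ[μ] fun x => ∫ y, A x y * g y ∂ν := by
    filter_upwards [hS] with x hx
    exact hinner x hx
  refine ⟨?_, ?_, ?_⟩
  · filter_upwards [hS] with x hx
    exact (hprod x hx).integral_prod_left
  · exact hag.integral_prod_left.congr hae.symm
  · rw [integral_congr_ae hae, integral_integral_swap hag]
    refine integral_nonneg fun y => ?_
    simp only [integral_mul_const]
    exact mul_self_nonneg _

lemma abs_walshMulti (k : Fin s → ℕ) (x : Fin s → ℝ) : |walshMulti k x| = 1 := by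
  simp [walshMulti, Finset.abs_prod, abs_walsh]

lemma measurable_walshMulti (k : Fin s → ℕ) : Measurable (walshMulti k) :=
  Finset.measurable_prod _ fun j _ => (measurable_walsh _).comp (measurable_pi_apply j)

lemma walshMulti_zero (x : Fin s → ℝ) : walshMulti 0 x = 1 := by simp [walshMulti, walsh]

/-- Multiplying the feature maps of the Gram form `kernel_eq_sum` by the Walsh function keeps the
Gram form, so the coefficient is a nonnegatively weighted sum of integrals of squares. -/
lemma kernelWalshCoeff_nonneg {α : ℕ} (hα : 2 ≤ α) {γ : Finset (Fin s) → ℝ} (hγ : ∀ u, 0 ≤ γ u)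
    (k : Fin s → ℕ) : 0 ≤ kernelWalshCoeff α γ k k := by
  have key : IsNonnegKernel (volume.restrict (cube (Fin s))) fun x z =>
      ∑ u : Finset (Fin s), ∑ v ∈ u.powerset, ∑ β ∈ multiIndices α u v,
        γ u * ∫ y in cube {j // j ∈ v}, (expandKernelOn α v β z y * walshMulti k z) *
          (expandKernelOn α v β x y * walshMulti k x) := by
    refine IsNonnegKernel.sum fun u _ => IsNonnegKernel.sum fun v _ => IsNonnegKernel.sum
      fun β _ => IsNonnegKernel.const_mul (hγ u) ?_
    obtain ⟨M, hM⟩ := ((isCompact_closedCube (Fin s)).prod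
      (isCompact_closedCube {j // j ∈ v})).exists_bound_of_continuousOn
      (continuous_expandKernelOn hα v β).continuousOn
    refine isNonnegKernel_integral_mul (A := fun x y => expandKernelOn α v β x y * walshMulti k x)
      (ae_mem_cube _) (ae_mem_cube _) ?_ (M := M) ?_
    · exact (continuous_expandKernelOn hα v β).measurable.mul
        ((measurable_walshMulti k).comp measurable_fst)
    · intro x hx y hy
      rw [abs_mul, abs_walshMulti, mul_one]
      exact hM (x, y) ⟨cube_subset_closedCube _ hx, cube_subset_closedCube _ hy⟩
  refine key.2.2.trans_eq ?_
  refine setIntegral_congr_fun (measurableSet_cube _) fun x hx =>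
    setIntegral_congr_fun (measurableSet_cube _) fun z hz => ?_
  dsimp only
  rw [kernel_eq_sum hα γ (cube_subset_closedCube _ hx) (cube_subset_closedCube _ hz), mul_assoc]
  simp only [Finset.sum_mul]
  refine Finset.sum_congr rfl fun u _ => Finset.sum_congr rfl fun v _ =>
    Finset.sum_congr rfl fun β _ => ?_
  rw [mul_assoc, ← integral_mul_const]
  congr 2
  ext y
  ring

lemma kernelWalshCoeff_zero {α : ℕ} (hα : 2 ≤ α) (γ : Finset (Fin s) → ℝ) :
    kernelWalshCoeff α γ 0 0 = γ ∅ := by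
  have : ∀ x ∈ cube (Fin s), ∫ y in cube (Fin s), kernel α γ x y = γ ∅ := by
    intro x hx
    rw [← integral_kernel hα γ (cube_subset_closedCube _ hx)]
    refine setIntegral_congr_fun (measurableSet_cube _) fun y _ => ?_
    simp only [kernel, kernel₁, abs_sub_comm, mul_comm]
  simp only [kernelWalshCoeff, walshMulti_zero, mul_one]
  rw [setIntegral_congr_fun (measurableSet_cube _) this]
  simp

/-! ### The shift-and-fold map -/

lemma restrict_cube_eq_pi (ι : Type) [Fintype ι] :
    (volume : Measure (ι → ℝ)).restrict (cube ι) =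
      Measure.pi fun _ : ι => (volume : Measure ℝ).restrict (Ico 0 1) := by
  rw [cube, volume_pi, Measure.restrict_pi_pi]

lemma measurePreserving_shiftFold {r : ℕ} {x : Fin s → ℝ} (hx : ∀ j, IsDyadic r (x j)) :
    MeasurePreserving (fun σ => shiftFold σ x) (volume.restrict (cube (Fin s)))
      (volume.restrict (cube (Fin s))) := by
  rw [restrict_cube_eq_pi]
  have : ∀ _ : Fin s, SigmaFinite ((volume : Measure ℝ).restrict (Ico 0 1)) :=
    fun _ => inferInstance
  exact measurePreserving_pi (fun _ => volume.restrict (Ico (0 : ℝ) 1))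
    (fun _ => volume.restrict (Ico (0 : ℝ) 1)) (f := fun j t => tent (digitalAdd (x j) t))
    fun j => measurePreserving_tent.comp (hx j).measurePreserving_digitalAdd

/-- The exceptional shifts are those that move some coordinate to a dyadic rational; they form a
null set because the digital shift preserves measure. -/
lemma ae_shiftFold {r : ℕ} {x : Fin s → ℝ} (hx : ∀ j, IsDyadic r (x j)) :
    ∀ᵐ σ ∂(volume : Measure (Fin s → ℝ)).restrict (cube (Fin s)), shiftFold σ x ∈ cube (Fin s) ∧
      ∀ j i, rad i (shiftFold σ x j) = foldRad i (x j) * foldRad i (σ j) := by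
  have h : ∀ᵐ σ ∂(volume : Measure (Fin s → ℝ)).restrict (cube (Fin s)), ∀ j,
      IsNonDyadic (digitalAdd (x j) (σ j)) := by
    rw [restrict_cube_eq_pi, ae_all_iff]
    intro j
    have h1 : ∀ᵐ w ∂(volume : Measure ℝ).restrict (Ico 0 1), IsNonDyadic w :=
      ae_restrict_of_ae ae_isNonDyadic
    exact (Measure.quasiMeasurePreserving_eval (fun _ : Fin s => volume.restrict (Ico (0 : ℝ) 1)) j).ae
      ((hx j).measurePreserving_digitalAdd.quasiMeasurePreserving.ae h1)
  filter_upwards [h, ae_mem_cube (Fin s)] with σ hσ hσc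
  have hσj : ∀ j, σ j ∈ Ico (0 : ℝ) 1 := fun j => hσc j trivial
  refine ⟨fun j _ => (rad_tent ((hx j).digitalAdd_mem (hσj j)) (hσ j) 0).1, fun j i => ?_⟩
  rw [shiftFold, (rad_tent ((hx j).digitalAdd_mem (hσj j)) (hσ j) i).2]
  simp only [foldRad, (hx j).rad_digitalAdd (hσj j)]
  ring

lemma shiftFold_mem_closedCube {r : ℕ} {x σ : Fin s → ℝ} (hx : ∀ j, IsDyadic r (x j))
    (hσ : σ ∈ cube (Fin s)) : shiftFold σ x ∈ closedCube (Fin s) :=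
  fun j _ => tent_mem_Icc (Ico_subset_Icc_self ((hx j).digitalAdd_mem (hσ j trivial)))

lemma exists_kernel_bound {α : ℕ} (hα : 2 ≤ α) (γ : Finset (Fin s) → ℝ) :
    ∃ M, ∀ x ∈ closedCube (Fin s), ∀ z ∈ closedCube (Fin s), |kernel α γ x z| ≤ M := by
  obtain ⟨M, hM⟩ := ((isCompact_closedCube (Fin s)).prod
    (isCompact_closedCube (Fin s))).exists_bound_of_continuousOn
    (continuous_kernel hα γ).continuousOn
  exact ⟨M, fun x hx z hz => hM (x, z) ⟨hx, hz⟩⟩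

lemma integrable_kernel_shiftFold {α : ℕ} (hα : 2 ≤ α) (γ : Finset (Fin s) → ℝ) {r : ℕ}
    {x y : Fin s → ℝ} (hx : ∀ j, IsDyadic r (x j)) (hy : ∀ j, IsDyadic r (y j)) :
    Integrable (fun σ => kernel α γ (shiftFold σ x) (shiftFold σ y))
      (volume.restrict (cube (Fin s))) := by
  obtain ⟨M, hM⟩ := exists_kernel_bound hα γ
  refine Integrable.of_bound ((continuous_kernel hα γ).measurable.comp
    ((measurePreserving_shiftFold hx).measurable.prodMk
      (measurePreserving_shiftFold hy).measurable)).aestronglyMeasurable M ?_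
  filter_upwards [ae_mem_cube (Fin s)] with σ hσ
  exact hM _ (shiftFold_mem_closedCube hx hσ) _ (shiftFold_mem_closedCube hy hσ)

/-! ### Box sums of Walsh coefficients -/

lemma abs_walshDirichlet_le (R : ℕ) (b b₀ : ℝ) : |walshDirichlet R b b₀| ≤ 2 ^ R := by
  rw [walshDirichlet, Finset.abs_prod]
  refine (Finset.prod_le_prod (g := fun _ => (2 : ℝ)) (fun _ _ => abs_nonneg _)
    fun i _ => ?_).trans (by simp)
  refine (abs_add_le _ _).trans ?_
  rw [abs_mul, abs_rad, abs_rad, abs_one]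
  norm_num

/-- The finite box `{0, …, 2 ^ R - 1}^s`. -/
def dyadicBox (s R : ℕ) : Finset (Fin s → ℕ) := Fintype.piFinset fun _ => Finset.range (2 ^ R)

/-- A sum over a box of products of signs factorises over coordinates and binary digits. -/
lemma sum_walshMulti (R : ℕ) (a b x y : Fin s → ℝ) :
    ∑ l ∈ dyadicBox s R, walshMulti l a * walshMulti l b *
        (walshMulti (fun j => evenLift (l j)) x * walshMulti (fun j => evenLift (l j)) y) =
      ∏ j, ∏ i ∈ Finset.range R, (1 + rad i (a j) * rad i (b j) *
        (foldRad i (x j) * foldRad i (y j))) := by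
  simp only [← sum_prod_pow_natDigit]
  rw [Finset.prod_univ_sum, dyadicBox]
  refine Finset.sum_congr rfl fun l hl => ?_
  simp only [walshMulti, ← Finset.prod_mul_distrib]
  refine Finset.prod_congr rfl fun j _ => ?_
  have hj : l j < 2 ^ R := Finset.mem_range.1 (Fintype.mem_piFinset.1 hl j)
  rw [walsh_eq_prod hj, walsh_eq_prod hj, walsh_evenLift hj, walsh_evenLift hj]
  simp only [← Finset.prod_mul_distrib, mul_pow]

lemma integrable_kernel_prod {α : ℕ} (hα : 2 ≤ α) (γ : Finset (Fin s) → ℝ) :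
    Integrable (fun z : (Fin s → ℝ) × (Fin s → ℝ) => kernel α γ z.1 z.2)
      ((volume.restrict (cube (Fin s))).prod (volume.restrict (cube (Fin s)))) := by
  obtain ⟨M, hM⟩ := exists_kernel_bound hα γ
  refine Integrable.of_bound (continuous_kernel hα γ).aestronglyMeasurable M ?_
  filter_upwards [Measure.quasiMeasurePreserving_fst.ae (ae_mem_cube (Fin s)),
    Measure.quasiMeasurePreserving_snd.ae (ae_mem_cube (Fin s))] with z h1 h2
  exact hM _ (cube_subset_closedCube _ h1) _ (cube_subset_closedCube _ h2)

lemma foldRad_mul_self (i : ℕ) (x : ℝ) : foldRad i x * foldRad i x = 1 := by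
  rw [foldRad, mul_mul_mul_comm, rad_mul_self, rad_mul_self, one_mul]

/-- The box sum is the integral of `kernel a b` against a product of digit signs. Substituting `a =
shiftFold σ x` preserves measure, and the signs of `a`, `x` and `y` then multiply, because the
square of `foldRad i (x j)` is `1`, to the sign of `shiftFold σ y`. What is left is the Dirichlet
kernel at that point. -/
lemma boxSum_eq {α : ℕ} (hα : 2 ≤ α) (γ : Finset (Fin s) → ℝ) {r : ℕ} {x y : Fin s → ℝ}
    (hx : ∀ j, IsDyadic r (x j)) (hy : ∀ j, IsDyadic r (y j)) (R : ℕ) :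
    Integrable (fun σ => ∫ b in cube (Fin s), kernel α γ (shiftFold σ x) b *
        ∏ j, walshDirichlet R (b j) (shiftFold σ y j)) (volume.restrict (cube (Fin s))) ∧
    ∑ l ∈ dyadicBox s R, kernelWalshCoeff α γ l l *
        (walshMulti (fun j => evenLift (l j)) x * walshMulti (fun j => evenLift (l j)) y) =
      ∫ σ in cube (Fin s), ∫ b in cube (Fin s), kernel α γ (shiftFold σ x) b *
        ∏ j, walshDirichlet R (b j) (shiftFold σ y j) := by
  set μ := (volume : Measure (Fin s → ℝ)).restrict (cube (Fin s)) with hμ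
  have hK := integrable_kernel_prod hα γ
  have hterm : ∀ l : Fin s → ℕ, Integrable (fun z : (Fin s → ℝ) × (Fin s → ℝ) =>
      kernel α γ z.1 z.2 * walshMulti l z.1 * walshMulti l z.2) (μ.prod μ) := by
    intro l
    refine (hK.mul_bdd (c := 1)
      ((measurable_walshMulti l).comp measurable_fst).aestronglyMeasurable
      (.of_forall fun z => ?_)).mul_bdd (c := 1)
      ((measurable_walshMulti l).comp measurable_snd).aestronglyMeasurable
      (.of_forall fun z => ?_) <;> exact (abs_walshMulti l _).le
  set D : (Fin s → ℝ) × (Fin s → ℝ) → ℝ := fun z => ∏ j, ∏ i ∈ Finset.range R,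
    (1 + rad i (z.1 j) * rad i (z.2 j) * (foldRad i (x j) * foldRad i (y j))) with hD
  have hsum : ∀ z : (Fin s → ℝ) × (Fin s → ℝ), kernel α γ z.1 z.2 * D z =
      ∑ l ∈ dyadicBox s R, kernel α γ z.1 z.2 * walshMulti l z.1 * walshMulti l z.2 *
        (walshMulti (fun j => evenLift (l j)) x * walshMulti (fun j => evenLift (l j)) y) := by
    intro z
    rw [hD]
    simp only [← sum_walshMulti, Finset.mul_sum]
    exact Finset.sum_congr rfl fun l _ => by ring
  have hint : Integrable (fun z => kernel α γ z.1 z.2 * D z) (μ.prod μ) := by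
    simp only [hsum]
    exact integrable_finsetSum _ fun l _ => (hterm l).mul_const _
  have hmp := measurePreserving_shiftFold hx
  have hmp2 := hmp.prod (MeasurePreserving.id μ)
  have hint2 := hmp2.integrable_comp_of_integrable hint
  have hae : ∀ᵐ σ ∂μ, (fun b => kernel α γ (shiftFold σ x) b * D (shiftFold σ x, b)) =
      fun b => kernel α γ (shiftFold σ x) b * ∏ j, walshDirichlet R (b j) (shiftFold σ y j) := by
    filter_upwards [ae_shiftFold hx, ae_shiftFold hy] with σ h1 h2
    funext b
    congr 1
    refine Finset.prod_congr rfl fun j _ => Finset.prod_congr rfl fun i _ => ?_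
    congr 1
    dsimp only
    rw [h1.2, h2.2]
    linear_combination (foldRad i (σ j) * rad i (b j) * foldRad i (y j)) *
      foldRad_mul_self i (x j)
  have hae2 : (fun σ => ∫ b, kernel α γ (shiftFold σ x) b * D (shiftFold σ x, b) ∂μ) =ᵐ[μ]
      fun σ => ∫ b, kernel α γ (shiftFold σ x) b *
        ∏ j, walshDirichlet R (b j) (shiftFold σ y j) ∂μ := by
    filter_upwards [hae] with σ hσ
    rw [hσ]
  refine ⟨hint2.integral_prod_left.congr hae2, ?_⟩
  rw [← integral_congr_ae hae2]
  calc ∑ l ∈ dyadicBox s R, kernelWalshCoeff α γ l l *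
        (walshMulti (fun j => evenLift (l j)) x * walshMulti (fun j => evenLift (l j)) y)
      = ∫ z, kernel α γ z.1 z.2 * D z ∂μ.prod μ := by
        simp only [hsum]
        rw [integral_finsetSum _ fun l _ => (hterm l).mul_const _]
        refine Finset.sum_congr rfl fun l _ => ?_
        rw [integral_mul_const, integral_prod _ (hterm l), kernelWalshCoeff]
    _ = ∫ z, kernel α γ (shiftFold z.1 x) z.2 * D (shiftFold z.1 x, z.2) ∂μ.prod μ := by
        conv_lhs => rw [← hmp2.map_eq]
        rw [integral_map hmp2.measurable.aemeasurable]
        · rfl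
        · rw [hmp2.map_eq]
          exact hint.aestronglyMeasurable
    _ = _ := integral_prod _ hint2

/-- The Dirichlet product is an approximate identity: nonnegative, of integral one, and zero outside
a dyadic cell around `b₀`. -/
lemma abs_integral_mul_walshDirichlet_sub_le {R : ℕ} {g : (Fin s → ℝ) → ℝ} (hg : Continuous g)
    {b₀ : Fin s → ℝ} (hb₀ : b₀ ∈ cube (Fin s)) {ε : ℝ}
    (hε : ∀ b ∈ cube (Fin s), (∀ j, |b j - b₀ j| ≤ (1 / 2) ^ R) → |g b - g b₀| ≤ ε) :
    |(∫ b in cube (Fin s), g b * ∏ j, walshDirichlet R (b j) (b₀ j)) - g b₀| ≤ ε := by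
  have hint1 : ∫ b in cube (Fin s), ∏ j, walshDirichlet R (b j) (b₀ j) = 1 := by
    rw [integral_cube_prod fun j t => walshDirichlet R t (b₀ j)]
    exact Finset.prod_eq_one fun j _ => integral_walshDirichlet R (hb₀ j trivial)
  have hmeas : Measurable fun b : Fin s → ℝ => ∏ j, walshDirichlet R (b j) (b₀ j) :=
    Finset.measurable_prod _ fun j _ => (measurable_walshDirichlet R (b₀ j)).comp
      (measurable_pi_apply j)
  have hbd : ∀ b : Fin s → ℝ, ‖∏ j, walshDirichlet R (b j) (b₀ j)‖ ≤ (2 ^ R) ^ s := by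
    intro b
    rw [Real.norm_eq_abs, Finset.abs_prod]
    exact (Finset.prod_le_prod (fun _ _ => abs_nonneg _)
      fun j _ => abs_walshDirichlet_le R _ _).trans (by simp)
  have hDint : Integrable (fun b : Fin s → ℝ => ∏ j, walshDirichlet R (b j) (b₀ j))
      (volume.restrict (cube (Fin s))) :=
    Integrable.of_bound hmeas.aestronglyMeasurable _ (.of_forall hbd)
  have hgint : IntegrableOn g (cube (Fin s)) :=
    (hg.continuousOn.integrableOn_compact (isCompact_closedCube (Fin s))).mono_set
      (cube_subset_closedCube _)
  have hgD := hgint.mul_bdd hmeas.aestronglyMeasurable (.of_forall hbd)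
  have e : (∫ b in cube (Fin s), g b * ∏ j, walshDirichlet R (b j) (b₀ j)) - g b₀ =
      ∫ b in cube (Fin s), (g b - g b₀) * ∏ j, walshDirichlet R (b j) (b₀ j) := by
    simp only [sub_mul]
    rw [integral_sub hgD (hDint.const_mul _), integral_const_mul, hint1, mul_one]
  rw [e, ← Real.norm_eq_abs]
  refine (norm_integral_le_of_norm_le (hDint.const_mul ε) ?_).trans
    (by rw [integral_const_mul, hint1, mul_one])
  filter_upwards [ae_mem_cube (Fin s)] with b hb
  have hnn : ∀ j, 0 ≤ walshDirichlet R (b j) (b₀ j) := fun j =>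
    walshDirichlet_nonneg R (hb j trivial) (hb₀ j trivial)
  have hnn' : 0 ≤ ∏ j, walshDirichlet R (b j) (b₀ j) := Finset.prod_nonneg fun j _ => hnn j
  rw [Real.norm_eq_abs, abs_mul, abs_of_nonneg hnn']
  rcases hnn'.eq_or_lt with h0 | h0
  · rw [← h0, mul_zero, mul_zero]
  · refine mul_le_mul_of_nonneg_right (hε b hb fun j => ?_) hnn'
    exact abs_sub_le_of_walshDirichlet_ne_zero (hb j trivial) (hb₀ j trivial)
      (Finset.prod_ne_zero_iff.1 h0.ne' j (Finset.mem_univ j))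

/-- Uniform continuity of the kernel on the compact cube makes the approximation error small
uniformly in the shift. No summability of the coefficients enters; it is a consequence later on. -/
lemma tendsto_boxSum {α : ℕ} (hα : 2 ≤ α) (γ : Finset (Fin s) → ℝ) {r : ℕ} {x y : Fin s → ℝ}
    (hx : ∀ j, IsDyadic r (x j)) (hy : ∀ j, IsDyadic r (y j)) :
    Filter.Tendsto (fun R => ∑ l ∈ dyadicBox s R, kernelWalshCoeff α γ l l *
        (walshMulti (fun j => evenLift (l j)) x * walshMulti (fun j => evenLift (l j)) y))
      Filter.atTop
      (nhds (∫ σ in cube (Fin s), kernel α γ (shiftFold σ x) (shiftFold σ y))) := by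
  rw [Metric.tendsto_atTop]
  intro ε hε
  have huc := ((isCompact_closedCube (Fin s)).prod
    (isCompact_closedCube (Fin s))).uniformContinuousOn_of_continuous
    (continuous_kernel hα γ).continuousOn
  obtain ⟨δ, hδ, hd⟩ := Metric.uniformContinuousOn_iff.1 huc (ε / 2) (half_pos hε)
  obtain ⟨R₀, hR₀⟩ := exists_pow_lt_of_lt_one hδ (show (1 / 2 : ℝ) < 1 by norm_num)
  refine ⟨R₀, fun R hR => ?_⟩
  obtain ⟨hint, he⟩ := boxSum_eq hα γ hx hy R
  rw [he, Real.dist_eq, ← integral_sub hint (integrable_kernel_shiftFold hα γ hx hy)]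
  rw [← Real.norm_eq_abs]
  refine (norm_integral_le_of_norm_le_const (C := ε / 2) ?_).trans_lt
    (by rw [probReal_univ, mul_one]; exact half_lt_self hε)
  filter_upwards [ae_shiftFold hx, ae_shiftFold hy] with σ h1 h2
  refine abs_integral_mul_walshDirichlet_sub_le
    ((continuous_kernel hα γ).comp (continuous_const.prodMk continuous_id)) h2.1 fun b hb hbj => ?_
  have hlt : (1 / 2 : ℝ) ^ R < δ :=
    (pow_le_pow_of_le_one (by norm_num) (by norm_num) hR).trans_lt hR₀
  refine (hd (shiftFold σ x, b) ⟨cube_subset_closedCube _ h1.1, cube_subset_closedCube _ hb⟩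
    (shiftFold σ x, shiftFold σ y)
    ⟨cube_subset_closedCube _ h1.1, cube_subset_closedCube _ h2.1⟩ ?_).le
  rw [Prod.dist_eq, dist_self]
  refine max_lt hδ ((dist_pi_lt_iff hδ).2 fun j => ?_)
  exact (hbj j).trans_lt hlt

end
end FoldedLattice

/-! ### Laurent series and the character property of the polynomial lattice. -/

namespace FoldedLattice
noncomputable section
open MeasureTheory Set Polynomial
open scoped ContDiff

variable {s : ℕ}

/-! ### Digits of the lattice points -/

lemma sum_two_pow_lt {d : ℕ → ℕ} (hd : ∀ i, d i < 2) (r : ℕ) :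
    ∑ i ∈ Finset.range r, d i * 2 ^ i < 2 ^ r := by
  induction r with
  | zero => simp
  | succ r ih =>
    rw [Finset.sum_range_succ, pow_succ]
    have : d r * 2 ^ r ≤ 1 * 2 ^ r := Nat.mul_le_mul_right _ (Nat.lt_succ_iff.1 (hd r))
    omega

lemma natDigit_sum_two_pow {d : ℕ → ℕ} (hd : ∀ i, d i < 2) {r i : ℕ} (hi : i < r) :
    natDigit (∑ i ∈ Finset.range r, d i * 2 ^ i) i = d i := by
  induction i generalizing d r with
  | zero =>
    obtain ⟨r, rfl⟩ := Nat.exists_eq_succ_of_ne_zero hi.ne'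
    rw [Finset.sum_range_succ']
    have : ∑ i ∈ Finset.range r, d (i + 1) * 2 ^ (i + 1) =
        2 * ∑ i ∈ Finset.range r, d (i + 1) * 2 ^ i := by
      rw [Finset.mul_sum]
      exact Finset.sum_congr rfl fun i _ => by ring
    rw [this, natDigit]
    have := hd 0
    omega
  | succ i ih =>
    obtain ⟨r, rfl⟩ := Nat.exists_eq_succ_of_ne_zero (Nat.ne_zero_of_lt hi)
    rw [Finset.sum_range_succ', natDigit_succ]
    have : ∑ i ∈ Finset.range r, d (i + 1) * 2 ^ (i + 1) =
        2 * ∑ i ∈ Finset.range r, d (i + 1) * 2 ^ i := by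
      rw [Finset.mul_sum]
      exact Finset.sum_congr rfl fun i _ => by ring
    have hhalf : (2 * (∑ i ∈ Finset.range r, d (i + 1) * 2 ^ i) + d 0 * 2 ^ 0) / 2 =
        ∑ i ∈ Finset.range r, d (i + 1) * 2 ^ i := by
      have := hd 0
      omega
    rw [this, hhalf]
    exact ih (fun i => hd (i + 1)) (by omega)

/-- The integer `X` carries the coefficient of index `l` at bit `r - l`, matching the digit order
for points `X / 2 ^ r`. -/
lemma exists_laurentToReal_eq (r : ℕ) (L : LaurentSeries (ZMod 2)) :
    ∃ X : ℕ, X < 2 ^ r ∧ laurentToReal r L = (X : ℝ) / 2 ^ r ∧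
      ∀ i < r, natDigit X (r - 1 - i) = (L.coeff ((i + 1 : ℕ) : ℤ)).val := by
  have hd : ∀ i, (fun i : ℕ => (L.coeff ((r - i : ℕ) : ℤ)).val) i < 2 := fun i => ZMod.val_lt _
  refine ⟨_, sum_two_pow_lt hd r, ?_, fun i hi => ?_⟩
  · rw [laurentToReal, Nat.cast_sum, Finset.sum_div]
    refine Finset.sum_nbij' (fun l => r - l) (fun i => r - i) ?_ ?_ ?_ ?_ ?_
    · intro l hl
      rw [Finset.mem_Icc] at hl
      exact Finset.mem_range.2 (by omega)
    · intro i hi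
      rw [Finset.mem_range] at hi
      exact Finset.mem_Icc.2 (by omega)
    · intro l hl
      rw [Finset.mem_Icc] at hl
      omega
    · intro i hi
      rw [Finset.mem_range] at hi
      omega
    · intro l hl
      rw [Finset.mem_Icc] at hl
      have h1 : r - (r - l) = l := by omega
      have h2 : (2 : ℝ) ^ r = 2 ^ (r - l) * 2 ^ l := by
        rw [← pow_add]
        congr 1
        omega
      rw [h1, h2]
      push_cast
      field_simp
  · rw [natDigit_sum_two_pow hd (by omega)]
    congr 3
    omega

lemma isDyadic_laurentToReal (r : ℕ) (L : LaurentSeries (ZMod 2)) :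
    IsDyadic r (laurentToReal r L) := by
  obtain ⟨X, hX, h, -⟩ := exists_laurentToReal_eq r L
  exact ⟨X, hX, h⟩

/-- The nontrivial additive character of `ZMod 2`. -/
def signChar (t : ZMod 2) : ℝ := (-1) ^ t.val

lemma signChar_zero : signChar 0 = 1 := by simp [signChar]

lemma signChar_one : signChar 1 = -1 := by
  rw [signChar, show ((1 : ZMod 2)).val = 1 from rfl, pow_one]

lemma signChar_add (a b : ZMod 2) : signChar (a + b) = signChar a * signChar b := by
  rw [signChar, signChar, signChar, ← pow_add, ZMod.val_add, ← neg_one_pow_eq_pow_mod_two]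

lemma signChar_sum {ι : Type*} (S : Finset ι) (f : ι → ZMod 2) :
    signChar (∑ i ∈ S, f i) = ∏ i ∈ S, signChar (f i) := by
  classical
  induction S using Finset.induction_on with
  | empty => simp [signChar_zero]
  | insert i S hi ih => rw [Finset.sum_insert hi, Finset.prod_insert hi, signChar_add, ih]

lemma signChar_natCast_mul (n : ℕ) (t : ZMod 2) : signChar (n * t) = signChar t ^ n := by
  induction n with
  | zero => simp [signChar_zero]
  | succ n ih => rw [Nat.cast_succ, add_mul, one_mul, signChar_add, ih, pow_succ]

lemma one_add_signChar (t : ZMod 2) : 1 + signChar t = if t = 0 then 2 else 0 := by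
  have h : ∀ t : ZMod 2, t = 0 ∨ t = 1 := by decide
  rcases h t with rfl | rfl
  · rw [signChar_zero, if_pos rfl]
    norm_num
  · rw [signChar_one, if_neg one_ne_zero]
    norm_num

lemma rad_laurentToReal (r : ℕ) (L : LaurentSeries (ZMod 2)) (i : ℕ) :
    rad i (laurentToReal r L) =
      if i < r then signChar (L.coeff ((i + 1 : ℕ) : ℤ)) else 1 := by
  obtain ⟨X, -, h, hd⟩ := exists_laurentToReal_eq r L
  have h0 : (0 : ℝ) ∈ Ico (0 : ℝ) 1 := ⟨le_rfl, one_pos⟩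
  have e : (X : ℝ) / 2 ^ r = (X + 0) / 2 ^ r := by rw [add_zero]
  rw [rad, h, e]
  split_ifs with hi
  · rw [val_digits_of_lt h0 hi, hd i hi, signChar]
  · rw [val_digits_of_le h0 (not_lt.1 hi)]
    simp

/-- The point has no nonzero digits beyond the first `r`, so only the `r` lowest digits of `k`
matter. This is why the dual lattice is defined with truncated polynomials. -/
lemma walsh_laurentToReal (r : ℕ) (L : LaurentSeries (ZMod 2)) (k : ℕ) :
    walsh k (laurentToReal r L) =
      signChar (∑ i ∈ Finset.range r, (natDigit k i : ZMod 2) * L.coeff ((i + 1 : ℕ) : ℤ)) := by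
  -- The bound `r + k` exceeds the size of `k` and also contains the range `r` in question.
  have hk : k < 2 ^ (r + k) :=
    Nat.lt_two_pow_self.trans_le (Nat.pow_le_pow_right two_pos (Nat.le_add_left _ _))
  rw [walsh_eq_prod hk, signChar_sum]
  simp only [signChar_natCast_mul]
  rw [← Finset.prod_subset (Finset.range_subset_range.2 (Nat.le_add_right r k))]
  · exact Finset.prod_congr rfl fun i hi => by
      rw [rad_laurentToReal, if_pos (Finset.mem_range.1 hi)]
  · intro i _ hi
    rw [rad_laurentToReal, if_neg (fun h => hi (Finset.mem_range.2 h)), one_pow]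

/-! ### Polynomials as Laurent series in `x⁻¹` -/

/-- `polyToLaurent` as a ring homomorphism. -/
def polyToLaurentHom : (ZMod 2)[X] →+* LaurentSeries (ZMod 2) :=
  (Polynomial.aeval (HahnSeries.single (-1 : ℤ) (1 : ZMod 2) : LaurentSeries (ZMod 2))).toRingHom

lemma polyToLaurent_eq (f : (ZMod 2)[X]) : polyToLaurent f = polyToLaurentHom f := rfl

lemma polyToLaurentHom_monomial (n : ℕ) (a : ZMod 2) :
    polyToLaurentHom (monomial n a) = HahnSeries.single (-(n : ℤ)) a := by
  change Polynomial.aeval _ (monomial n a) = _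
  rw [Polynomial.aeval_monomial, HahnSeries.single_pow, one_pow, nsmul_eq_mul, mul_neg_one]
  have h : ∀ t : ZMod 2, t = 0 ∨ t = 1 := by decide
  rcases h a with rfl | rfl
  · rw [map_zero, zero_mul, HahnSeries.single_eq_zero]
  · rw [map_one, one_mul]

lemma coeff_polyToLaurentHom (f : (ZMod 2)[X]) (l : ℤ) :
    (polyToLaurentHom f).coeff l = if l ≤ 0 then f.coeff (-l).toNat else 0 := by
  induction f using Polynomial.induction_on' with
  | add f g hf hg =>
    rw [map_add, HahnSeries.coeff_add, hf, hg]
    split_ifs <;> simp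
  | monomial n a =>
    rw [polyToLaurentHom_monomial, HahnSeries.coeff_single, Polynomial.coeff_monomial]
    by_cases hl : l ≤ 0
    · rw [if_pos hl]
      by_cases h : l = -(n : ℤ)
      · rw [if_pos h, if_pos (by omega)]
      · rw [if_neg h, if_neg (by omega)]
    · rw [if_neg hl, if_neg (by omega)]

/-- The residue pairing: matching the digits of a polynomial with successive coefficients of `L` is
taking the coefficient of `x⁻¹` in the product. -/
lemma coeff_polyToLaurentHom_mul (f : (ZMod 2)[X]) (L : LaurentSeries (ZMod 2)) {r : ℕ}
    (d : ℕ → ZMod 2) (hf : f = ∑ i ∈ Finset.range r, C (d i) * X ^ i) :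
    (polyToLaurentHom f * L).coeff 1 =
      ∑ i ∈ Finset.range r, d i * L.coeff ((i + 1 : ℕ) : ℤ) := by
  rw [hf, map_sum, Finset.sum_mul, HahnSeries.coeff_sum]
  refine Finset.sum_congr rfl fun i _ => ?_
  rw [C_mul_X_pow_eq_monomial, polyToLaurentHom_monomial]
  have : (1 : ℤ) = -(i : ℤ) + ((i + 1 : ℕ) : ℤ) := by
    push_cast
    ring
  conv_lhs => rw [this]
  rw [add_comm, HahnSeries.coeff_single_mul_add]

lemma polyToLaurentHom_ne_zero {f : (ZMod 2)[X]} (hf : f ≠ 0) : polyToLaurentHom f ≠ 0 := by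
  intro h
  have h1 := coeff_polyToLaurentHom f (-(f.natDegree : ℤ))
  rw [h, if_pos (by omega), neg_neg, Int.toNat_natCast, coeff_natDegree] at h1
  exact hf (leadingCoeff_eq_zero.1 h1.symm)

lemma order_polyToLaurentHom {f : (ZMod 2)[X]} (hf : f ≠ 0) :
    (polyToLaurentHom f).order = -(f.natDegree : ℤ) := by
  apply le_antisymm
  · apply HahnSeries.order_le_of_coeff_ne_zero
    rw [coeff_polyToLaurentHom, if_pos (by omega), neg_neg, Int.toNat_natCast, coeff_natDegree]
    exact leadingCoeff_ne_zero.2 hf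
  · have h := HahnSeries.coeff_order_eq_zero.not.2 (polyToLaurentHom_ne_zero hf)
    rw [coeff_polyToLaurentHom] at h
    split_ifs at h with h0
    · have := le_natDegree_of_ne_zero h
      omega
    · exact absurd rfl h

/-- For nonzero `b` the quotient has order `m' - deg b` in `x⁻¹`; its first `m` coefficients vanish
exactly if this order exceeds `m`. -/
lemma coeff_div_eq_zero_iff {p b : (ZMod 2)[X]} {m m' : ℕ} (hp : p.degree = m')
    (hb : b.degree < m') (hm : m ≤ m') :
    (∀ i < m, (polyToLaurentHom b / polyToLaurentHom p).coeff ((i + 1 : ℕ) : ℤ) = 0) ↔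
      b.degree < ((m' - m : ℕ) : WithBot ℕ) := by
  have hp0 : p ≠ 0 := by
    rintro rfl
    simp at hp
  rcases eq_or_ne b 0 with rfl | hb0
  · simp
  set y := polyToLaurentHom b / polyToLaurentHom p with hy
  have hP := polyToLaurentHom_ne_zero hp0
  have hB := polyToLaurentHom_ne_zero hb0
  have hmul : y * polyToLaurentHom p = polyToLaurentHom b := div_mul_cancel₀ _ hP
  have hy0 : y ≠ 0 := div_ne_zero hB hP
  have hord : y.order = (m' : ℤ) - b.natDegree := by
    have h := HahnSeries.order_mul hy0 hP
    rw [hmul, order_polyToLaurentHom hb0, order_polyToLaurentHom hp0,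
      natDegree_eq_of_degree_eq_some hp] at h
    omega
  rw [degree_eq_natDegree hb0] at hb ⊢
  rw [Nat.cast_lt] at hb ⊢
  constructor
  · intro h
    by_contra hlt
    refine HahnSeries.coeff_order_eq_zero.not.2 hy0 ?_
    rw [hord, ← h (m' - b.natDegree - 1) (by omega)]
    congr 1
    omega
  · intro h i hi
    refine HahnSeries.coeff_eq_zero_of_lt_order ?_
    rw [hord]
    omega

/-- Division by `p` with remainder changes the quotient series by a polynomial, which has no
coefficients at negative powers of `x`. The witness `a` of small degree can only be the remainder.
-/
lemma mem_dualLattice_iff {m m' : ℕ} (hmm' : m ≤ m') {p : (ZMod 2)[X]} (hp : p.degree = m')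
    (q : Fin s → (ZMod 2)[X]) (k : Fin s → ℕ) :
    k ∈ dualLattice m m' q p ↔ ∀ i < m, (polyToLaurentHom (∑ j, truncPoly m' (k j) * q j) /
      polyToLaurentHom p).coeff ((i + 1 : ℕ) : ℤ) = 0 := by
  set Q := ∑ j, truncPoly m' (k j) * q j with hQ
  have hp0 : p ≠ 0 := by
    rintro rfl
    simp at hp
  have hdiv : ∀ i : ℕ, (polyToLaurentHom Q / polyToLaurentHom p).coeff ((i + 1 : ℕ) : ℤ) =
      (polyToLaurentHom (Q % p) / polyToLaurentHom p).coeff ((i + 1 : ℕ) : ℤ) := by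
    intro i
    have hP := polyToLaurentHom_ne_zero hp0
    have : polyToLaurentHom Q / polyToLaurentHom p =
        polyToLaurentHom (Q / p) + polyToLaurentHom (Q % p) / polyToLaurentHom p := by
      field_simp
      rw [← map_mul, ← map_add]
      congr 1
      exact (EuclideanDomain.div_add_mod Q p).symm
    rw [this, HahnSeries.coeff_add, coeff_polyToLaurentHom, if_neg (by omega), zero_add]
  simp only [hdiv]
  rw [coeff_div_eq_zero_iff hp (hp ▸ EuclideanDomain.mod_lt Q hp0) hmm']
  constructor
  · rintro ⟨a, ha, hdvd⟩
    have hap : a.degree < p.degree := by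
      rw [hp]
      exact ha.trans_le (by exact_mod_cast Nat.sub_le m' m)
    have : Q % p = a := by
      rw [← mod_eq_self_iff hp0 |>.2 hap, ← sub_eq_zero, ← sub_mod]
      exact EuclideanDomain.mod_eq_zero.2 hdvd
    rwa [this]
  · intro h
    refine ⟨Q % p, h, ⟨Q / p, ?_⟩⟩
    rw [sub_eq_iff_eq_add, EuclideanDomain.div_add_mod]

/-! ### The character property of the lattice -/

lemma natPoly_eq {m n : ℕ} (hn : n < 2 ^ m) :
    natPoly n = ∑ i ∈ Finset.range m, C (natDigit n i : ZMod 2) * X ^ i := by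
  rw [natPoly, truncPoly]
  refine Finset.sum_subset (Finset.range_subset_range.2 (Nat.size_le.2 hn)) fun i _ hi => ?_
  rw [natDigit_eq_zero (Nat.size_le.1 (not_lt.1 fun h => hi (Finset.mem_range.2 h)))]
  simp

/-- The Walsh value is a residue of `n(x)` times a series independent of `n`. Reading the pairing
from the side of `n` exhibits the value as a character in the binary digits of `n`. -/
lemma walshMulti_latticePoint {m m' n : ℕ} (hn : n < 2 ^ m) (q : Fin s → (ZMod 2)[X])
    (p : (ZMod 2)[X]) (k : Fin s → ℕ) :
    walshMulti k (latticePoint m' q p n) = ∏ i ∈ Finset.range m,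
      signChar ((polyToLaurentHom (∑ j, truncPoly m' (k j) * q j) /
        polyToLaurentHom p).coeff ((i + 1 : ℕ) : ℤ)) ^ natDigit n i := by
  have hj : ∀ j, walsh (k j) (latticePoint m' q p n j) =
      signChar ((polyToLaurentHom (natPoly n) * (polyToLaurentHom (truncPoly m' (k j) * q j) /
        polyToLaurentHom p)).coeff 1) := by
    intro j
    rw [latticePoint, walsh_laurentToReal,
      ← coeff_polyToLaurentHom_mul (truncPoly m' (k j)) _ _ rfl, polyToLaurent_eq, polyToLaurent_eq,
      map_mul, map_mul]
    congr 2
    ring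
  have hn' := coeff_polyToLaurentHom_mul (natPoly n)
    (polyToLaurentHom (∑ j, truncPoly m' (k j) * q j) / polyToLaurentHom p) _ (natPoly_eq hn)
  rw [walshMulti, Finset.prod_congr rfl fun j _ => hj j, ← signChar_sum, ← HahnSeries.coeff_sum,
    ← Finset.mul_sum, ← Finset.sum_div, ← map_sum, hn', signChar_sum]
  exact Finset.prod_congr rfl fun i _ => signChar_natCast_mul _ _

-- The sum factorises into factors `1 + signChar c_i`, each `2` or `0`; all are `2` exactly when the
-- first `m` coefficients vanish.
open Classical in
lemma sum_walshMulti_latticePoint {m m' : ℕ} (hmm' : m ≤ m') {p : (ZMod 2)[X]}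
    (hp : p.degree = m') (q : Fin s → (ZMod 2)[X]) (k : Fin s → ℕ) :
    ∑ n ∈ Finset.range (2 ^ m), walshMulti k (latticePoint m' q p n) =
      if k ∈ dualLattice m m' q p then 2 ^ m else 0 := by
  rw [Finset.sum_congr rfl fun n hn =>
    walshMulti_latticePoint (Finset.mem_range.1 hn) q p k, sum_prod_pow_natDigit]
  simp only [one_add_signChar, mem_dualLattice_iff hmm' hp]
  split_ifs with h
  · rw [Finset.prod_congr rfl fun i hi => if_pos (h i (Finset.mem_range.1 hi))]
    simp
  · push Not at h
    obtain ⟨i, hi, h⟩ := h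
    exact Finset.prod_eq_zero (Finset.mem_range.2 hi) (if_neg h)

end
end FoldedLattice

/-! ### Assembly: mean square error as a sum over the dual lattice. -/

namespace FoldedLattice
noncomputable section
open MeasureTheory Set Polynomial
open scoped ContDiff

variable {s : ℕ}

/-! ### The mean square worst-case error -/

lemma isDyadic_latticePoint (m' : ℕ) (q : Fin s → (ZMod 2)[X]) (p : (ZMod 2)[X]) (n : ℕ)
    (j : Fin s) : IsDyadic m' (latticePoint m' q p n j) :=
  isDyadic_laurentToReal m' _

lemma shiftedFoldedPoints_mem {m' : ℕ} {q : Fin s → (ZMod 2)[X]} {p : (ZMod 2)[X]}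
    {σ : Fin s → ℝ} (hσ : σ ∈ cube (Fin s)) (n : ℕ) :
    shiftedFoldedPoints m' q p σ n ∈ closedCube (Fin s) :=
  shiftFold_mem_closedCube (isDyadic_latticePoint m' q p n) hσ

lemma bddAbove_errorSet {α : ℕ} (hα : 2 ≤ α) {γ : Finset (Fin s) → ℝ} (hγ : ∀ u, 0 ≤ γ u) {N : ℕ}
    (hN : N ≠ 0) {m' : ℕ} {q : Fin s → (ZMod 2)[X]} {p : (ZMod 2)[X]} {σ : Fin s → ℝ}
    (hσ : σ ∈ cube (Fin s)) : BddAbove (errorSet α γ N (shiftedFoldedPoints m' q p σ)) :=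
  ⟨_, (isGreatest_errorSet hα hγ hN (shiftedFoldedPoints_mem hσ)).2.2⟩

lemma integrable_errorSq {α : ℕ} (hα : 2 ≤ α) (γ : Finset (Fin s) → ℝ) (N m' : ℕ)
    (q : Fin s → (ZMod 2)[X]) (p : (ZMod 2)[X]) :
    Integrable (fun σ => errorSq α γ N (shiftedFoldedPoints m' q p σ))
      (volume.restrict (cube (Fin s))) ∧
    ∫ σ in cube (Fin s), errorSq α γ N (shiftedFoldedPoints m' q p σ) =
      (1 / (N : ℝ)) * ∑ i ∈ Finset.range N, ((1 / (N : ℝ)) * ∑ n ∈ Finset.range N,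
        ((∫ σ in cube (Fin s), kernel α γ (shiftFold σ (latticePoint m' q p i))
          (shiftFold σ (latticePoint m' q p n))) - γ ∅)) := by
  have h : ∀ i n, Integrable (fun σ => kernel α γ (shiftedFoldedPoints m' q p σ i)
      (shiftedFoldedPoints m' q p σ n) - γ ∅) (volume.restrict (cube (Fin s))) := fun i n =>
    (integrable_kernel_shiftFold hα γ (isDyadic_latticePoint m' q p i)
      (isDyadic_latticePoint m' q p n)).sub (integrable_const _)
  have h2 : ∀ i, Integrable (fun σ => (1 / (N : ℝ)) * ∑ n ∈ Finset.range N,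
      (kernel α γ (shiftedFoldedPoints m' q p σ i) (shiftedFoldedPoints m' q p σ n) - γ ∅))
      (volume.restrict (cube (Fin s))) := fun i =>
    (integrable_finsetSum _ fun n _ => h i n).const_mul _
  unfold errorSq
  refine ⟨(integrable_finsetSum _ fun i _ => h2 i).const_mul _, ?_⟩
  rw [integral_const_mul, integral_finsetSum _ fun i _ => h2 i]
  congr 1
  refine Finset.sum_congr rfl fun i _ => ?_
  rw [integral_const_mul, integral_finsetSum _ fun n _ => h i n]
  congr 1
  refine Finset.sum_congr rfl fun n _ => ?_
  refine (integral_sub (integrable_kernel_shiftFold hα γ (isDyadic_latticePoint m' q p i)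
    (isDyadic_latticePoint m' q p n)) (integrable_const (γ ∅))).trans ?_
  simp

lemma monotone_dyadicBox (s : ℕ) : Monotone (dyadicBox s) := fun _ _ h =>
  Fintype.piFinset_subset _ _ fun _ =>
    Finset.range_subset_range.2 (Nat.pow_le_pow_right two_pos h)

lemma tendsto_dyadicBox (s : ℕ) : Filter.Tendsto (dyadicBox s) Filter.atTop Filter.atTop := by
  refine Filter.tendsto_atTop_finset_of_monotone (monotone_dyadicBox s) fun l => ?_
  refine ⟨∑ j, l j, Fintype.mem_piFinset.2 fun j => Finset.mem_range.2 ?_⟩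
  exact Nat.lt_two_pow_self.trans_le (Nat.pow_le_pow_right two_pos
    (Finset.single_le_sum (f := l) (fun _ _ => Nat.zero_le _) (Finset.mem_univ j)))

/-- For nonnegative terms every finite sum lies below some box sum, hence below the limit.
Convergence along one cofinal monotone sequence therefore already gives summability. -/
lemma hasSum_of_tendsto_of_nonneg {ι : Type*} {f : ι → ℝ} (hf : ∀ i, 0 ≤ f i)
    {B : ℕ → Finset ι} (hB : Monotone B) (hBt : Filter.Tendsto B Filter.atTop Filter.atTop)
    {S : ℝ} (h : Filter.Tendsto (fun R => ∑ i ∈ B R, f i) Filter.atTop (nhds S)) :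
    HasSum f S := by
  have hmono : Monotone fun R => ∑ i ∈ B R, f i := fun _ _ hR =>
    Finset.sum_le_sum_of_subset_of_nonneg (hB hR) fun i _ _ => hf i
  have hs : Summable f := summable_of_sum_le hf (c := S) fun u => by
    obtain ⟨R, hR⟩ := (hBt.eventually_ge_atTop u).exists
    exact (Finset.sum_le_sum_of_subset_of_nonneg hR fun i _ _ => hf i).trans
      (hmono.ge_of_tendsto h R)
  rw [← tendsto_nhds_unique (hs.hasSum.comp hBt) h]
  exact hs.hasSum

-- Averaging the box sums over pairs of points produces the square of the mean Walsh value, which is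
-- the indicator of the dual lattice. The limit exceeds the mean of `errorSq` by `γ ∅`, the constant
-- subtracted there.
open Classical in
lemma hasSum_kernelWalshCoeff {α : ℕ} (hα : 2 ≤ α) {γ : Finset (Fin s) → ℝ} (hγ : ∀ u, 0 ≤ γ u)
    {m m' : ℕ} (hmm' : m ≤ m') {p : (ZMod 2)[X]} (hp : p.degree = m')
    (q : Fin s → (ZMod 2)[X]) :
    HasSum (fun l : Fin s → ℕ => if (fun j => evenLift (l j)) ∈ dualLattice m m' q p then
        kernelWalshCoeff α γ l l else 0)
      ((∫ σ in cube (Fin s), errorSq α γ (2 ^ m) (shiftedFoldedPoints m' q p σ)) + γ ∅) := by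
  refine hasSum_of_tendsto_of_nonneg (fun l => ?_) (monotone_dyadicBox s) (tendsto_dyadicBox s) ?_
  · split_ifs
    exacts [kernelWalshCoeff_nonneg hα hγ l, le_rfl]
  set x := latticePoint m' q p with hx
  have hN : ((2 ^ m : ℕ) : ℝ) ≠ 0 := by positivity
  have hlim := (tendsto_finsetSum (Finset.range (2 ^ m)) fun i _ =>
    (tendsto_finsetSum (Finset.range (2 ^ m)) fun n _ =>
      tendsto_boxSum hα γ (isDyadic_latticePoint m' q p i)
        (isDyadic_latticePoint m' q p n)).const_mul (1 / ((2 ^ m : ℕ) : ℝ))).const_mul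
          (1 / ((2 ^ m : ℕ) : ℝ))
  refine (hlim.congr fun R => ?_).trans (le_of_eq ?_)
  · simp only [Finset.mul_sum]
    rw [Finset.sum_congr rfl fun i _ => Finset.sum_comm, Finset.sum_comm]
    refine Finset.sum_congr rfl fun l _ => ?_
    set w := fun n => walshMulti (fun j => evenLift (l j)) (x n) with hw
    -- The double sum over pairs of points is a perfect square, so a single character sum suffices.
    have e : ∑ i ∈ Finset.range (2 ^ m), ∑ n ∈ Finset.range (2 ^ m),
        1 / ((2 ^ m : ℕ) : ℝ) * (1 / ((2 ^ m : ℕ) : ℝ) *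
          (kernelWalshCoeff α γ l l * (w i * w n))) =
        kernelWalshCoeff α γ l l * (1 / ((2 ^ m : ℕ) : ℝ) * ∑ i ∈ Finset.range (2 ^ m), w i) ^ 2 := by
      rw [mul_pow, sq (∑ i ∈ Finset.range (2 ^ m), w i), Finset.sum_mul_sum]
      simp only [Finset.mul_sum]
      exact Finset.sum_congr rfl fun i _ => Finset.sum_congr rfl fun n _ => by ring
    rw [e, hw, hx, sum_walshMulti_latticePoint hmm' hp]
    split_ifs
    · push_cast
      rw [one_div, inv_mul_cancel₀ (by positivity)]
      ring
    · ring
  · rw [(integrable_errorSq hα γ (2 ^ m) m' q p).2]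
    congr 1
    simp only [Finset.sum_sub_distrib, Finset.sum_const, Finset.card_range, nsmul_eq_mul, mul_sub]
    field_simp
    ring

lemma evenLift_zero : evenLift 0 = 0 := by simp [evenLift, digitSum]

lemma zero_mem_dualLattice (m m' : ℕ) (q : Fin s → (ZMod 2)[X]) (p : (ZMod 2)[X]) :
    (0 : Fin s → ℕ) ∈ dualLattice m m' q p := by
  refine ⟨0, by simp, ?_⟩
  simp [truncPoly, natDigit]

lemma hasSum_of_eq {ι : Type*} {f g : ι → ℝ} {a : ℝ} (hf : HasSum f a) (h : ∀ i, g i = f i) :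
    HasSum g a := by
  rwa [show g = f from funext h]

lemma hasSum_evenDigitSum {α : ℕ} (hα : 2 ≤ α) {γ : Finset (Fin s) → ℝ} (hγ : ∀ u, 0 ≤ γ u)
    {m m' : ℕ} (hmm' : m ≤ m') {p : (ZMod 2)[X]} (hp : p.degree = m')
    (q : Fin s → (ZMod 2)[X]) :
    HasSum (fun k : {k : Fin s → ℕ // (∀ j, k j ∈ evenDigitSum₀) ∧ k ≠ 0 ∧
        k ∈ dualLattice m m' q p} =>
      kernelWalshCoeff α γ (fun j => k.1 j / 2) (fun j => k.1 j / 2))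
      (∫ σ in cube (Fin s), errorSq α γ (2 ^ m) (shiftedFoldedPoints m' q p σ)) := by
  classical
  -- Overwriting the term at `l = 0` removes exactly `γ ∅`: zero lies in the dual lattice and the
  -- coefficient there is `γ ∅`. Reindexing by halving then loses only zero terms.
  have h := (hasSum_kernelWalshCoeff hα hγ hmm' hp q).update 0 0
  have hz : (fun j : Fin s => evenLift ((0 : Fin s → ℕ) j)) = 0 := funext fun _ => evenLift_zero
  rw [hz, if_pos (zero_mem_dualLattice m m' q p), kernelWalshCoeff_zero hα, zero_sub,
    neg_add_cancel_comm_assoc] at h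
  have hinj : Function.Injective fun k : {k : Fin s → ℕ // (∀ j, k j ∈ evenDigitSum₀) ∧ k ≠ 0 ∧
      k ∈ dualLattice m m' q p} => fun j => k.1 j / 2 := by
    intro k k' hk
    refine Subtype.ext (funext fun j => ?_)
    rw [← evenLift_of_mem (k.2.1 j), ← evenLift_of_mem (k'.2.1 j)]
    exact congrArg evenLift (congrFun hk j)
  rw [← hinj.hasSum_iff] at h
  · refine hasSum_of_eq h fun k => ?_
    have hlift : (fun j => evenLift (k.1 j / 2)) = k.1 :=
      funext fun j => evenLift_of_mem (k.2.1 j)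
    have hne : (fun j => k.1 j / 2) ≠ 0 := by
      intro h0
      refine k.2.2.1 ?_
      rw [← hlift]
      funext j
      rw [show k.1 j / 2 = 0 from congrFun h0 j]
      exact evenLift_zero
    rw [Function.comp_apply, Function.update_of_ne hne, hlift, if_pos k.2.2.2]
  · intro l hl
    by_cases h0 : l = 0
    · rw [h0, Function.update_self]
    · rw [Function.update_of_ne h0, if_neg]
      intro hmem
      refine hl ⟨⟨fun j => evenLift (l j), fun j => evenLift_mem _, fun hk => h0 ?_, hmem⟩, ?_⟩
      · funext j
        rw [← evenLift_div_two (l j), congrFun hk j, Pi.zero_apply, Nat.zero_div]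
      · exact funext fun j => evenLift_div_two (l j)

end
end FoldedLattice

theorem theorem3p1 (s α m m' : ℕ) (hs : 1 ≤ s) (hα : 2 ≤ α) (hm : 1 ≤ m) (hmm' : m ≤ m')
    (γ : Finset (Fin s) → ℝ) (hγ : ∀ u, 0 ≤ γ u)
    (p : Polynomial (ZMod 2)) (hp : p.degree = m') (q : Fin s → Polynomial (ZMod 2)) :
    (∀ σ ∈ FoldedLattice.cube (Fin s),
      BddAbove (FoldedLattice.errorSet α γ (2 ^ m)
        (FoldedLattice.shiftedFoldedPoints m' q p σ))) ∧
    MeasureTheory.IntegrableOn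
      (fun σ => (FoldedLattice.worstCaseError α γ (2 ^ m)
        (FoldedLattice.shiftedFoldedPoints m' q p σ)) ^ 2)
      (FoldedLattice.cube (Fin s)) MeasureTheory.volume ∧
    HasSum
      (fun k : {k : Fin s → ℕ // (∀ j, k j ∈ FoldedLattice.evenDigitSum₀) ∧ k ≠ 0 ∧
          k ∈ FoldedLattice.dualLattice m m' q p} =>
        FoldedLattice.kernelWalshCoeff α γ (fun j => k.1 j / 2) (fun j => k.1 j / 2))
      (FoldedLattice.meanSquareError α γ m m' q p) := by
  have hN : 2 ^ m ≠ 0 := by positivity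
  have hsq : ∀ σ ∈ FoldedLattice.cube (Fin s), FoldedLattice.worstCaseError α γ (2 ^ m)
      (FoldedLattice.shiftedFoldedPoints m' q p σ) ^ 2 =
      FoldedLattice.errorSq α γ (2 ^ m) (FoldedLattice.shiftedFoldedPoints m' q p σ) :=
    fun σ hσ => FoldedLattice.worstCaseError_sq hα hγ hN
      (FoldedLattice.shiftedFoldedPoints_mem hσ)
  refine ⟨fun σ hσ => FoldedLattice.bddAbove_errorSet hα hγ hN hσ, ?_, ?_⟩
  · exact (MeasureTheory.integrableOn_congr_fun hsq
      (FoldedLattice.measurableSet_cube (Fin s))).2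
      (FoldedLattice.integrable_errorSq hα γ (2 ^ m) m' q p).1
  · rw [FoldedLattice.meanSquareError, MeasureTheory.setIntegral_congr_fun
      (FoldedLattice.measurableSet_cube (Fin s)) hsq]
    exact FoldedLattice.hasSum_evenDigitSum hα hγ hmm' hp q
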